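/- Let $\mathcal O$ be a cyclic operad in vector spaces over a field $k$, and let $\mathcal G^{\mathcal O}$ be its graph complex: the vector space spanned by finite, not necessarily connected, oriented graphs $G$ with all vertices of valence at least $3$ and with an element of $\mathcal O((H(v)))$ attached to every vertex $v$ ($H(v)$ being the set of half-edges at $v$), taken up to isomorphism, modulo multilinearity in the labels and modulo $(G,or)=-(G,-or)$. Here an orientation is an ordering of the vertices together with a direction of every edge, up to an even number of transpositions of vertices and reversals of edges. Grade $\mathcal G^{\mathcal O}$ by the number of vertices, and let $S\mathcal G^{\mathcal O}$ be its graded symmetric (co)algebra, with product $\odot$. For $n\ge 1$ and directed edges $e_1,\dots,e_n$ of a graph $G$ lying on distinct edges, let $G\langle e_1,\dots,e_n\rangle$ be the graph obtained by gluing every other side of an oriented $2n$-gon, in cyclic order, to $e_1,\dots,e_n$ and deleting these $n$ edges; so there are $n$ new edges, joining the head of $e_i$ to the tail of $e_{i+1}$ (indices mod $n$). If the orientation of $G$ directs the edges $e_i$ as given, the new edges are directed from the tail of $e_{i+1}$ to the head of $e_i$, and the rest of the orientation is kept. Contracting an edge that is not a loop composes the two labels at its ends along the edge; if the edge runs from the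 first vertex to the second one, the new vertex becomes the first one and the order of the others is kept. The contraction of a loop is $0$. Put $$\phi_n(G_1\odot\cdots\odot G_n)=\sum (G_1\cdot G_2\cdots G_n)\langle e_1,\dots,e_n\rangle_e ,$$ where $G_1\cdots G_n$ is the disjoint union, the sum is over all $n$-tuples of directed edges $e_1,\dots,e_n$ lying in separate graphs $G_i$, and the subscript $e$ means contraction of the new edge between $e_1$ and $e_2$. Extend $\phi_n$ to $S\mathcal G^{\mathcal O}$ as a coderivation: $$\phi_n(G_1\odot\cdots\odot G_m)=\sum_{I\sqcup J=\{1,\dots,m\},\ |I|=n}\epsilon(I,J)\,\phi_n(G_I)\odot G_J ,$$ where $\epsilon(I,J)$ is the Koszul sign with $G_1\odot\cdots\odot G_m=\epsilon(I,J)\,G_I\odot G_J$. These formulas determine a unique linear endomorphism $\phi_n$ of $S\mathcal G^{\mathcal O}$ for every $n\ge 1$. For every subset $I$ of $\mathbb N=\{1,2,\dots\}$, finite or infinite, let $\phi_I=\sum_{i\in I}\phi_i$; this sum is finite on every element of $S\mathcal G^{\mathcal O}$. Then $\phi_I^2=0$, and $\phi_I$ is a $Lie_\infty$ structure on $\mathcal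 G^{\mathcal O}$, i.e. a coderivation of $S\mathcal G^{\mathcal O}$ of degree $-1$ and of square zero. Moreover $\phi_I=\phi_J$ if and only if $I$ and $J$ contain the same indices $n$ with $\phi_n\neq 0$; in particular, if $\phi_n\ne 0$ for infinitely many $n$, then there are uncountably many different $Lie_\infty$ structures $\phi_I$. -/

import Mathlib

universe u w

/-! ### Cyclic operads -/

/-- The set obtained from two finite sets by removing a point from each and taking the disjoint
union: the free legs that remain when leg `x` of one corolla is joined to leg `y` of another. -/
abbrev GluedLegs {X Y : Type} (x : X) (y : Y) : Type := {a : X // a ≠ x} ⊕ {b : Y // b ≠ y}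

/-- Relabelling of the free legs along relabellings of the two corollas. -/
def gluedCongr {X Y X' Y' : Type} (x : X) (y : Y) (f : X ≃ X') (g : Y ≃ Y') :
    GluedLegs x y ≃ GluedLegs (f x) (g y) :=
  Equiv.sumCongr (f.subtypeEquiv fun a => by simp) (g.subtypeEquiv fun b => by simp)

/-- The two iterated gluings of a path of three corollas `X - Y - Z` (leg `x` to leg `y`, leg `y'`
to leg `z`) have the same free legs. -/
def gluedAssoc {X Y Z : Type} (x : X) (y y' : Y) (z : Z) (hy : y ≠ y') :
    GluedLegs (X := GluedLegs x y) (Sum.inr ⟨y', hy.symm⟩) z ≃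
      GluedLegs (Y := GluedLegs y' z) x (Sum.inl ⟨y, hy⟩) where
  toFun
    | Sum.inl ⟨Sum.inl a, _⟩ => Sum.inl a
    | Sum.inl ⟨Sum.inr b, h⟩ =>
        Sum.inr ⟨Sum.inl ⟨b.1, fun e => h (by cases b; subst e; rfl)⟩,
          fun e => b.2 (by simpa using congrArg (Sum.elim Subtype.val (fun _ => y')) e)⟩
    | Sum.inr c => Sum.inr ⟨Sum.inr c, by simp⟩
  invFun
    | Sum.inl a => Sum.inl ⟨Sum.inl a, by simp⟩
    | Sum.inr ⟨Sum.inl b, h⟩ =>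
        Sum.inl ⟨Sum.inr ⟨b.1, fun e => h (by cases b; subst e; rfl)⟩,
          fun e => b.2 (by simpa using congrArg (Sum.elim (fun _ => y) Subtype.val) e)⟩
    | Sum.inr ⟨Sum.inr c, _⟩ => Sum.inr c
  left_inv := by rintro (⟨_ | _, _⟩ | _) <;> rfl
  right_inv := by rintro (_ | ⟨_ | _, _⟩) <;> rfl

/-- Gluing a corolla with two legs onto leg `x` does not change the set of legs. -/
noncomputable def gluedUnit {X : Type} (x : X) : GluedLegs x (0 : Fin 2) ≃ X where
  toFun := Sum.elim Subtype.val (fun _ => x)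
  invFun a := open Classical in
    if h : a = x then Sum.inr ⟨1, by decide⟩ else Sum.inl ⟨a, h⟩
  left_inv := by
    rintro (⟨a, ha⟩ | ⟨b, hb⟩)
    · simp [ha]
    · have : b = 1 := by omega
      subst this
      simp
  right_inv a := by
    by_cases h : a = x <;> simp [h]

/-- A cyclic operad in `k`-vector spaces, in its coordinate-free form: a functor `X ↦ O((X))` from
finite sets and bijections to vector spaces, with a composition
`O((X)) ⊗ O((Y)) → O((X \ x ⊔ Y \ y))` for all `x ∈ X`, `y ∈ Y`, which is equivariant, commutative,
associative and unital. The space usually written `O(n)` is `O((Fin (n + 1)))`, with its action of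
the symmetric group on the `n + 1` legs (the root and the `n` inputs). -/
structure CyclicOperad (k : Type u) [Field k] where
  obj (X : Type) [Finite X] : Type w
  [addCommGroup (X : Type) [Finite X] : AddCommGroup (obj X)]
  [module (X : Type) [Finite X] : Module k (obj X)]
  map {X Y : Type} [Finite X] [Finite Y] (f : X ≃ Y) : obj X →ₗ[k] obj Y
  map_refl {X : Type} [Finite X] (p : obj X) : map (Equiv.refl X) p = p
  map_trans {X Y Z : Type} [Finite X] [Finite Y] [Finite Z] (f : X ≃ Y) (g : Y ≃ Z) (p : obj X) :
    map (f.trans g) p = map g (map f p)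
  comp {X Y : Type} [Finite X] [Finite Y] (x : X) (y : Y) :
    obj X →ₗ[k] obj Y →ₗ[k] obj (GluedLegs x y)
  comp_map {X Y X' Y' : Type} [Finite X] [Finite Y] [Finite X'] [Finite Y']
    (x : X) (y : Y) (f : X ≃ X') (g : Y ≃ Y') (p : obj X) (q : obj Y) :
    comp (f x) (g y) (map f p) (map g q) = map (gluedCongr x y f g) (comp x y p q)
  comp_comm {X Y : Type} [Finite X] [Finite Y] (x : X) (y : Y) (p : obj X) (q : obj Y) :
    comp y x q p = map (Equiv.sumComm _ _) (comp x y p q)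
  comp_assoc {X Y Z : Type} [Finite X] [Finite Y] [Finite Z] (x : X) (y y' : Y) (z : Z)
    (hy : y ≠ y') (p : obj X) (q : obj Y) (r : obj Z) :
    map (gluedAssoc x y y' z hy) (comp (Sum.inr ⟨y', hy.symm⟩) z (comp x y p q) r) =
      comp x (Sum.inl ⟨y, hy⟩) p (comp y' z q r)
  unit : obj (Fin 2)
  map_unit : map (Equiv.swap 0 1) unit = unit
  comp_unit {X : Type} [Finite X] (x : X) (p : obj X) :
    map (gluedUnit x) (comp x (0 : Fin 2) p unit) = p

attribute [instance] CyclicOperad.addCommGroup CyclicOperad.module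

/-! ### Oriented labelled graphs -/

section Graphs

variable {k : Type u} [Field k]

/-- A finite graph with vertices of valence at least three, with an `O`-label at every vertex and
with data representing an orientation.

Edges are the orbits of the fixed point free involution `flip` on the set `H` of half-edges. A
directed edge is the same as a half-edge, namely the half at its tail: the directed edge `h` runs
from `vert h` to `vert (flip h)`. The orientation is represented by a linear ordering of the
vertices and by the set `dir` of the half-edges at the tails of the chosen edge directions. -/
structure OGraph (O : CyclicOperad.{u, w} k) where
  V : Type
  H : Type
  [finV : Finite V]
  [finH : Finite H]
  [order : LinearOrder V]
  vert : H → V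
  flip : H → H
  flip_flip : ∀ h, flip (flip h) = h
  flip_ne : ∀ h, flip h ≠ h
  dir : Set H
  mem_dir : ∀ h, h ∈ dir ↔ flip h ∉ dir
  valence : ∀ v, 3 ≤ Nat.card {h // vert h = v}
  label : ∀ v, O.obj {h // vert h = v}

attribute [instance] OGraph.finV OGraph.finH OGraph.order

namespace OGraph

variable {O : CyclicOperad.{u, w} k}

/-- The half-edges at a vertex correspond under a bijection that respects the incidence. -/
def fibreEquiv {H H' V V' : Type} {vert : H → V} {vert' : H' → V'} (v : V ≃ V') (h : H ≃ H')
    (hv : ∀ x, vert' (h x) = v (vert x)) (a : V) :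
    {x // vert x = a} ≃ {y // vert' y = v a} :=
  h.subtypeEquiv fun x => by rw [hv, v.apply_eq_iff_eq]

/-- Isomorphisms of `O`-labelled graphs; the orientations are ignored. -/
structure Iso (A B : OGraph O) where
  onV : A.V ≃ B.V
  onH : A.H ≃ B.H
  vert_onH : ∀ x, B.vert (onH x) = onV (A.vert x)
  flip_onH : ∀ x, B.flip (onH x) = onH (A.flip x)
  label_onV : ∀ a, B.label (onV a) = O.map (fibreEquiv onV onH vert_onH a) (A.label a)

/-- `1` if the isomorphism carries the orientation to the orientation, `-1` if it carries it to
the opposite one: the sign of the permutation of the vertices (through its inversions) times `-1`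
for every edge whose direction is not preserved. -/
noncomputable def Iso.sign {A B : OGraph O} (f : Iso A B) : k :=
  (-1) ^ (Set.ncard {p : A.V × A.V | p.1 < p.2 ∧ f.onV p.2 < f.onV p.1} +
    Set.ncard {h : A.H | h ∈ A.dir ∧ f.onH h ∉ B.dir})

/-- Change the label at one vertex. -/
def setLabel (A : OGraph O) (v : A.V) (p : O.obj {h // A.vert h = v}) : OGraph O :=
  { A with label := Function.update A.label v p }

/-- The defining relations of the graph complex. For an isomorphism that is the identity on
vertices and half-edges, the first one says `(G, or) = -(G, -or)`; the others say that a graph is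
multilinear in its labels. -/
inductive Rel : (OGraph O →₀ k) → Prop
  | iso {A B : OGraph O} (f : Iso A B) :
      Rel (Finsupp.single B 1 - Finsupp.single A f.sign)
  | add (A : OGraph O) (v : A.V) (p q : O.obj {h // A.vert h = v}) :
      Rel (Finsupp.single (A.setLabel v (p + q)) 1 -
        (Finsupp.single (A.setLabel v p) 1 + Finsupp.single (A.setLabel v q) 1))
  | smul (A : OGraph O) (v : A.V) (c : k) (p : O.obj {h // A.vert h = v}) :
      Rel (Finsupp.single (A.setLabel v (c • p)) 1 - Finsupp.single (A.setLabel v p) c)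

end OGraph

/-- The `O`-graph complex, as a vector space: oriented `O`-labelled graphs modulo the relations. -/
abbrev GraphComplex (O : CyclicOperad.{u, w} k) : Type _ :=
  (OGraph O →₀ k) ⧸ Submodule.span k {x : OGraph O →₀ k | OGraph.Rel x}

namespace OGraph

variable {O : CyclicOperad.{u, w} k}

/-- The class of a graph in the graph complex. -/
noncomputable def cls (A : OGraph O) : GraphComplex O :=
  Submodule.Quotient.mk (Finsupp.single A 1)

/-- The disjoint union of a finite ordered family of graphs. The vertices of earlier members of
the family precede those of later ones. -/
noncomputable def disjUnion {ι : Type} [Finite ι] [LinearOrder ι] (G : ι → OGraph O) :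
    OGraph O where
  V := Σₗ i, (G i).V
  H := Σ i, (G i).H
  finV := inferInstanceAs (Finite (Σ i, (G i).V))
  order := Sigma.Lex.linearOrder
  vert h := toLex ⟨h.1, (G h.1).vert h.2⟩
  flip h := ⟨h.1, (G h.1).flip h.2⟩
  flip_flip h := by simp [(G h.1).flip_flip]
  flip_ne := by
    rintro ⟨i, h⟩ e
    exact (G i).flip_ne h (by simpa using e)
  dir := {h | h.2 ∈ (G h.1).dir}
  mem_dir h := (G h.1).mem_dir h.2
  valence v := by
    refine ((G (ofLex v).1).valence (ofLex v).2).trans (Nat.card_le_card_of_injective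
      (fun h => ⟨⟨(ofLex v).1, h.1⟩, by rw [h.2]; rfl⟩) ?_)
    rintro ⟨a, ha⟩ ⟨b, hb⟩ e
    simpa using e
  label v := O.map (Equiv.ofBijective
      (fun h : {h // (G (ofLex v).1).vert h = (ofLex v).2} =>
        (⟨⟨(ofLex v).1, h.1⟩, by rw [h.2]; rfl⟩ :
          {h : Σ i, (G i).H // toLex (⟨h.1, (G h.1).vert h.2⟩ : Σ i, (G i).V) = v}))
      ⟨by
        rintro ⟨a, ha⟩ ⟨b, hb⟩ e
        simpa using e, by
        rintro ⟨⟨i, h⟩, rfl⟩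
        exact ⟨⟨h, rfl⟩, rfl⟩⟩)
    ((G (ofLex v).1).label (ofLex v).2)

open Classical in
/-- The graph `A⟨e 0, …, e (n-1)⟩` obtained by gluing every other side of a `2n`-gon to the
directed edges `e 0, …, e (n-1)`, which lie on distinct edges, and deleting these edges. With `c`
the cyclic permutation `e i ↦ e (i+1)` of half-edges, the edge `{e i, flip (e i)}` is replaced by
the side `{e (i+1), flip (e i)}` of the polygon, which joins the head of `e i` to the tail of
`e (i+1)`; vertices and labels stay the same.

If the orientation of `A` directs every `e i` as given, the new edges are directed against the
boundary of the polygon, that is, from the tail of `e (i+1)` to the head of `e i`, so that `dir` is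
unchanged; in this case `c` maps `dir` onto itself. If some `e i` is directed the other way, then
reversing it gives a sign, and the side `{e (i+1), flip (e i)}` of the image of `dir` under `c` is
directed the other way too, which gives a second sign; so the image of `dir` under `c` always
represents the induced orientation. -/
noncomputable def fuse (A : OGraph O) {n : ℕ} (e : Fin n → A.H) : OGraph O :=
  let c : Equiv.Perm A.H := (List.ofFn e).formPerm
  { A with
    flip := fun h => c (A.flip (c.symm h))
    flip_flip := fun h => by simp [A.flip_flip]
    flip_ne := fun h he => A.flip_ne (c.symm h) (by rw [Equiv.eq_symm_apply]; exact he)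
    dir := {h | c.symm h ∈ A.dir}
    mem_dir := fun h => by simpa using A.mem_dir (c.symm h) }

section Contract

variable (A : OGraph O) (h : A.H) (hne : A.vert h ≠ A.vert (A.flip h))

open Classical in
/-- The incidence map after contraction of `h`: the head of `h` is identified with its tail. -/
noncomputable def contractVert (x : {x : A.H // x ≠ h ∧ x ≠ A.flip h}) :
    {v : A.V // v ≠ A.vert (A.flip h)} :=
  if hx : A.vert x.1 = A.vert (A.flip h) then ⟨A.vert h, hne⟩ else ⟨A.vert x.1, hx⟩

/-- The half-edges at the vertex that results from the contraction of `h`. -/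
noncomputable def mergedEquiv (v : {v : A.V // v ≠ A.vert (A.flip h)}) (hv : v.1 = A.vert h) :
    GluedLegs (X := {x // A.vert x = A.vert h}) (Y := {x // A.vert x = A.vert (A.flip h)})
      ⟨h, rfl⟩ ⟨A.flip h, rfl⟩ ≃ {x // A.contractVert h hne x = v} :=
  Equiv.ofBijective
    (Sum.elim
      (fun a => ⟨⟨a.1.1, fun e => a.2 (Subtype.ext e), fun e => hne (by rw [← a.1.2, e])⟩, by
        have ha : A.vert a.1.1 ≠ A.vert (A.flip h) := by rw [a.1.2]; exact hne
        rw [contractVert, dif_neg ha]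
        exact Subtype.ext (a.1.2.trans hv.symm)⟩)
      (fun b => ⟨⟨b.1.1, fun e => hne (by rw [← b.1.2, e]), fun e => b.2 (Subtype.ext e)⟩, by
        rw [contractVert, dif_pos b.1.2]
        exact Subtype.ext hv.symm⟩))
    ⟨by
      rintro (⟨⟨a, ha⟩, ha'⟩ | ⟨⟨a, ha⟩, ha'⟩) (⟨⟨b, hb⟩, hb'⟩ | ⟨⟨b, hb⟩, hb'⟩) e
      · have : a = b := congrArg (fun t => t.1.1) e
        subst this; rfl
      · have : a = b := congrArg (fun t => t.1.1) e
        subst this; exact absurd (ha.symm.trans hb) hne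
      · have : a = b := congrArg (fun t => t.1.1) e
        subst this; exact absurd (hb.symm.trans ha) hne
      · have : a = b := congrArg (fun t => t.1.1) e
        subst this; rfl, by
      rintro ⟨⟨x, hx, hx'⟩, hv'⟩
      by_cases hw : A.vert x = A.vert (A.flip h)
      · exact ⟨Sum.inr ⟨⟨x, hw⟩, fun e => hx' (congrArg Subtype.val e)⟩, rfl⟩
      · have hu : A.vert x = A.vert h := by
          rw [contractVert, dif_neg hw] at hv'
          rw [← hv, ← hv']
        exact ⟨Sum.inl ⟨⟨x, hu⟩, fun e => hx (congrArg Subtype.val e)⟩, rfl⟩⟩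

/-- The half-edges at a vertex that is not involved in the contraction of `h`. -/
noncomputable def unmergedEquiv (v : {v : A.V // v ≠ A.vert (A.flip h)}) (hv : v.1 ≠ A.vert h) :
    {x // A.vert x = v.1} ≃ {x // A.contractVert h hne x = v} :=
  Equiv.ofBijective
    (fun a => ⟨⟨a.1, fun e => hv (by rw [← a.2, e]), fun e => v.2 (by rw [← a.2, e])⟩, by
      have ha : A.vert a.1 ≠ A.vert (A.flip h) := by rw [a.2]; exact v.2
      rw [contractVert, dif_neg ha]
      exact Subtype.ext a.2⟩)
    ⟨by
      rintro ⟨a, ha⟩ ⟨b, hb⟩ e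
      have : a = b := congrArg (fun t => t.1.1) e
      subst this; rfl, by
      rintro ⟨⟨x, hx, hx'⟩, hv'⟩
      by_cases hw : A.vert x = A.vert (A.flip h)
      · rw [contractVert, dif_pos hw] at hv'
        exact absurd (congrArg Subtype.val hv').symm hv
      · rw [contractVert, dif_neg hw] at hv'
        exact ⟨⟨x, congrArg Subtype.val hv'⟩, rfl⟩⟩

open Classical in
/-- Contraction of the directed edge `h`, which is not a loop: the head of `h` is removed and merged
into the tail, and the labels of the two are composed along the edge. -/
noncomputable def contract : OGraph O where
  V := {v : A.V // v ≠ A.vert (A.flip h)}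
  H := {x : A.H // x ≠ h ∧ x ≠ A.flip h}
  vert := A.contractVert h hne
  flip x := ⟨A.flip x.1, fun e => x.2.2 (by simpa [A.flip_flip] using congrArg A.flip e),
    fun e => x.2.1 (by simpa [A.flip_flip] using congrArg A.flip e)⟩
  flip_flip x := Subtype.ext (A.flip_flip x.1)
  flip_ne x e := A.flip_ne x.1 (congrArg Subtype.val e)
  dir := {x | x.1 ∈ A.dir}
  mem_dir x := A.mem_dir x.1
  valence v := by
    by_cases hv : v.1 = A.vert h
    · rw [← Nat.card_congr (A.mergedEquiv h hne v hv), Nat.card_sum]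
      have h₁ := A.valence (A.vert h)
      have h₂ := A.valence (A.vert (A.flip h))
      have e₁ := Nat.card_congr (Equiv.optionSubtypeNe
        (⟨h, rfl⟩ : {x // A.vert x = A.vert h}))
      have e₂ := Nat.card_congr (Equiv.optionSubtypeNe
        (⟨A.flip h, rfl⟩ : {x // A.vert x = A.vert (A.flip h)}))
      rw [Finite.card_option] at e₁ e₂
      omega
    · rw [← Nat.card_congr (A.unmergedEquiv h hne v hv)]
      exact A.valence v.1
  label v :=
    if hv : v.1 = A.vert h then
      O.map (A.mergedEquiv h hne v hv)
        (O.comp ⟨h, rfl⟩ ⟨A.flip h, rfl⟩ (A.label (A.vert h)) (A.label (A.vert (A.flip h))))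
    else O.map (A.unmergedEquiv h hne v hv) (A.label v.1)

open Classical in
/-- The contraction of the edge of `h` in the graph complex, which is zero if the edge is a loop.

The convention for the orientation is: if the edge runs from the first vertex to the second one,
then the merged vertex comes first, and the order of the others is kept. Moving the tail and the
head of `h` to the first two places, and the merged vertex back to the place of the tail, produces
the sign `(-1) ^ (j + 1)` where `j` is the number of vertices that precede the head. There is a
further sign if the orientation directs the edge against `h`. -/
noncomputable def contractCls : GraphComplex O :=
  if hne : A.vert h ≠ A.vert (A.flip h) then
    ((-1 : k) ^ (Set.ncard {v : A.V | v < A.vert (A.flip h)} + 1) *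
      (if h ∈ A.dir then 1 else -1)) • (A.contract h hne).cls
  else 0

end Contract

/-- The fusion `φ_n(G_1 ⊙ ⋯ ⊙ G_n)` of a family of `n` graphs: the sum over all `n`-tuples of
directed edges in separate members of the family of the contraction of
`(G_1 ⋯ G_n)⟨e_1, …, e_n⟩` along the side of the polygon between the sides `1` and `2`, that is,
from the head of the first directed edge to the tail of the second one. -/
noncomputable def fusion (n : ℕ+) {ι : Type} [Finite ι] [LinearOrder ι] (G : ι → OGraph O) :
    GraphComplex O :=
  ∑ᶠ e ∈ {e : Fin n → (disjUnion G).H | Function.Injective fun j => (e j).1},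
    ((disjUnion G).fuse e).contractCls ((disjUnion G).flip (e ⟨0, n.pos⟩))

end OGraph

/-- The part of the graph complex of degree `d`, spanned by the graphs with `d` vertices. -/
noncomputable def GraphComplex.degree (O : CyclicOperad.{u, w} k) (d : ℤ) : Submodule k (GraphComplex O) :=
  Submodule.span k {x | ∃ A : OGraph O, (Nat.card A.V : ℤ) = d ∧ A.cls = x}

/-! ### Graded symmetric algebras and `Lie_∞` structures -/

section GradedSymmetric

variable {M : Type*} [AddCommGroup M] [Module k M]

/-- Graded commutativity: `x y = (-1)^{|x| |y|} y x`. -/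
inductive GradedSymRel (D : ℤ → Submodule k M) : TensorAlgebra k M → TensorAlgebra k M → Prop
  | swap (i j : ℤ) (x y : M) (hx : x ∈ D i) (hy : y ∈ D j) :
      GradedSymRel D (TensorAlgebra.ι k x * TensorAlgebra.ι k y)
        ((-1 : k) ^ (i * j) • (TensorAlgebra.ι k y * TensorAlgebra.ι k x))

/-- The graded symmetric algebra `S M` of a vector space `M` with homogeneous parts `D d`; its
multiplication is the graded symmetric tensor product `⊙`. -/
abbrev GradedSym (D : ℤ → Submodule k M) : Type _ := RingQuot (GradedSymRel D)

namespace GradedSym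

variable (D : ℤ → Submodule k M)

/-- The inclusion of `M = S^1 M` into `S M`. -/
noncomputable def incl : M →ₗ[k] GradedSym D :=
  (RingQuot.mkAlgHom k (GradedSymRel D)).toLinearMap ∘ₗ TensorAlgebra.ι k

/-- `x_I = x_{i_1} ⊙ ⋯ ⊙ x_{i_r}` for `I = {i_1 < ⋯ < i_r}`. -/
noncomputable def monomial {m : ℕ} (x : Fin m → M) (I : Finset (Fin m)) : GradedSym D :=
  (((List.finRange m).filter (· ∈ I)).map fun i => incl D (x i)).prod

/-- The Koszul sign `ε(I, J)`, with `J` the complement of `I`, for elements of degrees `d`: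
`x_1 ⊙ ⋯ ⊙ x_m = ε(I, J) x_I ⊙ x_J`. -/
noncomputable def koszulSign (k : Type u) [Field k] {m : ℕ} (d : Fin m → ℤ)
    (I : Finset (Fin m)) : k :=
  (-1) ^ (∑ i ∈ I, ∑ j ∈ Iᶜ with j < i, d i * d j)

/-- `Φ` is a `Lie_∞` structure on the graded vector space `M`: a coderivation of degree `-1` of the
graded symmetric coalgebra `S M` (without constant term) whose square is zero. That `Φ` is a
coderivation is expressed by the formula
`Φ(x_1 ⊙ ⋯ ⊙ x_m) = ∑ ε(I, J) l(x_I) ⊙ x_J` with a linear map `l : S M → M`; the restrictions of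
`l` to the symmetric powers are the higher brackets. -/
def IsLieInfinity (Φ : Module.End k (GradedSym D)) : Prop :=
  (∃ l : GradedSym D →ₗ[k] M, l 1 = 0 ∧
    ∀ (m : ℕ) (x : Fin m → M) (d : Fin m → ℤ), (∀ i, x i ∈ D (d i)) →
      l (monomial D x Finset.univ) ∈ D (∑ i, d i - 1) ∧
      Φ (monomial D x Finset.univ) = ∑ I : Finset (Fin m),
        koszulSign k d I • (incl D (l (monomial D x I)) * monomial D x Iᶜ)) ∧
  Φ ∘ₗ Φ = 0

end GradedSym

end GradedSymmetric

/-! ### The fusion operations -/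

/-- The graded symmetric (co)algebra `S G^O` of the `O`-graph complex, which is graded by the number
of vertices. -/
abbrev SymGraphComplex (O : CyclicOperad.{u, w} k) : Type _ :=
  GradedSym (GraphComplex.degree O)

open GradedSym in
/-- `φ` is the operation `φ_n : S G^O → S G^O`: it is the extension as a coderivation
`φ_n(G_1 ⊙ ⋯ ⊙ G_m) = ∑ ε(I, J) φ_n(G_I) ⊙ G_J`, the sum being over the ordered partitions
`I ∪ J = {1, …, m}` with `|I| = n`, of the fusion of `n` graphs. -/
def IsFusion (O : CyclicOperad.{u, w} k) (n : ℕ+) (φ : Module.End k (SymGraphComplex O)) : Prop :=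
  ∀ (m : ℕ) (G : Fin m → OGraph O),
    φ (monomial _ (fun i => (G i).cls) Finset.univ) =
      ∑ I ∈ Finset.powersetCard n Finset.univ,
        koszulSign k (fun i => (Nat.card (G i).V : ℤ)) I •
          (incl _ (OGraph.fusion n fun i : I => G i) * monomial _ (fun i => (G i).cls) Iᶜ)

/-- `Φ = ∑_{i ∈ I} φ_i`, as a sum that is finite on every element. -/
def IsPointwiseSum {S : Type*} [AddCommGroup S] [Module k S] (φ : ℕ+ → Module.End k S)
    (I : Set ℕ+) (Φ : Module.End k S) : Prop :=
  ∀ x, {i | i ∈ I ∧ φ i x ≠ 0}.Finite ∧ Φ x = ∑ᶠ i ∈ I, φ i x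

end Graphs

/-! For a sequence of scalars `c`, let l be the bracket that equals `c n` times the fusion of `n`
graphs on `n` factors, and let D be its extension as a coderivation. The operation `φ_n` is D for
the `n`-th unit sequence, and `φ_I` is D for the indicator sequence of `I`. So everything follows
once D² = 0 is known for every `c` (`SymGraph.coderivation_sq`).

By coassociativity and cocommutativity of splitting a word (`splitSum_assoc`, `splitSum_comm`), D² =
0 follows from l ∘ D = 0. In the remaining terms of D² two brackets act on disjoint subwords, and
these terms cancel in pairs because the bracket has odd degree (`SymGraph.coderivation_comp_self`).

The value of l ∘ D on a word of `n` graphs is a sum over pairs of lists `(e, f)` of directed edges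
with `|e| + |f| = n + 1`: one fuses along `e`, contracts a new side, then fuses along `f`, which
avoids the contracted edge, and contracts again. The first contraction can be postponed, so a term
is the double contraction of a graph fused twice (`OGraph.doubleTerm`, `SymGraph.bracket_bracket`).
The Koszul signs are absorbed by the signs of vertex permutations (`SymGraph.splitSum_union`). The
algebraic input is that contractions of two edges anticommute (`OGraph.contract2Cls_swap`); for
edges that form a path this rests on associativity of the operad. The rest is combinatorics of
polygons, in three cases.

If `f` uses no new side of the first polygon, the two fusions are independent, and exchanging `e`
and `f` changes the sign (`OGraph.sum_doubleTerm_disjoint`).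

If `f` contains an element of `e`, the two polygons are glued along a side and form a single polygon
on `n` edges, in which two of the new sides are contracted. A suitable rotation of the large polygon
interchanges these two sides and keeps both lengths, so again terms cancel in pairs
(`OGraph.sum_doubleTerm_shared`).

If `f` runs through a new side in the other direction, turning the second polygon over leads back to
the previous case (`OGraph.sum_doubleTerm_reversed`).

The first cancellation pairs the weight `c |e| * c |f|` with `c |f| * c |e|` and the others preserve
both lengths, which is why arbitrary weights are allowed.

Linear maps out of the symmetric algebra are produced from functions of words that respect the
relations (`SymGraph.lift`), and uniqueness holds because words span (`SymGraph.span_word`).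
Finally, `φ_n` sends words of length r to combinations of words of length r - n + 1, so the
coefficient of a nonzero `φ_n` can be read off from the number of factors
(`SymGraph.eq_of_coderivation_eq`). Uncountability is then Cantor's theorem. -/

/-! ### Comparing labels along realizations of their legs -/

namespace CyclicOperad

variable {k : Type u} [Field k] (O : CyclicOperad.{u, w} k)

/-- Two labels whose legs are realized in a common set `T` agree if they correspond to each other
under a bijection of the legs over `T`. -/
def Agree {X Y T : Type} [Finite X] [Finite Y] (i : X → T) (j : Y → T) (p : O.obj X)
    (q : O.obj Y) : Prop :=
  ∃ f : X ≃ Y, (∀ x, j (f x) = i x) ∧ O.map f p = q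

variable {O} {X Y Z X' Y' T T' : Type} [Finite X] [Finite Y] [Finite Z] [Finite X'] [Finite Y']

theorem Agree.of_map {i : X → T} {j : Y → T} (f : X ≃ Y) (hf : ∀ x, j (f x) = i x) (p : O.obj X) :
    O.Agree i j p (O.map f p) :=
  ⟨f, hf, rfl⟩

theorem Agree.refl (i : X → T) (p : O.obj X) : O.Agree i i p p :=
  ⟨Equiv.refl X, fun _ => rfl, O.map_refl p⟩

theorem Agree.symm {i : X → T} {j : Y → T} {p : O.obj X} {q : O.obj Y} (h : O.Agree i j p q) :
    O.Agree j i q p := by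
  obtain ⟨f, hf, rfl⟩ := h
  refine ⟨f.symm, fun y => ?_, ?_⟩
  · rw [← hf, f.apply_symm_apply]
  · rw [← O.map_trans, f.self_trans_symm, O.map_refl]

theorem Agree.trans {i : X → T} {j : Y → T} {l : Z → T} {p : O.obj X} {q : O.obj Y} {r : O.obj Z}
    (h : O.Agree i j p q) (h' : O.Agree j l q r) : O.Agree i l p r := by
  obtain ⟨f, hf, rfl⟩ := h
  obtain ⟨g, hg, rfl⟩ := h'
  exact ⟨f.trans g, fun x => by simp [hg, hf], O.map_trans f g p⟩

theorem Agree.push {i : X → T} {j : Y → T} {p : O.obj X} {q : O.obj Y} (h : O.Agree i j p q)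
    (t : T → T') {i' : X → T'} {j' : Y → T'} (hi : ∀ x, i' x = t (i x)) (hj : ∀ y, j' y = t (j y)) :
    O.Agree i' j' p q := by
  obtain ⟨f, hf, rfl⟩ := h
  exact ⟨f, fun x => by rw [hj, hf, hi], rfl⟩

theorem Agree.pull {i : X → T} {j : Y → T} {i' : X → T'} {j' : Y → T'} {p : O.obj X} {q : O.obj Y}
    (h : O.Agree i' j' p q) (t : T → T') (ht : Function.Injective t)
    (hi : ∀ x, i' x = t (i x)) (hj : ∀ y, j' y = t (j y)) : O.Agree i j p q := by
  obtain ⟨f, hf, rfl⟩ := h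
  exact ⟨f, fun x => ht (by rw [← hj, hf, hi]), rfl⟩

/-- Over an injective realization the bijection of legs is forced. This is what lets chains of
comparisons inside a fixed set of half-edges replace explicit bijections between iterated subtypes.
-/
theorem Agree.map_eq {i : X → T} {j : Y → T} {p : O.obj X} {q : O.obj Y} (h : O.Agree i j p q)
    (hj : Function.Injective j) (f : X ≃ Y) (hf : ∀ x, j (f x) = i x) : q = O.map f p := by
  obtain ⟨g, hg, rfl⟩ := h
  have : g = f := Equiv.ext fun x => hj (by rw [hg, hf])
  rw [this]

/-- Injectivity forces the glued legs to correspond as soon as their images in `T` coincide; then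
equivariance of the composition applies. -/
theorem Agree.comp {i : X → T} {i' : X' → T} {j : Y → T} {j' : Y' → T} {p : O.obj X}
    {p' : O.obj X'} {q : O.obj Y} {q' : O.obj Y'} (hp : O.Agree i i' p p') (hq : O.Agree j j' q q')
    (hi' : Function.Injective i') (hj' : Function.Injective j')
    {x : X} {x' : X'} {y : Y} {y' : Y'} (hx : i x = i' x') (hy : j y = j' y') :
    O.Agree (Sum.elim (fun a : {a // a ≠ x} => i a.1) (fun b : {b // b ≠ y} => j b.1))
      (Sum.elim (fun a : {a // a ≠ x'} => i' a.1) (fun b : {b // b ≠ y'} => j' b.1))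
      (O.comp x y p q) (O.comp x' y' p' q') := by
  obtain ⟨f, hf, rfl⟩ := hp
  obtain ⟨g, hg, rfl⟩ := hq
  have ex : x' = f x := hi' (by rw [hf, hx])
  have ey : y' = g y := hj' (by rw [hg, hy])
  subst ex ey
  rw [O.comp_map]
  refine Agree.of_map _ ?_ _
  rintro (a | b)
  · exact hf a.1
  · exact hg b.1

theorem Agree.comp_comm {i : X → T} {j : Y → T} (x : X) (y : Y) (p : O.obj X) (q : O.obj Y) :
    O.Agree (Sum.elim (fun a : {a // a ≠ x} => i a.1) (fun b : {b // b ≠ y} => j b.1))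
      (Sum.elim (fun b : {b // b ≠ y} => j b.1) (fun a : {a // a ≠ x} => i a.1))
      (O.comp x y p q) (O.comp y x q p) := by
  rw [O.comp_comm x y p q]
  refine Agree.of_map _ ?_ _
  rintro (a | b) <;> rfl

theorem Agree.comp_assoc {i : X → T} {j : Y → T} {l : Z → T} (x : X) (y y' : Y) (z : Z)
    (hy : y ≠ y') (p : O.obj X) (q : O.obj Y) (r : O.obj Z) :
    O.Agree
      (Sum.elim (fun a : {a : GluedLegs x y // a ≠ Sum.inr ⟨y', hy.symm⟩} =>
        Sum.elim (fun a : {a // a ≠ x} => i a.1) (fun b : {b // b ≠ y} => j b.1) a.1)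
        (fun c : {c // c ≠ z} => l c.1))
      (Sum.elim (fun a : {a // a ≠ x} => i a.1)
        (fun b : {b : GluedLegs y' z // b ≠ Sum.inl ⟨y, hy⟩} =>
        Sum.elim (fun b : {b // b ≠ y'} => j b.1) (fun c : {c // c ≠ z} => l c.1) b.1))
      (O.comp (Sum.inr ⟨y', hy.symm⟩) z (O.comp x y p q) r)
      (O.comp x (Sum.inl ⟨y, hy⟩) p (O.comp y' z q r)) := by
  rw [← O.comp_assoc x y y' z hy p q r]
  refine Agree.of_map _ ?_ _
  rintro (⟨a | b, h⟩ | c) <;> rfl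

end CyclicOperad

/-! ### Signs of bijections of ordered sets -/

section Signs

variable (k : Type u) [Field k]

open Classical in
/-- `-1` if `p` holds, `1` otherwise. -/
noncomputable def signIf (p : Prop) : k := if p then -1 else 1

theorem signIf_of {p : Prop} (h : p) : signIf k p = -1 := if_pos h

theorem signIf_of_not {p : Prop} (h : ¬ p) : signIf k p = 1 := if_neg h

theorem signIf_mul_self (p : Prop) : signIf k p * signIf k p = 1 := by
  by_cases h : p
  · rw [signIf_of k h]; ring
  · rw [signIf_of_not k h]; ring

/-- Signs given by counting become products over points, which can be split off and reindexed. -/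
theorem neg_one_pow_ncard {α : Type} [Fintype α] (S : Set α) :
    (-1 : k) ^ S.ncard = ∏ x, signIf k (x ∈ S) := by
  classical
  simp only [signIf]
  rw [Finset.prod_ite, Finset.prod_const, Finset.prod_const_one, mul_one,
    Set.ncard_eq_toFinset_card', Set.toFinset_card, Fintype.card_subtype]

theorem neg_one_pow_ncard_congr {α β : Type} (f : α ≃ β) {S : Set α} {T : Set β}
    (h : ∀ x, x ∈ S ↔ f x ∈ T) : (-1 : k) ^ S.ncard = (-1) ^ T.ncard := by
  have : T = f '' S := by
    ext y
    rw [Equiv.image_eq_preimage_symm, Set.mem_preimage, h, f.apply_symm_apply]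
  rw [this, Set.ncard_image_of_injective _ f.injective]

/-- The sign of a bijection of linearly ordered sets, through its inversions. -/
noncomputable def vsign {V W : Type} [LinearOrder V] [LinearOrder W] (f : V ≃ W) : k :=
  (-1) ^ Set.ncard {p : V × V | p.1 < p.2 ∧ f p.2 < f p.1}

/-- The parity of the number of predecessors. -/
noncomputable def belowSign {V : Type} [LinearOrder V] (v : V) : k :=
  (-1) ^ Set.ncard {x : V | x < v}

variable {k}

theorem neg_one_pow_mul_self' (n : ℕ) : (-1 : k) ^ n * (-1) ^ n = 1 := by
  rw [← mul_pow]; simp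

theorem belowSign_mul_self {V : Type} [LinearOrder V] (v : V) :
    belowSign k v * belowSign k v = 1 := neg_one_pow_mul_self' _

theorem vsign_eq_one {V W : Type} [LinearOrder V] [LinearOrder W] (f : V ≃ W) (hf : StrictMono f) :
    vsign k f = 1 := by
  have : {p : V × V | p.1 < p.2 ∧ f p.2 < f p.1} = ∅ := by
    ext p
    simp only [Set.mem_ofPred_eq, Set.mem_empty_iff_false, iff_false, not_and]
    exact fun h h' => lt_asymm h' (hf h)
  rw [vsign, this, Set.ncard_empty, pow_zero]

/-- Deleting `a` removes a predecessor of `b` exactly when `a < b`. -/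
theorem belowSign_subtype {V : Type} [Finite V] [LinearOrder V] {a b : V} (h : b ≠ a) :
    belowSign k b = belowSign k (⟨b, h⟩ : {v // v ≠ a}) * signIf k (a < b) := by
  classical
  have := Fintype.ofFinite V
  rw [belowSign, belowSign, neg_one_pow_ncard, neg_one_pow_ncard,
    Fintype.prod_eq_mul_prod_subtype_ne _ a, mul_comm]
  rfl

/-- The inversions that involve `v` come from the points lying below `v` or below `f v` after
transport, but not both. Their number has the parity of the sum of the two numbers of predecessors.
This comparison replaces multiplicativity of the sign throughout. -/
theorem vsign_restrict {V W : Type} [Finite V] [LinearOrder V] [LinearOrder W] (f : V ≃ W) (v : V)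
    (w : W) (g : {x // x ≠ v} ≃ {y // y ≠ w}) (hw : f v = w) (hg : ∀ x, (g x).1 = f x.1) :
    vsign k f = vsign k g * (belowSign k v * belowSign k w) := by
  classical
  subst hw
  have := Fintype.ofFinite V
  have hW : belowSign k (f v) = (-1) ^ Set.ncard {x | f x < f v} :=
    (neg_one_pow_ncard_congr k f fun x => Iff.rfl).symm
  have hv : vsign k f = ∏ a : V, ∏ b : V, signIf k (a < b ∧ f b < f a) := by
    rw [vsign, neg_one_pow_ncard, Fintype.prod_prod_type]
    rfl
  have hr : vsign k g = ∏ a : {x // x ≠ v}, ∏ b : {x // x ≠ v},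
      signIf k (a.1 < b.1 ∧ f b.1 < f a.1) := by
    rw [vsign, neg_one_pow_ncard, Fintype.prod_prod_type]
    refine Fintype.prod_congr _ _ fun a => Fintype.prod_congr _ _ fun b => ?_
    rw [← hg, ← hg]
    rfl
  have h1 : ∀ a : {x // x ≠ v}, (∏ b, signIf k (a.1 < b ∧ f b < f a.1)) =
      signIf k (a.1 < v ∧ f v < f a.1) * ∏ b : {x // x ≠ v},
        signIf k (a.1 < b.1 ∧ f b.1 < f a.1) :=
    fun a => Fintype.prod_eq_mul_prod_subtype_ne _ v
  have hb : belowSign k v = ∏ a : {x // x ≠ v}, signIf k (a.1 < v) := by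
    rw [belowSign, neg_one_pow_ncard, Fintype.prod_eq_mul_prod_subtype_ne _ v]
    exact (congrArg (· * _) (signIf_of_not k (lt_irrefl v))).trans (one_mul _)
  have hb' : belowSign k (f v) = ∏ a : {x // x ≠ v}, signIf k (f a.1 < f v) := by
    rw [hW, neg_one_pow_ncard, Fintype.prod_eq_mul_prod_subtype_ne _ v]
    exact (congrArg (· * _) (signIf_of_not k (lt_irrefl (f v)))).trans (one_mul _)
  -- For each other point, the pair with `v` is inverted iff exactly one of `a < v` and `f a < f v`
  -- holds.
  have key : (∏ a : {x // x ≠ v}, signIf k (v < a.1 ∧ f a.1 < f v)) *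
      (∏ a : {x // x ≠ v}, signIf k (a.1 < v ∧ f v < f a.1)) =
      (∏ a : {x // x ≠ v}, signIf k (a.1 < v)) * ∏ a : {x // x ≠ v}, signIf k (f a.1 < f v) := by
    rw [← Finset.prod_mul_distrib, ← Finset.prod_mul_distrib]
    refine Fintype.prod_congr _ _ fun a => ?_
    have hne : f a.1 ≠ f v := fun e => a.2 (f.injective e)
    rcases lt_or_gt_of_ne a.2 with h | h <;> rcases lt_or_gt_of_ne hne with h' | h' <;>
      simp [h, h', not_lt_of_gt h, not_lt_of_gt h', signIf]
  rw [hv, hr, hb, hb', ← key, Fintype.prod_eq_mul_prod_subtype_ne _ v, Fintype.prod_congr _ _ h1,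
    Finset.prod_mul_distrib,
    Fintype.prod_eq_mul_prod_subtype_ne (fun b => signIf k (v < b ∧ f b < f v)) v,
    signIf_of_not k (fun h => lt_irrefl v h.1)]
  ring

/-- Delete `u` and `v` one after the other: what remains is the identity. The predecessor counts
cancel except for the comparison of `u` with `v`, which holds in exactly one direction. -/
theorem vsign_swap {V : Type} [Finite V] [LinearOrder V] [DecidableEq V] {u v : V} (huv : u ≠ v) :
    vsign k (Equiv.swap u v) = -1 := by
  have e1 : ∀ x, x ≠ v ↔ Equiv.swap u v x ≠ u := fun x => by
    rw [Ne, Ne, not_iff_not, Equiv.swap_apply_eq_iff, Equiv.swap_apply_left]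
  have e2 : ∀ x : {x // x ≠ v}, x ≠ ⟨u, huv⟩ ↔
      (Equiv.swap u v).subtypeEquiv (q := fun y => y ≠ u) e1 x ≠ ⟨v, huv.symm⟩ := fun x => by
    rw [Ne, Ne, not_iff_not, Subtype.ext_iff, Subtype.ext_iff]
    simp [Equiv.swap_apply_eq_iff]
  rw [vsign_restrict (Equiv.swap u v) v u ((Equiv.swap u v).subtypeEquiv e1) (by simp)
    (fun _ => rfl),
    vsign_restrict ((Equiv.swap u v).subtypeEquiv e1) ⟨u, huv⟩ ⟨v, huv.symm⟩
      (((Equiv.swap u v).subtypeEquiv e1).subtypeEquiv e2) (Subtype.ext (by simp)) (fun _ => rfl),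
    vsign_eq_one, belowSign_subtype (k := k) huv, belowSign_subtype (k := k) huv.symm]
  · have h1 := belowSign_mul_self (k := k) (⟨u, huv⟩ : {x // x ≠ v})
    have h2 := belowSign_mul_self (k := k) (⟨v, huv.symm⟩ : {x // x ≠ u})
    set s := belowSign k (⟨u, huv⟩ : {x // x ≠ v})
    set t := belowSign k (⟨v, huv.symm⟩ : {x // x ≠ u})
    rcases lt_or_gt_of_ne huv with h | h <;> simp only [signIf, h, not_lt_of_gt h, if_true, if_false] <;>
      linear_combination (-(s * s)) * h2 - h1
  · have key : ∀ x : {x : {x // x ≠ v} // x ≠ ⟨u, huv⟩}, Equiv.swap u v x.1.1 = x.1.1 := fun x =>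
      Equiv.swap_apply_of_ne_of_ne (fun e => x.2 (Subtype.ext e)) x.1.2
    intro x y h
    change Equiv.swap u v x.1.1 < Equiv.swap u v y.1.1
    rw [key, key]
    exact h

end Signs

namespace OGraph

variable {k : Type u} [Field k] {O : CyclicOperad.{u, w} k}

/-! ### Isomorphisms and their signs -/

/-- Serves in place of casts of labels along equalities of vertices. -/
theorem label_agree (A : OGraph O) {v v' : A.V} (h : v = v') :
    O.Agree (fun x : {x // A.vert x = v} => x.1) (fun x : {x // A.vert x = v'} => x.1)
      (A.label v) (A.label v') := by
  subst h
  exact .refl _ _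

theorem Iso.label_agree {A B : OGraph O} (f : Iso A B) {v : A.V} {v' : B.V} (h : f.onV v = v') :
    O.Agree (fun x : {x // A.vert x = v} => f.onH x.1) (fun x : {x // B.vert x = v'} => x.1)
      (A.label v) (B.label v') := by
  subst h
  rw [f.label_onV]
  exact ⟨_, fun _ => rfl, rfl⟩

/-- An isomorphism from bijections under which the labels agree. -/
def Iso.ofAgree {A B : OGraph O} (onV : A.V ≃ B.V) (onH : A.H ≃ B.H)
    (vert_onH : ∀ x, B.vert (onH x) = onV (A.vert x))
    (flip_onH : ∀ x, B.flip (onH x) = onH (A.flip x))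
    (label : ∀ v, O.Agree (fun x : {x // A.vert x = v} => onH x.1)
      (fun x : {x // B.vert x = onV v} => x.1) (A.label v) (B.label (onV v))) : Iso A B where
  onV := onV
  onH := onH
  vert_onH := vert_onH
  flip_onH := flip_onH
  label_onV v := (label v).map_eq Subtype.val_injective _ fun _ => rfl

theorem Iso.cls_eq {A B : OGraph O} (f : Iso A B) : B.cls = f.sign • A.cls := by
  rw [cls, cls, ← Submodule.Quotient.mk_smul, Submodule.Quotient.eq]
  refine Submodule.subset_span ?_
  have := Rel.iso f
  simpa using this

/-- The part of the sign that comes from the directions of the edges. -/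
noncomputable def Iso.dsign {A B : OGraph O} (f : Iso A B) : k :=
  (-1) ^ Set.ncard {h : A.H | h ∈ A.dir ∧ f.onH h ∉ B.dir}

theorem Iso.sign_eq {A B : OGraph O} (f : Iso A B) : f.sign = vsign k f.onV * f.dsign :=
  pow_add _ _ _

theorem Iso.dsign_eq_one {A B : OGraph O} (f : Iso A B) (h : ∀ x ∈ A.dir, f.onH x ∈ B.dir) :
    f.dsign = (1 : k) := by
  have : {h : A.H | h ∈ A.dir ∧ f.onH h ∉ B.dir} = ∅ := by
    ext x
    simp only [Set.mem_ofPred_eq, Set.mem_empty_iff_false, iff_false, not_and, not_not]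
    exact h x
  rw [Iso.dsign, this, Set.ncard_empty, pow_zero]

theorem Iso.sign_eq_one {A B : OGraph O} (f : Iso A B) (hV : StrictMono f.onV)
    (h : ∀ x ∈ A.dir, f.onH x ∈ B.dir) : f.sign = (1 : k) := by
  rw [f.sign_eq, f.dsign_eq_one h, vsign_eq_one _ hV, mul_one]

/-- The identity. -/
def Iso.refl (A : OGraph O) : Iso A A :=
  Iso.ofAgree (Equiv.refl _) (Equiv.refl _) (fun _ => rfl) (fun _ => rfl) fun _ => .refl _ _

/-- The inverse of an isomorphism. -/
def Iso.symm {A B : OGraph O} (f : Iso A B) : Iso B A :=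
  Iso.ofAgree f.onV.symm f.onH.symm
    (fun x => by rw [Equiv.eq_symm_apply, ← f.vert_onH, f.onH.apply_symm_apply])
    (fun x => by rw [Equiv.eq_symm_apply, ← f.flip_onH, f.onH.apply_symm_apply])
    (fun v => (f.label_agree (f.onV.apply_symm_apply v)).symm.push f.onH.symm (fun _ => rfl)
      (fun y => by simp))

theorem flip_injective (A : OGraph O) : Function.Injective A.flip :=
  Function.LeftInverse.injective A.flip_flip

theorem flip_mem_dir (A : OGraph O) (h : A.H) : A.flip h ∈ A.dir ↔ h ∉ A.dir := by
  rw [A.mem_dir, A.flip_flip]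

/-! ### Contractions -/

/-- The sign in the contraction of a directed edge. -/
noncomputable def contractSign (A : OGraph O) (h : A.H) : k :=
  -(belowSign k (A.vert (A.flip h)) * signIf k (h ∉ A.dir))

theorem contractSign_mul_self (A : OGraph O) (h : A.H) :
    A.contractSign h * A.contractSign h = (1 : k) := by
  rw [contractSign]
  linear_combination (belowSign k (A.vert (A.flip h)) * belowSign k (A.vert (A.flip h))) *
    signIf_mul_self k (h ∉ A.dir) + belowSign_mul_self (k := k) (A.vert (A.flip h))

theorem contractCls_of_ne (A : OGraph O) (h : A.H) (hne : A.vert h ≠ A.vert (A.flip h)) :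
    A.contractCls h = A.contractSign h • (A.contract h hne).cls := by
  rw [contractCls, dif_pos hne, contractSign, belowSign, signIf]
  congr 1
  by_cases hd : h ∈ A.dir <;> simp [hd, pow_succ]

theorem contractCls_of_eq (A : OGraph O) (h : A.H) (hl : A.vert h = A.vert (A.flip h)) :
    A.contractCls h = 0 :=
  dif_neg (not_not.mpr hl)

theorem contract_label_merged (A : OGraph O) (h : A.H) (hne : A.vert h ≠ A.vert (A.flip h))
    (v : (A.contract h hne).V) (hv : v.1 = A.vert h) :
    O.Agree
      (Sum.elim (fun a : {a : {x // A.vert x = A.vert h} // a ≠ ⟨h, rfl⟩} => a.1.1)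
        (fun b : {b : {x // A.vert x = A.vert (A.flip h)} // b ≠ ⟨A.flip h, rfl⟩} => b.1.1))
      (fun x : {x // (A.contract h hne).vert x = v} => x.1.1)
      (O.comp ⟨h, rfl⟩ ⟨A.flip h, rfl⟩ (A.label (A.vert h)) (A.label (A.vert (A.flip h))))
      ((A.contract h hne).label v) := by
  have : (A.contract h hne).label v = O.map (A.mergedEquiv h hne v hv)
      (O.comp ⟨h, rfl⟩ ⟨A.flip h, rfl⟩ (A.label (A.vert h)) (A.label (A.vert (A.flip h)))) :=
    dif_pos hv
  rw [this]
  refine .of_map _ ?_ _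
  rintro (a | b) <;> rfl

theorem contract_label_unmerged (A : OGraph O) (h : A.H) (hne : A.vert h ≠ A.vert (A.flip h))
    (v : (A.contract h hne).V) (hv : v.1 ≠ A.vert h) :
    O.Agree (fun x : {x // A.vert x = v.1} => x.1)
      (fun x : {x // (A.contract h hne).vert x = v} => x.1.1)
      (A.label v.1) ((A.contract h hne).label v) := by
  have : (A.contract h hne).label v = O.map (A.unmergedEquiv h hne v hv) (A.label v.1) :=
    dif_neg hv
  rw [this]
  exact ⟨_, fun _ => rfl, rfl⟩

open Classical in
theorem contract_vert_val (A : OGraph O) (h : A.H) (hne : A.vert h ≠ A.vert (A.flip h))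
    (x : (A.contract h hne).H) :
    ((A.contract h hne).vert x).1 =
      if A.vert x.1 = A.vert (A.flip h) then A.vert h else A.vert x.1 := by
  change (A.contractVert h hne x).1 = _
  unfold contractVert
  split_ifs <;> rfl

/-- An isomorphism induces an isomorphism of contractions. -/
noncomputable def Iso.contract {A B : OGraph O} (f : Iso A B) (h : A.H) (h' : B.H)
    (e : f.onH h = h') (hne : A.vert h ≠ A.vert (A.flip h))
    (hne' : B.vert h' ≠ B.vert (B.flip h')) : Iso (A.contract h hne) (B.contract h' hne') :=
  have hf : B.flip h' = f.onH (A.flip h) := by rw [← e, f.flip_onH]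
  have hv : B.vert h' = f.onV (A.vert h) := by rw [← e, f.vert_onH]
  have hv' : B.vert (B.flip h') = f.onV (A.vert (A.flip h)) := by rw [hf, f.vert_onH]
  Iso.ofAgree (A := A.contract h hne) (B := B.contract h' hne')
    (f.onV.subtypeEquiv fun v => by rw [hv', Ne, Ne, f.onV.apply_eq_iff_eq])
    (f.onH.subtypeEquiv fun x => by
      rw [← e, f.flip_onH, Ne, Ne, Ne, Ne, f.onH.apply_eq_iff_eq, f.onH.apply_eq_iff_eq])
    (fun x => Subtype.ext (by
      rw [contract_vert_val]
      change _ = f.onV ((A.contract h hne).vert x).1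
      rw [contract_vert_val]
      change (if B.vert (f.onH x.1) = _ then _ else B.vert (f.onH x.1)) = _
      simp only [f.vert_onH, hv, hv', f.onV.apply_eq_iff_eq]
      split_ifs <;> rfl))
    (fun x => Subtype.ext (f.flip_onH x.1))
    (fun v => by
      by_cases hm : v.1 = A.vert h
      · have h1 := A.contract_label_merged h hne v hm
        have h2 := B.contract_label_merged h' hne'
          (f.onV.subtypeEquiv (fun v => by rw [hv', Ne, Ne, f.onV.apply_eq_iff_eq]) v)
          ((congrArg f.onV hm).trans hv.symm)
        have h3 := (f.label_agree hv.symm).comp (f.label_agree hv'.symm)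
          Subtype.val_injective Subtype.val_injective
          (x := ⟨h, rfl⟩) (x' := ⟨h', rfl⟩) (y := ⟨A.flip h, rfl⟩) (y' := ⟨B.flip h', rfl⟩)
          e hf.symm
        refine ((h1.symm.push f.onH (fun _ => rfl) (fun _ => rfl)).trans
          ((h3.push id ?_ (fun _ => rfl)).trans h2)).pull Subtype.val Subtype.val_injective
          (fun _ => rfl) (fun _ => rfl)
        rintro (a | b) <;> rfl
      · have h1 := A.contract_label_unmerged h hne v hm
        have h2 := B.contract_label_unmerged h' hne'
          (f.onV.subtypeEquiv (fun v => by rw [hv', Ne, Ne, f.onV.apply_eq_iff_eq]) v)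
          (fun e' => hm (f.onV.injective (e'.trans hv)))
        exact ((h1.symm.push f.onH (fun _ => rfl) (fun _ => rfl)).trans
          ((f.label_agree rfl).trans h2)).pull Subtype.val Subtype.val_injective
          (fun _ => rfl) (fun _ => rfl))

/-- On vertices the contraction deletes the head, so `vsign_restrict` produces the predecessor
counts in the contraction signs; on directions it deletes one edge, which contributes the two
direction factors. -/
theorem Iso.contract_sign {A B : OGraph O} (f : Iso A B) (h : A.H) (h' : B.H)
    (e : f.onH h = h') (hne : A.vert h ≠ A.vert (A.flip h))
    (hne' : B.vert h' ≠ B.vert (B.flip h')) :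
    f.sign = (f.contract h h' e hne hne').sign * (A.contractSign h * B.contractSign h') := by
  classical
  subst e
  have hd : f.dsign = (f.contract h _ rfl hne hne').dsign *
      (signIf k (h ∉ A.dir) * signIf k (f.onH h ∉ B.dir)) := by
    have := Fintype.ofFinite A.H
    have h1 : f.dsign = ∏ x : A.H, signIf k (x ∈ A.dir ∧ f.onH x ∉ B.dir) :=
      neg_one_pow_ncard k _
    have h2 : (f.contract h _ rfl hne hne').dsign = ∏ x : {x // x ≠ h ∧ x ≠ A.flip h},
        signIf k (x.1 ∈ A.dir ∧ f.onH x.1 ∉ B.dir) := by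
      exact neg_one_pow_ncard (α := {x // x ≠ h ∧ x ≠ A.flip h}) k _
    have h3 : ∏ x : {x // x ≠ h ∧ x ≠ A.flip h}, signIf k (x.1 ∈ A.dir ∧ f.onH x.1 ∉ B.dir) =
        ∏ x : {x : {x // x ≠ h} // x ≠ ⟨A.flip h, A.flip_ne h⟩},
          signIf k (x.1.1 ∈ A.dir ∧ f.onH x.1.1 ∉ B.dir) :=
      Fintype.prod_equiv
        { toFun := fun x => ⟨⟨x.1, x.2.1⟩, fun e => x.2.2 (congrArg Subtype.val e)⟩
          invFun := fun x => ⟨x.1.1, x.1.2, fun e => x.2 (Subtype.ext e)⟩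
          left_inv := fun _ => rfl
          right_inv := fun _ => rfl } _ _ fun _ => rfl
    rw [h1, h2, h3, Fintype.prod_eq_mul_prod_subtype_ne _ h,
      Fintype.prod_eq_mul_prod_subtype_ne (fun x : {x // x ≠ h} =>
        signIf k (x.1 ∈ A.dir ∧ f.onH x.1 ∉ B.dir)) ⟨A.flip h, A.flip_ne h⟩, ← mul_assoc, mul_comm]
    congr 1
    -- Exactly one half of each edge lies in `dir`, so the two deleted factors multiply to `-1`
    -- precisely when `f` does not preserve the direction of the edge.
    have e1 := A.flip_mem_dir h
    have e2 := B.flip_mem_dir (f.onH h)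
    rw [f.flip_onH] at e2
    simp only [e1, e2]
    by_cases p : h ∈ A.dir <;> by_cases q : f.onH h ∈ B.dir <;> simp [p, q, signIf]
  have hv : vsign k f.onV = vsign k (f.contract h _ rfl hne hne').onV *
      (belowSign k (A.vert (A.flip h)) * belowSign k (B.vert (B.flip (f.onH h)))) :=
    vsign_restrict f.onV _ _ (f.contract h _ rfl hne hne').onV
      (by rw [f.flip_onH, f.vert_onH]) (fun _ => rfl)
  rw [f.sign_eq, hd, Iso.sign_eq, contractSign, contractSign, hv]
  ring

theorem Iso.contractCls_eq {A B : OGraph O} (f : Iso A B) (h : A.H) (h' : B.H)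
    (e : f.onH h = h') : B.contractCls h' = f.sign • A.contractCls h := by
  subst e
  by_cases hne : A.vert h ≠ A.vert (A.flip h)
  · have hne' : B.vert (f.onH h) ≠ B.vert (B.flip (f.onH h)) := by
      rw [f.flip_onH, f.vert_onH, f.vert_onH]
      exact fun e => hne (f.onV.injective e)
    rw [contractCls_of_ne _ _ hne, contractCls_of_ne _ _ hne',
      (f.contract h _ rfl hne hne').cls_eq, smul_smul, smul_smul,
      f.contract_sign h _ rfl hne hne']
    congr 1
    linear_combination (-(B.contractSign (f.onH h) * (f.contract h _ rfl hne hne').sign)) *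
      A.contractSign_mul_self h
  · push Not at hne
    rw [contractCls_of_eq _ _ hne, contractCls_of_eq, smul_zero]
    rw [f.flip_onH, f.vert_onH, f.vert_onH, hne]

open Classical in
/-- The contractions along the two directions of an edge are isomorphic. -/
noncomputable def contractFlipIso (A : OGraph O) (h : A.H) (hne : A.vert h ≠ A.vert (A.flip h))
    (hne' : A.vert (A.flip h) ≠ A.vert (A.flip (A.flip h))) :
    Iso (A.contract h hne) (A.contract (A.flip h) hne') :=
  have hs : ∀ v, v ≠ A.vert (A.flip h) ↔
      Equiv.swap (A.vert h) (A.vert (A.flip h)) v ≠ A.vert (A.flip (A.flip h)) := fun v => by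
    rw [A.flip_flip, Ne, Ne, not_iff_not, Equiv.swap_apply_eq_iff, Equiv.swap_apply_left]
  Iso.ofAgree (A := A.contract h hne) (B := A.contract (A.flip h) hne')
    ((Equiv.swap (A.vert h) (A.vert (A.flip h))).subtypeEquiv hs)
    (Equiv.subtypeEquivRight fun x => by rw [A.flip_flip, and_comm])
    (fun x => Subtype.ext (by
      rw [contract_vert_val]
      change _ = Equiv.swap (A.vert h) (A.vert (A.flip h)) ((A.contract h hne).vert x).1
      rw [contract_vert_val]
      change (if A.vert x.1 = _ then _ else A.vert x.1) = _
      rw [A.flip_flip]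
      split_ifs with h1 h2 h2
      · exact absurd (h1.symm.trans h2) hne
      · rw [h1, Equiv.swap_apply_left]
      · rw [Equiv.swap_apply_left, h2]
      · rw [Equiv.swap_apply_of_ne_of_ne h1 h2]))
    (fun x => Subtype.ext rfl)
    (fun v => by
      by_cases hm : v.1 = A.vert h
      · have h1 := A.contract_label_merged h hne v hm
        have h2 := A.contract_label_merged (A.flip h) hne'
          ((Equiv.swap (A.vert h) (A.vert (A.flip h))).subtypeEquiv hs v)
          ((congrArg _ hm).trans (Equiv.swap_apply_left _ _))
        have h3 := CyclicOperad.Agree.comp_comm (i := fun x : {x // A.vert x = A.vert h} => x.1)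
          (j := fun x : {x // A.vert x = A.vert (A.flip h)} => x.1)
          ⟨h, rfl⟩ ⟨A.flip h, rfl⟩ (A.label (A.vert h)) (A.label (A.vert (A.flip h)))
        have h4 := (CyclicOperad.Agree.refl (fun x : {x // A.vert x = A.vert (A.flip h)} => x.1)
          (A.label (A.vert (A.flip h)))).comp (A.label_agree (congrArg A.vert (A.flip_flip h).symm))
          Subtype.val_injective Subtype.val_injective
          (x := ⟨A.flip h, rfl⟩) (x' := ⟨A.flip h, rfl⟩) (y := ⟨h, rfl⟩)
          (y' := ⟨A.flip (A.flip h), rfl⟩) rfl (A.flip_flip h).symm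
        exact (h1.symm.trans (h3.trans (h4.trans h2))).pull Subtype.val Subtype.val_injective
          (fun _ => rfl) (fun _ => rfl)
      · have h1 := A.contract_label_unmerged h hne v hm
        have hv : Equiv.swap (A.vert h) (A.vert (A.flip h)) v.1 = v.1 :=
          Equiv.swap_apply_of_ne_of_ne hm v.2
        have h2 := A.contract_label_unmerged (A.flip h) hne'
          ((Equiv.swap (A.vert h) (A.vert (A.flip h))).subtypeEquiv hs v)
          (fun e' => v.2 (hv.symm.trans e'))
        exact (h1.symm.trans ((A.label_agree hv.symm).trans h2)).pull Subtype.val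
          Subtype.val_injective (fun _ => rfl) (fun _ => rfl))

/-- Reversing the contracted edge exchanges the roles of its two ends. The transposition of the ends
gives one sign and the direction of the edge a second one, so they cancel. -/
theorem contractFlipIso_sign (A : OGraph O) (h : A.H) (hne : A.vert h ≠ A.vert (A.flip h))
    (hne' : A.vert (A.flip h) ≠ A.vert (A.flip (A.flip h))) :
    A.contractSign (A.flip h) * (A.contractFlipIso h hne hne').sign = A.contractSign h := by
  classical
  have h1 : vsign k (Equiv.swap (A.vert h) (A.vert (A.flip h))) =
      vsign k (A.contractFlipIso h hne hne').onV *
        (belowSign k (A.vert (A.flip h)) * belowSign k (A.vert (A.flip (A.flip h)))) :=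
    vsign_restrict _ _ _ (A.contractFlipIso h hne hne').onV
      (by rw [A.flip_flip, Equiv.swap_apply_right]) (fun _ => rfl)
  rw [vsign_swap hne] at h1
  rw [Iso.sign_eq, Iso.dsign_eq_one _ (fun x hx => hx), contractSign, contractSign]
  have h2 : signIf k (A.flip h ∉ A.dir) = - signIf k (h ∉ A.dir) := by
    rw [A.flip_mem_dir]
    by_cases p : h ∈ A.dir <;> simp [p, signIf]
  have h3 := belowSign_mul_self (k := k) (A.vert (A.flip h))
  rw [h2]
  linear_combination (-(belowSign k (A.vert (A.flip h)) * signIf k (h ∉ A.dir))) * h1 -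
    (vsign k (A.contractFlipIso h hne hne').onV *
      belowSign k (A.vert (A.flip (A.flip h))) * signIf k (h ∉ A.dir)) * h3

theorem contractCls_flip (A : OGraph O) (h : A.H) :
    A.contractCls (A.flip h) = A.contractCls h := by
  by_cases hne : A.vert h ≠ A.vert (A.flip h)
  · have hne' : A.vert (A.flip h) ≠ A.vert (A.flip (A.flip h)) := by
      rw [A.flip_flip]; exact hne.symm
    rw [contractCls_of_ne _ _ hne, contractCls_of_ne _ _ hne',
      (A.contractFlipIso h hne hne').cls_eq, smul_smul, contractFlipIso_sign]
  · push Not at hne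
    rw [contractCls_of_eq _ _ hne, contractCls_of_eq]
    rw [A.flip_flip, hne]

end OGraph

namespace OGraph

variable {k : Type u} [Field k] {O : CyclicOperad.{u, w} k}

/-! ### Contraction of two edges -/

section DoubleContraction

variable (A : OGraph O) {a b : A.H} (ha : A.vert a ≠ A.vert (A.flip a))
  (hab : b ≠ a ∧ b ≠ A.flip a)

/-- The directed edge `b` after contraction of `a`. -/
abbrev afterContract : (A.contract a ha).H := ⟨b, hab⟩

theorem contract_vert_of_ne (x : (A.contract a ha).H) (h : A.vert x.1 ≠ A.vert (A.flip a)) :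
    ((A.contract a ha).vert x).1 = A.vert x.1 := by
  rw [contract_vert_val, if_neg h]

theorem contract_vert_of_eq (x : (A.contract a ha).H) (h : A.vert x.1 = A.vert (A.flip a)) :
    ((A.contract a ha).vert x).1 = A.vert a := by
  rw [contract_vert_val, if_pos h]

variable (hb : (A.contract a ha).vert (A.afterContract ha hab) ≠
  (A.contract a ha).vert ((A.contract a ha).flip (A.afterContract ha hab)))

open Classical in
theorem contract_contract_vert
    (x : ((A.contract a ha).contract (A.afterContract ha hab) hb).H) :
    (((A.contract a ha).contract (A.afterContract ha hab) hb).vert x).1.1 =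
      if ((A.contract a ha).vert x.1).1 =
        ((A.contract a ha).vert ((A.contract a ha).flip (A.afterContract ha hab))).1
      then ((A.contract a ha).vert (A.afterContract ha hab)).1
      else ((A.contract a ha).vert x.1).1 := by
  rw [contract_vert_val]
  by_cases h : (A.contract a ha).vert x.1 =
      (A.contract a ha).vert ((A.contract a ha).flip (A.afterContract ha hab))
  · rw [if_pos h, if_pos (congrArg Subtype.val h)]
  · rw [if_neg h, if_neg (fun e => h (Subtype.ext e))]

theorem contract_contract_label_first
    (v : ((A.contract a ha).contract (A.afterContract ha hab) hb).V) (hv : v.1.1 = A.vert a)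
    (hv' : v.1 ≠ (A.contract a ha).vert (A.afterContract ha hab)) :
    O.Agree
      (Sum.elim (fun x : {x : {x // A.vert x = A.vert a} // x ≠ ⟨a, rfl⟩} => x.1.1)
        (fun y : {y : {x // A.vert x = A.vert (A.flip a)} // y ≠ ⟨A.flip a, rfl⟩} => y.1.1))
      (fun x : {x // ((A.contract a ha).contract (A.afterContract ha hab) hb).vert x = v} =>
        x.1.1.1)
      (O.comp ⟨a, rfl⟩ ⟨A.flip a, rfl⟩ (A.label (A.vert a)) (A.label (A.vert (A.flip a))))
      (((A.contract a ha).contract (A.afterContract ha hab) hb).label v) :=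
  (A.contract_label_merged a ha v.1 hv).trans
    (((A.contract a ha).contract_label_unmerged _ hb v hv').push Subtype.val
      (fun _ => rfl) (fun _ => rfl))

theorem contract_contract_label_second
    (v : ((A.contract a ha).contract (A.afterContract ha hab) hb).V)
    (hv : v.1 = (A.contract a ha).vert (A.afterContract ha hab))
    (h1 : A.vert b ≠ A.vert a) (h2 : A.vert b ≠ A.vert (A.flip a))
    (h3 : A.vert (A.flip b) ≠ A.vert a) (h4 : A.vert (A.flip b) ≠ A.vert (A.flip a)) :
    O.Agree
      (Sum.elim (fun x : {x : {x // A.vert x = A.vert b} // x ≠ ⟨b, rfl⟩} => x.1.1)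
        (fun y : {y : {x // A.vert x = A.vert (A.flip b)} // y ≠ ⟨A.flip b, rfl⟩} => y.1.1))
      (fun x : {x // ((A.contract a ha).contract (A.afterContract ha hab) hb).vert x = v} =>
        x.1.1.1)
      (O.comp ⟨b, rfl⟩ ⟨A.flip b, rfl⟩ (A.label (A.vert b)) (A.label (A.vert (A.flip b))))
      (((A.contract a ha).contract (A.afterContract ha hab) hb).label v) := by
  have e1 : ((A.contract a ha).vert (A.afterContract ha hab)).1 = A.vert b :=
    A.contract_vert_of_ne ha (A.afterContract ha hab) h2
  have e2 : ((A.contract a ha).vert ((A.contract a ha).flip (A.afterContract ha hab))).1 =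
      A.vert (A.flip b) :=
    A.contract_vert_of_ne ha ((A.contract a ha).flip (A.afterContract ha hab)) h4
  have l1 := (A.label_agree e1.symm).trans
    (A.contract_label_unmerged a ha _ (by rw [e1]; exact h1))
  have l2 := (A.label_agree e2.symm).trans
    (A.contract_label_unmerged a ha _ (by rw [e2]; exact h3))
  have l3 := l1.comp l2 (Subtype.val_injective.comp Subtype.val_injective)
    (Subtype.val_injective.comp Subtype.val_injective)
    (x := ⟨b, rfl⟩) (x' := ⟨A.afterContract ha hab, rfl⟩)
    (y := ⟨A.flip b, rfl⟩) (y' := ⟨(A.contract a ha).flip (A.afterContract ha hab), rfl⟩) rfl rfl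
  refine l3.trans (((A.contract a ha).contract_label_merged _ hb v hv).push Subtype.val
    ?_ (fun _ => rfl))
  rintro (x | y) <;> rfl

theorem contract_contract_label_of_ne
    (v : ((A.contract a ha).contract (A.afterContract ha hab) hb).V) (hv : v.1.1 ≠ A.vert a)
    (hv' : v.1 ≠ (A.contract a ha).vert (A.afterContract ha hab)) :
    O.Agree (fun x : {x // A.vert x = v.1.1} => x.1)
      (fun x : {x // ((A.contract a ha).contract (A.afterContract ha hab) hb).vert x = v} =>
        x.1.1.1)
      (A.label v.1.1) (((A.contract a ha).contract (A.afterContract ha hab) hb).label v) :=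
  (A.contract_label_unmerged a ha v.1 hv).trans
    (((A.contract a ha).contract_label_unmerged _ hb v hv').push Subtype.val
      (fun _ => rfl) (fun _ => rfl))

variable (hb' : A.vert b ≠ A.vert (A.flip b)) (hba : a ≠ b ∧ a ≠ A.flip b)
  (ha' : (A.contract b hb').vert (A.afterContract hb' hba) ≠
    (A.contract b hb').vert ((A.contract b hb').flip (A.afterContract hb' hba)))

/-- The edges `a` and `b` form a path of three vertices, and the two orders of contraction give the
two bracketings in the associativity of the operad. -/
theorem contract_contract_label_path (hp : A.vert b = A.vert (A.flip a))
    (h1 : A.vert (A.flip b) ≠ A.vert a)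
    (v : ((A.contract a ha).contract (A.afterContract ha hab) hb).V) (hv : v.1.1 = A.vert a)
    (w : ((A.contract b hb').contract (A.afterContract hb' hba) ha').V) (hw : w.1.1 = A.vert a) :
    O.Agree
      (fun x : {x // ((A.contract a ha).contract (A.afterContract ha hab) hb).vert x = v} =>
        x.1.1.1)
      (fun x : {x // ((A.contract b hb').contract (A.afterContract hb' hba) ha').vert x = w} =>
        x.1.1.1)
      (((A.contract a ha).contract (A.afterContract ha hab) hb).label v)
      (((A.contract b hb').contract (A.afterContract hb' hba) ha').label w) := by
  have e1 : ((A.contract a ha).vert (A.afterContract ha hab)).1 = A.vert a :=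
    A.contract_vert_of_eq ha (A.afterContract ha hab) hp
  have e2 : ((A.contract a ha).vert ((A.contract a ha).flip (A.afterContract ha hab))).1 =
      A.vert (A.flip b) :=
    A.contract_vert_of_ne ha ((A.contract a ha).flip (A.afterContract ha hab))
      (fun e => hb' (hp.trans e.symm))
  have f1 : ((A.contract b hb').vert (A.afterContract hb' hba)).1 = A.vert a :=
    A.contract_vert_of_ne hb' (A.afterContract hb' hba) h1.symm
  have f2 : ((A.contract b hb').vert ((A.contract b hb').flip (A.afterContract hb' hba))).1 =
      A.vert b :=
    (A.contract_vert_of_ne hb' ((A.contract b hb').flip (A.afterContract hb' hba))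
      (fun e => hb' (hp.trans e))).trans hp.symm
  let y : {x // A.vert x = A.vert (A.flip a)} := ⟨A.flip a, rfl⟩
  let y' : {x // A.vert x = A.vert (A.flip a)} := ⟨b, hp⟩
  have hy : y ≠ y' := fun e => hab.2 (congrArg Subtype.val e).symm
  have l1 := A.contract_label_merged a ha _ e1
  have l2 := (A.label_agree e2.symm).trans (A.contract_label_unmerged a ha _
    (by rw [e2]; exact h1))
  have l3 := l1.comp l2 (Subtype.val_injective.comp Subtype.val_injective)
    (Subtype.val_injective.comp Subtype.val_injective)
    (x := Sum.inr ⟨y', hy.symm⟩) (x' := ⟨A.afterContract ha hab, rfl⟩)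
    (y := ⟨A.flip b, rfl⟩) (y' := ⟨(A.contract a ha).flip (A.afterContract ha hab), rfl⟩) rfl rfl
  have l4 := ((A.contract a ha).contract_label_merged _ hb v (Subtype.ext (hv.trans e1.symm))).push
    Subtype.val
    (i' := Sum.elim (fun x : {x : {x // (A.contract a ha).vert x =
        (A.contract a ha).vert (A.afterContract ha hab)} // x ≠ ⟨A.afterContract ha hab, rfl⟩} =>
        x.1.1.1) (fun x => x.1.1.1))
    (by rintro (x | y) <;> rfl) (fun _ => rfl)
  have m1 := (A.label_agree f1.symm).trans (A.contract_label_unmerged b hb' _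
    (by rw [f1, hp]; exact ha))
  have m2 := ((A.label_agree hp.symm).comp (A.label_agree rfl)
    Subtype.val_injective Subtype.val_injective
    (x := y') (x' := ⟨b, rfl⟩) (y := ⟨A.flip b, rfl⟩) (y' := ⟨A.flip b, rfl⟩) rfl rfl).trans
    (A.contract_label_merged b hb' _ f2)
  have m3 := m1.comp m2 (Subtype.val_injective.comp Subtype.val_injective)
    (Subtype.val_injective.comp Subtype.val_injective)
    (x := ⟨a, rfl⟩) (x' := ⟨A.afterContract hb' hba, rfl⟩)
    (y := Sum.inl ⟨y, hy⟩) (y' := ⟨(A.contract b hb').flip (A.afterContract hb' hba), rfl⟩) rfl rfl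
  have m4 := ((A.contract b hb').contract_label_merged _ ha' w
    (Subtype.ext (hw.trans f1.symm))).push Subtype.val
    (i' := Sum.elim (fun x : {x : {x // (A.contract b hb').vert x =
        (A.contract b hb').vert (A.afterContract hb' hba)} // x ≠ ⟨A.afterContract hb' hba, rfl⟩} =>
        x.1.1.1) (fun x => x.1.1.1))
    (by rintro (x | y) <;> rfl) (fun _ => rfl)
  have as := CyclicOperad.Agree.comp_assoc (O := O)
    (i := fun x : {x // A.vert x = A.vert a} => x.1)
    (j := fun x : {x // A.vert x = A.vert (A.flip a)} => x.1)
    (l := fun x : {x // A.vert x = A.vert (A.flip b)} => x.1)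
    ⟨a, rfl⟩ y y' ⟨A.flip b, rfl⟩ hy (A.label _) (A.label _) (A.label _)
  exact (l3.trans l4).symm.trans (as.trans (m3.trans m4))

/-- Contraction of two edges in either order; the head of `b` is not an end of `a`. -/
noncomputable def contractContractIso (h1 : A.vert (A.flip b) ≠ A.vert a)
    (h2 : A.vert (A.flip b) ≠ A.vert (A.flip a)) (h3 : A.vert b ≠ A.vert a) :
    Iso ((A.contract a ha).contract (A.afterContract ha hab) hb)
      ((A.contract b hb').contract (A.afterContract hb' hba) ha') :=
  have e2 : ((A.contract a ha).vert ((A.contract a ha).flip (A.afterContract ha hab))).1 =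
      A.vert (A.flip b) :=
    A.contract_vert_of_ne ha ((A.contract a ha).flip (A.afterContract ha hab)) h2
  have f2 : ((A.contract b hb').vert ((A.contract b hb').flip (A.afterContract hb' hba))).1 =
      A.vert (A.flip a) :=
    A.contract_vert_of_ne hb' ((A.contract b hb').flip (A.afterContract hb' hba)) h2.symm
  have f1 : ((A.contract b hb').vert (A.afterContract hb' hba)).1 = A.vert a :=
    A.contract_vert_of_ne hb' (A.afterContract hb' hba) h1.symm
  -- Both double contractions delete the same vertices, the heads of `a` and `b`, so the isomorphism
  -- is the identity on what survives.
  let onV : ((A.contract a ha).contract (A.afterContract ha hab) hb).V ≃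
      ((A.contract b hb').contract (A.afterContract hb' hba) ha').V :=
    { toFun := fun v => ⟨⟨v.1.1, fun e => v.2 (Subtype.ext (e.trans e2.symm))⟩,
        fun e => v.1.2 ((congrArg Subtype.val e).trans f2)⟩
      invFun := fun v => ⟨⟨v.1.1, fun e => v.2 (Subtype.ext (e.trans f2.symm))⟩,
        fun e => v.1.2 ((congrArg Subtype.val e).trans e2)⟩
      left_inv := fun _ => rfl
      right_inv := fun _ => rfl }
  let onH : ((A.contract a ha).contract (A.afterContract ha hab) hb).H ≃
      ((A.contract b hb').contract (A.afterContract hb' hba) ha').H :=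
    { toFun := fun x => ⟨⟨x.1.1, fun e => x.2.1 (Subtype.ext e), fun e => x.2.2 (Subtype.ext e)⟩,
        fun e => x.1.2.1 (congrArg Subtype.val e), fun e => x.1.2.2 (congrArg Subtype.val e)⟩
      invFun := fun x => ⟨⟨x.1.1, fun e => x.2.1 (Subtype.ext e), fun e => x.2.2 (Subtype.ext e)⟩,
        fun e => x.1.2.1 (congrArg Subtype.val e), fun e => x.1.2.2 (congrArg Subtype.val e)⟩
      left_inv := fun _ => rfl
      right_inv := fun _ => rfl }
  Iso.ofAgree onV onH
    (fun x => by
      refine Subtype.ext (Subtype.ext ?_)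
      change _ = (((A.contract a ha).contract (A.afterContract ha hab) hb).vert x).1.1
      classical
      rw [contract_contract_vert, contract_contract_vert, e2, f2, f1, contract_vert_val,
        contract_vert_val, contract_vert_val]
      change (if (if A.vert x.1.1 = _ then _ else A.vert x.1.1) = _ then _ else
        if A.vert x.1.1 = _ then _ else A.vert x.1.1) =
        if _ then if A.vert b = _ then _ else A.vert b else _
      split_ifs <;> simp_all)
    (fun x => rfl)
    (fun v => by
      have c1 : (onV v).1.1 = v.1.1 := rfl
      refine CyclicOperad.Agree.pull (i' := fun x => x.1.1.1) (j' := fun x => x.1.1.1) ?_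
        (fun x => x.1.1) (Subtype.val_injective.comp Subtype.val_injective)
        (fun _ => rfl) (fun _ => rfl)
      -- Either `b` continues `a`, which is the case of a path, or the two edges have no common end
      -- and each label is composed at most once.
      by_cases hp : A.vert b = A.vert (A.flip a)
      · have e1 : ((A.contract a ha).vert (A.afterContract ha hab)).1 = A.vert a :=
          A.contract_vert_of_eq ha (A.afterContract ha hab) hp
        by_cases hv : v.1.1 = A.vert a
        · exact A.contract_contract_label_path ha hab hb hb' hba ha' hp h1 v hv _ hv
        · exact (A.contract_contract_label_of_ne ha hab hb v hv
            (fun e => hv ((congrArg Subtype.val e).trans e1))).symm.trans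
            (A.contract_contract_label_of_ne hb' hba ha' (onV v)
              (fun e => v.1.2 (e.trans hp))
              (fun e => hv ((congrArg Subtype.val e).trans f1)))
      · have e1 : ((A.contract a ha).vert (A.afterContract ha hab)).1 = A.vert b :=
          A.contract_vert_of_ne ha (A.afterContract ha hab) hp
        by_cases hv : v.1.1 = A.vert a
        · exact (A.contract_contract_label_first ha hab hb v hv
            (fun e => h3 (e1.symm.trans ((congrArg Subtype.val e).symm.trans hv)))).symm.trans
            (A.contract_contract_label_second hb' hba ha' (onV v)
              (Subtype.ext (hv.trans f1.symm)) h3.symm h1.symm (Ne.symm hp) h2.symm)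
        · by_cases hv' : v.1.1 = A.vert b
          · exact (A.contract_contract_label_second ha hab hb v (Subtype.ext (hv'.trans e1.symm))
              h3 hp h1 h2).symm.trans (A.contract_contract_label_first hb' hba ha' (onV v) hv'
              (fun e => hv ((congrArg Subtype.val e).trans f1)))
          · exact (A.contract_contract_label_of_ne ha hab hb v hv
              (fun e => hv' ((congrArg Subtype.val e).trans e1))).symm.trans
              (A.contract_contract_label_of_ne hb' hba ha' (onV v) hv'
                (fun e => hv ((congrArg Subtype.val e).trans f1))))

end DoubleContraction

end OGraph

/-! ### Anticommutation of contractions -/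

namespace OGraph

variable {k : Type u} [Field k] {O : CyclicOperad.{u, w} k}

open Classical in
/-- The contraction of `a`, followed by the contraction of `b`. -/
noncomputable def contract2Cls (A : OGraph O) (a b : A.H) : GraphComplex O :=
  if h : A.vert a ≠ A.vert (A.flip a) ∧ b ≠ a ∧ b ≠ A.flip a then
    A.contractSign a • (A.contract a h.1).contractCls (A.afterContract h.1 h.2)
  else 0

theorem contract2Cls_of_ne (A : OGraph O) {a b : A.H} (ha : A.vert a ≠ A.vert (A.flip a))
    (hab : b ≠ a ∧ b ≠ A.flip a) : A.contract2Cls a b =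
      A.contractSign a • (A.contract a ha).contractCls (A.afterContract ha hab) :=
  dif_pos ⟨ha, hab⟩

theorem Iso.contract2Cls_eq {A B : OGraph O} (f : Iso A B) (a b : A.H) :
    B.contract2Cls (f.onH a) (f.onH b) = f.sign • A.contract2Cls a b := by
  have hv : A.vert a ≠ A.vert (A.flip a) ↔ B.vert (f.onH a) ≠ B.vert (B.flip (f.onH a)) := by
    rw [f.flip_onH, f.vert_onH, f.vert_onH, Ne, Ne, f.onV.apply_eq_iff_eq]
  have hb : (b ≠ a ∧ b ≠ A.flip a) ↔ f.onH b ≠ f.onH a ∧ f.onH b ≠ B.flip (f.onH a) := by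
    rw [f.flip_onH, Ne, Ne, Ne, Ne, f.onH.apply_eq_iff_eq, f.onH.apply_eq_iff_eq]
  by_cases h : A.vert a ≠ A.vert (A.flip a) ∧ b ≠ a ∧ b ≠ A.flip a
  · rw [contract2Cls_of_ne A h.1 h.2, contract2Cls_of_ne B (hv.1 h.1) (hb.1 h.2),
      (f.contract a _ rfl h.1 (hv.1 h.1)).contractCls_eq (A.afterContract h.1 h.2)
        (B.afterContract (hv.1 h.1) (hb.1 h.2)) rfl,
      smul_smul, smul_smul, f.contract_sign a _ rfl h.1 (hv.1 h.1)]
    congr 1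
    linear_combination (-(B.contractSign (f.onH a) *
      (f.contract a _ rfl h.1 (hv.1 h.1)).sign)) * A.contractSign_mul_self a
  · rw [contract2Cls, contract2Cls, dif_neg h, dif_neg, smul_zero]
    rw [← hv, ← hb]
    exact h

theorem contract2Cls_flip_right (A : OGraph O) (a b : A.H) :
    A.contract2Cls a (A.flip b) = A.contract2Cls a b := by
  have hb : (b ≠ a ∧ b ≠ A.flip a) ↔ A.flip b ≠ a ∧ A.flip b ≠ A.flip a := by
    rw [and_comm, Ne, Ne, Ne, Ne, A.flip_injective.eq_iff,
      ← A.flip_injective.eq_iff (a := A.flip b), A.flip_flip]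
  by_cases h : A.vert a ≠ A.vert (A.flip a) ∧ b ≠ a ∧ b ≠ A.flip a
  · rw [contract2Cls_of_ne A h.1 h.2, contract2Cls_of_ne A h.1 (hb.1 h.2),
      ← contractCls_flip _ (A.afterContract h.1 h.2)]
    rfl
  · rw [contract2Cls, contract2Cls, dif_neg h, dif_neg]
    rw [← hb]
    exact h

theorem contract2Cls_flip_left (A : OGraph O) (a b : A.H) :
    A.contract2Cls (A.flip a) b = A.contract2Cls a b := by
  have hv : A.vert a ≠ A.vert (A.flip a) ↔ A.vert (A.flip a) ≠ A.vert (A.flip (A.flip a)) := by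
    rw [A.flip_flip, ne_comm]
  have hb : (b ≠ a ∧ b ≠ A.flip a) ↔ b ≠ A.flip a ∧ b ≠ A.flip (A.flip a) := by
    rw [A.flip_flip, and_comm]
  by_cases h : A.vert a ≠ A.vert (A.flip a) ∧ b ≠ a ∧ b ≠ A.flip a
  · rw [contract2Cls_of_ne A h.1 h.2, contract2Cls_of_ne A (hv.1 h.1) (hb.1 h.2),
      (A.contractFlipIso a h.1 (hv.1 h.1)).contractCls_eq (A.afterContract h.1 h.2)
        (A.afterContract (hv.1 h.1) (hb.1 h.2)) rfl,
      smul_smul, contractFlipIso_sign]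
  · rw [contract2Cls, contract2Cls, dif_neg h, dif_neg]
    rw [← hv, ← hb]
    exact h

theorem contract2Cls_of_eq_left (A : OGraph O) {a b : A.H} (ha : A.vert a = A.vert (A.flip a)) :
    A.contract2Cls a b = 0 :=
  dif_neg fun h => h.1 ha

theorem contract2Cls_of_eq_right (A : OGraph O) {a b : A.H} (hb : A.vert b = A.vert (A.flip b)) :
    A.contract2Cls a b = 0 := by
  by_cases h : A.vert a ≠ A.vert (A.flip a) ∧ b ≠ a ∧ b ≠ A.flip a
  · rw [contract2Cls_of_ne A h.1 h.2, contractCls_of_eq, smul_zero]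
    refine Subtype.ext ?_
    classical
    rw [contract_vert_val, contract_vert_val]
    change (if A.vert b = _ then _ else A.vert b) =
      (if A.vert (A.flip b) = _ then _ else A.vert (A.flip b))
    rw [hb]
  · exact dif_neg h

/-- Once `a` is contracted, an edge `b` between its two ends is a loop. -/
theorem contract2Cls_of_parallel (A : OGraph O) {a b : A.H}
    (h1 : A.vert b = A.vert a ∨ A.vert b = A.vert (A.flip a))
    (h2 : A.vert (A.flip b) = A.vert a ∨ A.vert (A.flip b) = A.vert (A.flip a)) :
    A.contract2Cls a b = 0 := by
  by_cases h : A.vert a ≠ A.vert (A.flip a) ∧ b ≠ a ∧ b ≠ A.flip a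
  · rw [contract2Cls_of_ne A h.1 h.2, contractCls_of_eq, smul_zero]
    refine Subtype.ext ?_
    classical
    rw [contract_vert_val, contract_vert_val]
    change (if A.vert b = _ then _ else A.vert b) =
      (if A.vert (A.flip b) = _ then _ else A.vert (A.flip b))
    rcases h1 with h1 | h1 <;> rcases h2 with h2 | h2 <;> simp [h1, h2]
  · exact dif_neg h

/-- The two results are identified by the identity on survivors, with sign 1. Of the two heads one
precedes the other, so exactly one of the two predecessor counts drops by one when the other head
has been removed; this is the sign. -/
theorem contract2Cls_swap_of_ne (A : OGraph O) {a b : A.H} (ha : A.vert a ≠ A.vert (A.flip a))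
    (hb : A.vert b ≠ A.vert (A.flip b)) (h1 : A.vert (A.flip b) ≠ A.vert a)
    (h2 : A.vert (A.flip b) ≠ A.vert (A.flip a)) (h3 : A.vert b ≠ A.vert a) :
    A.contract2Cls b a = - A.contract2Cls a b := by
  have hab : b ≠ a ∧ b ≠ A.flip a :=
    ⟨fun e => h3 (by rw [e]), fun e => h1 (by rw [e, A.flip_flip])⟩
  have hba : a ≠ b ∧ a ≠ A.flip b :=
    ⟨fun e => h3 (by rw [e]), fun e => h1 (by rw [e])⟩
  have e2 : ((A.contract a ha).vert ((A.contract a ha).flip (A.afterContract ha hab))).1 =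
      A.vert (A.flip b) :=
    A.contract_vert_of_ne ha ((A.contract a ha).flip (A.afterContract ha hab)) h2
  have f2 : ((A.contract b hb).vert ((A.contract b hb).flip (A.afterContract hb hba))).1 =
      A.vert (A.flip a) :=
    A.contract_vert_of_ne hb ((A.contract b hb).flip (A.afterContract hb hba)) h2.symm
  have f1 : ((A.contract b hb).vert (A.afterContract hb hba)).1 = A.vert a :=
    A.contract_vert_of_ne hb (A.afterContract hb hba) h1.symm
  have hb' : (A.contract a ha).vert (A.afterContract ha hab) ≠
      (A.contract a ha).vert ((A.contract a ha).flip (A.afterContract ha hab)) := by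
    intro e
    have e' := (congrArg Subtype.val e).trans e2
    by_cases hp : A.vert b = A.vert (A.flip a)
    · exact h1 ((A.contract_vert_of_eq ha (A.afterContract ha hab) hp).symm.trans e').symm
    · exact hb ((A.contract_vert_of_ne ha (A.afterContract ha hab) hp).symm.trans e')
  have ha' : (A.contract b hb).vert (A.afterContract hb hba) ≠
      (A.contract b hb).vert ((A.contract b hb).flip (A.afterContract hb hba)) :=
    fun e => ha (f1.symm.trans ((congrArg Subtype.val e).trans f2))
  have s1 : belowSign k (A.vert (A.flip b)) =
      belowSign k ((A.contract a ha).vert ((A.contract a ha).flip (A.afterContract ha hab))) *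
        signIf k (A.vert (A.flip a) < A.vert (A.flip b)) := by
    rw [belowSign_subtype h2]
    congr 1
    exact congrArg (belowSign k) (Subtype.ext e2.symm)
  have s2 : belowSign k (A.vert (A.flip a)) =
      belowSign k ((A.contract b hb).vert ((A.contract b hb).flip (A.afterContract hb hba))) *
        signIf k (A.vert (A.flip b) < A.vert (A.flip a)) := by
    rw [belowSign_subtype h2.symm]
    congr 1
    exact congrArg (belowSign k) (Subtype.ext f2.symm)
  have s3 : signIf k (A.vert (A.flip a) < A.vert (A.flip b)) =
      - signIf k (A.vert (A.flip b) < A.vert (A.flip a)) := by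
    rcases lt_or_gt_of_ne h2 with h | h <;> simp [signIf, h, not_lt_of_gt h]
  have s4 := signIf_mul_self k (A.vert (A.flip b) < A.vert (A.flip a))
  have hs : (A.contractContractIso ha hab hb' hb hba ha' h1 h2 h3).sign = (1 : k) :=
    Iso.sign_eq_one _ (fun _ _ h => h) (fun _ h => h)
  rw [contract2Cls_of_ne A hb hba, contract2Cls_of_ne A ha hab, contractCls_of_ne _ _ hb',
    contractCls_of_ne _ _ ha', (A.contractContractIso ha hab hb' hb hba ha' h1 h2 h3).cls_eq, hs,
    one_smul, smul_smul, smul_smul, ← neg_smul]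
  congr 1
  have d1 : signIf k (A.afterContract ha hab ∉ (A.contract a ha).dir) = signIf k (b ∉ A.dir) := rfl
  have d2 : signIf k (A.afterContract hb hba ∉ (A.contract b hb).dir) = signIf k (a ∉ A.dir) := rfl
  simp only [contractSign, d1, d2]
  rw [s1, s2, s3]
  ring

/-- Contractions of two edges anticommute. -/
theorem contract2Cls_swap (A : OGraph O) (a b : A.H) :
    A.contract2Cls b a = - A.contract2Cls a b := by
  by_cases ha : A.vert a = A.vert (A.flip a)
  · rw [contract2Cls_of_eq_right A ha, contract2Cls_of_eq_left A ha, neg_zero]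
  by_cases hb : A.vert b = A.vert (A.flip b)
  · rw [contract2Cls_of_eq_right A hb, contract2Cls_of_eq_left A hb, neg_zero]
  by_cases hp : (A.vert b = A.vert a ∨ A.vert b = A.vert (A.flip a)) ∧
      (A.vert (A.flip b) = A.vert a ∨ A.vert (A.flip b) = A.vert (A.flip a))
  · rw [contract2Cls_of_parallel A hp.1 hp.2, contract2Cls_of_parallel A, neg_zero]
    · rcases hp with ⟨h | h, h' | h'⟩
      · exact absurd (h.trans h'.symm) hb
      · exact .inl h.symm
      · exact .inr h'.symm
      · exact absurd (h.trans h'.symm) hb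
    · rcases hp with ⟨h | h, h' | h'⟩
      · exact absurd (h.trans h'.symm) hb
      · exact .inr h'.symm
      · exact .inl h.symm
      · exact absurd (h.trans h'.symm) hb
  -- The remaining configurations are reduced to `contract2Cls_swap_of_ne` by reversing one or both
  -- edges, which does not change the double contraction.
  by_cases h1 : A.vert (A.flip b) = A.vert a
  · rw [← contract2Cls_flip_left, ← contract2Cls_flip_right, ← contract2Cls_flip_left A a,
      ← contract2Cls_flip_right A _ b]
    refine contract2Cls_swap_of_ne A ?_ ?_ ?_ ?_ ?_ <;> try simp only [A.flip_flip]
    all_goals grind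
  by_cases h2 : A.vert (A.flip b) = A.vert (A.flip a)
  · rw [← contract2Cls_flip_left, ← contract2Cls_flip_right A a b]
    refine contract2Cls_swap_of_ne A ?_ ?_ ?_ ?_ ?_ <;> try simp only [A.flip_flip]
    all_goals grind
  by_cases h3 : A.vert b = A.vert a
  · rw [← contract2Cls_flip_right, ← contract2Cls_flip_left A a b]
    refine contract2Cls_swap_of_ne A ?_ ?_ ?_ ?_ ?_ <;> try simp only [A.flip_flip]
    all_goals grind
  exact contract2Cls_swap_of_ne A ha hb h1 h2 h3

end OGraph

/-! ### Cyclic permutations -/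

section FormPerm

open Classical in
theorem List.formPerm_map_apply {α β : Type} (f : α → β) (hf : Function.Injective f) (l : List α)
    (x : α) : (l.map f).formPerm (f x) = f (l.formPerm x) := by
  induction l generalizing x with
  | nil => rfl
  | cons y l ih =>
    cases l with
    | nil => simp
    | cons z l =>
      rw [List.map_cons, List.map_cons, List.formPerm_cons_cons, List.formPerm_cons_cons,
        Equiv.Perm.mul_apply, Equiv.Perm.mul_apply, ← List.map_cons, ih]
      exact (hf.map_swap _ _ _).symm

-- Two polygons glued along the common edge `x` form one polygon: the cyclic permutations multiply
-- to the one of the concatenated list.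
open Classical in
theorem List.formPerm_append_cons {α : Type} (l l' : List α) (x : α) :
    (l ++ x :: l').formPerm = (l ++ [x]).formPerm * (x :: l').formPerm := by
  induction l with
  | nil => simp
  | cons y l ih =>
    cases l with
    | nil => simp [List.formPerm_cons_cons]
    | cons z l =>
      simp only [List.cons_append, List.formPerm_cons_cons] at ih ⊢
      rw [ih, mul_assoc]

end FormPerm

theorem neg_one_pow_ncard_sum {k : Type u} [Field k] {α β : Type} [Finite α] [Finite β]
    (S : Set (α ⊕ β)) :
    (-1 : k) ^ S.ncard = (-1) ^ (Sum.inl ⁻¹' S).ncard * (-1) ^ (Sum.inr ⁻¹' S).ncard := by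
  have := Fintype.ofFinite α
  have := Fintype.ofFinite β
  rw [neg_one_pow_ncard, neg_one_pow_ncard, neg_one_pow_ncard, Fintype.prod_sum_type]
  rfl

namespace OGraph

variable {k : Type u} [Field k] {O : CyclicOperad.{u, w} k}

/-! ### Twisting the involution by a permutation of the half-edges -/

/-- The graph whose edges and directions are the images of those of `A` under a permutation of the
half-edges. -/
abbrev twist (A : OGraph O) (c : Equiv.Perm A.H) : OGraph O :=
  { A with
    flip := fun h => c (A.flip (c.symm h))
    flip_flip := fun h => by simp [A.flip_flip]
    flip_ne := fun h he => A.flip_ne (c.symm h) (by rw [Equiv.eq_symm_apply]; exact he)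
    dir := {h | c.symm h ∈ A.dir}
    mem_dir := fun h => by simpa using A.mem_dir (c.symm h) }

open Classical in
/-- An isomorphism that carries one permutation to another one. -/
def Iso.twist {A B : OGraph O} (f : Iso A B) (c : Equiv.Perm A.H) (d : Equiv.Perm B.H)
    (h : ∀ x, d (f.onH x) = f.onH (c x)) : Iso (A.twist c) (B.twist d) where
  onV := f.onV
  onH := f.onH
  vert_onH := f.vert_onH
  flip_onH x := by
    have : d.symm (f.onH x) = f.onH (c.symm x) := by
      rw [Equiv.symm_apply_eq, h, Equiv.apply_symm_apply]
    change d (B.flip (d.symm (f.onH x))) = f.onH (c (A.flip (c.symm x)))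
    rw [this, f.flip_onH, h]
  label_onV := f.label_onV

theorem Iso.twist_sign {A B : OGraph O} (f : Iso A B) (c : Equiv.Perm A.H) (d : Equiv.Perm B.H)
    (h : ∀ x, d (f.onH x) = f.onH (c x)) : (f.twist c d h).sign = (f.sign : k) := by
  rw [Iso.sign_eq, Iso.sign_eq]
  congr 1
  refine neg_one_pow_ncard_congr k c.symm fun x => ?_
  have : d.symm (f.onH x) = f.onH (c.symm x) := by
    rw [Equiv.symm_apply_eq, h, Equiv.apply_symm_apply]
  change c.symm x ∈ A.dir ∧ d.symm (f.onH x) ∉ B.dir ↔ _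
  rw [this]
  rfl

open Classical in
/-- The contribution of a list of directed edges to the fusion. -/
noncomputable def fusionTerm (A : OGraph O) : List A.H → GraphComplex O
  | [] => 0
  | x :: l => (A.twist (x :: l).formPerm).contractCls (A.flip x)

theorem Iso.fusionTerm_eq {A B : OGraph O} (f : Iso A B) (l : List A.H) :
    B.fusionTerm (l.map f.onH) = f.sign • A.fusionTerm l := by
  classical
  cases l with
  | nil => exact (smul_zero _).symm
  | cons x l =>
    rw [fusionTerm, List.map_cons, fusionTerm,
      ← f.twist_sign (x :: l).formPerm ((x :: l).map f.onH).formPerm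
        (fun y => List.formPerm_map_apply _ f.onH.injective _ y)]
    exact Iso.contractCls_eq _ _ _ (f.flip_onH x).symm

/-! ### Disjoint unions of two graphs -/

/-- The half-edges at a vertex of the first summand. -/
def inlFibre {H K V W : Type} (f : H → V) (g : K → W) (v : V) : {h // f h = v} ≃
    {h : H ⊕ K // toLex (Sum.map f g h) = toLex (Sum.inl v)} where
  toFun h := ⟨Sum.inl h.1, congrArg (toLex ∘ Sum.inl) h.2⟩
  invFun
    | ⟨Sum.inl h, e⟩ => ⟨h, Sum.inl_injective (toLex.injective e)⟩
    | ⟨Sum.inr _, e⟩ => absurd (toLex.injective e) Sum.inr_ne_inl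
  left_inv _ := rfl
  right_inv := by
    rintro ⟨h | h, e⟩
    · rfl
    · exact absurd (toLex.injective e) Sum.inr_ne_inl

/-- The half-edges at a vertex of the second summand. -/
def inrFibre {H K V W : Type} (f : H → V) (g : K → W) (v : W) : {h // g h = v} ≃
    {h : H ⊕ K // toLex (Sum.map f g h) = toLex (Sum.inr v)} where
  toFun h := ⟨Sum.inr h.1, congrArg (toLex ∘ Sum.inr) h.2⟩
  invFun
    | ⟨Sum.inr h, e⟩ => ⟨h, Sum.inr_injective (toLex.injective e)⟩
    | ⟨Sum.inl _, e⟩ => absurd (toLex.injective e) Sum.inl_ne_inr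
  left_inv _ := rfl
  right_inv := by
    rintro ⟨h | h, e⟩
    · exact absurd (toLex.injective e) Sum.inl_ne_inr
    · rfl

/-- The disjoint union of two graphs; the vertices of the first one come first. -/
def sum (A B : OGraph O) : OGraph O where
  V := Lex (A.V ⊕ B.V)
  H := A.H ⊕ B.H
  finV := inferInstanceAs (Finite (A.V ⊕ B.V))
  order := Sum.Lex.linearOrder
  vert h := toLex (Sum.map A.vert B.vert h)
  flip := Sum.map A.flip B.flip
  flip_flip := by rintro (h | h) <;> simp [A.flip_flip, B.flip_flip]
  flip_ne := by rintro (h | h) <;> simp [A.flip_ne, B.flip_ne]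
  dir := {h | Sum.elim (· ∈ A.dir) (· ∈ B.dir) h}
  mem_dir := by
    rintro (h | h)
    · exact A.mem_dir h
    · exact B.mem_dir h
  valence v := by
    rcases v with v | v
    · refine (A.valence v).trans (Nat.card_le_card_of_injective
        (fun h => ⟨Sum.inl h.1, congrArg (toLex ∘ Sum.inl) h.2⟩) ?_)
      exact fun a b e => Subtype.ext (Sum.inl_injective (congrArg Subtype.val e))
    · refine (B.valence v).trans (Nat.card_le_card_of_injective
        (fun h => ⟨Sum.inr h.1, congrArg (toLex ∘ Sum.inr) h.2⟩) ?_)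
      exact fun a b e => Subtype.ext (Sum.inr_injective (congrArg Subtype.val e))
  label
    | Sum.inl v => O.map (inlFibre A.vert B.vert v) (A.label v)
    | Sum.inr v => O.map (inrFibre A.vert B.vert v) (B.label v)

/-- The empty graph. -/
def empty : OGraph O where
  V := Empty
  H := Empty
  vert := id
  flip := id
  flip_flip _ := rfl
  flip_ne h := h.elim
  dir := ∅
  mem_dir h := h.elim
  valence v := v.elim
  label v := v.elim

theorem sum_label_inl (A B : OGraph O) (v : A.V) :
    O.Agree (fun x : {x // A.vert x = v} => (Sum.inl x.1 : A.H ⊕ B.H))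
      (fun x : {x // (A.sum B).vert x = toLex (Sum.inl v)} => x.1)
      (A.label v) ((A.sum B).label (toLex (Sum.inl v))) :=
  ⟨_, fun _ => rfl, rfl⟩

theorem sum_label_inr (A B : OGraph O) (v : B.V) :
    O.Agree (fun x : {x // B.vert x = v} => (Sum.inr x.1 : A.H ⊕ B.H))
      (fun x : {x // (A.sum B).vert x = toLex (Sum.inr v)} => x.1)
      (B.label v) ((A.sum B).label (toLex (Sum.inr v))) :=
  ⟨_, fun _ => rfl, rfl⟩

/-- The bijection of lexicographic sums induced by two bijections. -/
abbrev lexSumCongr {V V' W W' : Type} (f : V ≃ V') (g : W ≃ W') :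
    Lex (V ⊕ W) ≃ Lex (V' ⊕ W') :=
  ofLex.trans ((Equiv.sumCongr f g).trans toLex)

/-- Isomorphisms of the summands. -/
def Iso.sumCongr {A A' B B' : OGraph O} (f : Iso A A') (g : Iso B B') :
    Iso (A.sum B) (A'.sum B') :=
  Iso.ofAgree (A := A.sum B) (B := A'.sum B') (lexSumCongr f.onV g.onV)
    (Equiv.sumCongr f.onH g.onH)
    (by
      rintro (x | x)
      · exact congrArg (toLex ∘ Sum.inl) (f.vert_onH x)
      · exact congrArg (toLex ∘ Sum.inr) (g.vert_onH x))
    (by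
      rintro (x | x)
      · exact congrArg Sum.inl (f.flip_onH x)
      · exact congrArg Sum.inr (g.flip_onH x))
    (by
      rintro (v | v)
      · exact ((sum_label_inl A B v).symm.push (Sum.map f.onH g.onH)
          (fun x => by cases x.1 <;> rfl) (fun _ => rfl)).trans
          (((f.label_agree rfl).push Sum.inl (fun _ => rfl) (fun _ => rfl)).trans
            (sum_label_inl A' B' _))
      · exact ((sum_label_inr A B v).symm.push (Sum.map f.onH g.onH)
          (fun x => by cases x.1 <;> rfl) (fun _ => rfl)).trans
          (((g.label_agree rfl).push Sum.inr (fun _ => rfl) (fun _ => rfl)).trans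
            (sum_label_inr A' B' _)))

theorem vsign_lexSumCongr {V V' W W' : Type} [Finite V] [Finite W] [LinearOrder V] [LinearOrder V']
    [LinearOrder W] [LinearOrder W'] (f : V ≃ V') (g : W ≃ W') :
    vsign k (lexSumCongr f g) = vsign k f * vsign k g := by
  have h : {p : Lex (V ⊕ W) × Lex (V ⊕ W) | p.1 < p.2 ∧ lexSumCongr f g p.2 < lexSumCongr f g p.1} =
      (fun p : V × V => ((toLex (Sum.inl p.1), toLex (Sum.inl p.2)) : Lex (V ⊕ W) × Lex (V ⊕ W))) ''
        {p : V × V | p.1 < p.2 ∧ f p.2 < f p.1} ∪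
      (fun p : W × W => ((toLex (Sum.inr p.1), toLex (Sum.inr p.2)) : Lex (V ⊕ W) × Lex (V ⊕ W))) ''
        {p : W × W | p.1 < p.2 ∧ g p.2 < g p.1} := by
    ext ⟨p, q⟩
    induction p using Lex.rec with | _ p
    induction q using Lex.rec with | _ q
    rcases p with p | p <;> rcases q with q | q <;> simp
  rw [vsign, h, Set.ncard_union_eq, Set.ncard_image_of_injective, Set.ncard_image_of_injective,
    pow_add, vsign, vsign]
  · rintro ⟨a, b⟩ ⟨c, d⟩ e
    simpa using e
  · rintro ⟨a, b⟩ ⟨c, d⟩ e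
    simpa using e
  · rw [Set.disjoint_left]
    rintro _ ⟨p, _, rfl⟩ ⟨q, _, e⟩
    simp at e

theorem Iso.sumCongr_sign {A A' B B' : OGraph O} (f : Iso A A') (g : Iso B B') :
    (f.sumCongr g).sign = (f.sign * g.sign : k) := by
  have hv : vsign k (f.sumCongr g).onV = vsign k f.onV * vsign k g.onV := vsign_lexSumCongr _ _
  have hd : (f.sumCongr g).dsign = (f.dsign * g.dsign : k) :=
    neg_one_pow_ncard_sum (α := A.H) (β := B.H) _
  rw [Iso.sign_eq, hv, hd, Iso.sign_eq, Iso.sign_eq]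
  ring

end OGraph

namespace OGraph

variable {k : Type u} [Field k] {O : CyclicOperad.{u, w} k}

/-- Associativity of the disjoint union. -/
def sumAssocIso (A B C : OGraph O) : Iso ((A.sum B).sum C) (A.sum (B.sum C)) :=
  Iso.ofAgree (A := (A.sum B).sum C) (B := A.sum (B.sum C))
    { toFun := fun
        | Sum.inl (Sum.inl a) => Sum.inl a
        | Sum.inl (Sum.inr b) => Sum.inr (Sum.inl b)
        | Sum.inr c => Sum.inr (Sum.inr c)
      invFun := fun
        | Sum.inl a => Sum.inl (Sum.inl a)
        | Sum.inr (Sum.inl b) => Sum.inl (Sum.inr b)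
        | Sum.inr (Sum.inr c) => Sum.inr c
      left_inv := by rintro ((_ | _) | _) <;> rfl
      right_inv := by rintro (_ | (_ | _)) <;> rfl }
    (Equiv.sumAssoc A.H B.H C.H)
    (by rintro ((_ | _) | _) <;> rfl)
    (by rintro ((_ | _) | _) <;> rfl)
    (by
      rintro ((v | v) | v)
      · exact (((sum_label_inl A B v).push (Equiv.sumAssoc A.H B.H C.H ∘ Sum.inl) (fun _ => rfl)
          (fun _ => rfl)).trans ((sum_label_inl (A.sum B) C (toLex (Sum.inl v))).push
          (Equiv.sumAssoc A.H B.H C.H) (fun _ => rfl) (fun _ => rfl))).symm.trans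
          (sum_label_inl A (B.sum C) v)
      · exact (((sum_label_inr A B v).push (Equiv.sumAssoc A.H B.H C.H ∘ Sum.inl) (fun _ => rfl)
          (fun _ => rfl)).trans ((sum_label_inl (A.sum B) C (toLex (Sum.inr v))).push
          (Equiv.sumAssoc A.H B.H C.H) (fun _ => rfl) (fun _ => rfl))).symm.trans
          (((sum_label_inl B C v).push (Sum.inr (α := A.H)) (fun _ => rfl) (fun _ => rfl)).trans
            (sum_label_inr A (B.sum C) (toLex (Sum.inl v))))
      · exact ((sum_label_inr (A.sum B) C v).push (Equiv.sumAssoc A.H B.H C.H)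
          (fun _ => rfl) (fun _ => rfl)).symm.trans
          (((sum_label_inr B C v).push (Sum.inr (α := A.H)) (fun _ => rfl) (fun _ => rfl)).trans
            (sum_label_inr A (B.sum C) (toLex (Sum.inr v)))))

theorem sumAssocIso_sign (A B C : OGraph O) : (sumAssocIso A B C).sign = (1 : k) := by
  refine Iso.sign_eq_one _ ?_ ?_
  · rintro ((a | a) | a) ((b | b) | b) h
    · exact Sum.Lex.inl (Sum.lex_inl_inl.1 (Sum.lex_inl_inl.1 h))
    · exact Sum.Lex.sep _ _
    · exact Sum.Lex.sep _ _
    · exact absurd (Sum.lex_inl_inl.1 h) Sum.lex_inr_inl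
    · exact Sum.Lex.inr (Sum.Lex.inl (Sum.lex_inr_inr.1 (Sum.lex_inl_inl.1 h)))
    · exact Sum.Lex.inr (Sum.Lex.sep _ _)
    · exact absurd h Sum.lex_inr_inl
    · exact absurd h Sum.lex_inr_inl
    · exact Sum.Lex.inr (Sum.Lex.inr (Sum.lex_inr_inr.1 h))
  · rintro ((_ | _) | _) h <;> exact h

/-- The bijection that exchanges the first two summands. -/
def lexSumSwap (V W X : Type) : Lex (V ⊕ Lex (W ⊕ X)) ≃ Lex (W ⊕ Lex (V ⊕ X)) where
  toFun
    | Sum.inl a => Sum.inr (Sum.inl a)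
    | Sum.inr (Sum.inl b) => Sum.inl b
    | Sum.inr (Sum.inr c) => Sum.inr (Sum.inr c)
  invFun
    | Sum.inl a => Sum.inr (Sum.inl a)
    | Sum.inr (Sum.inl b) => Sum.inl b
    | Sum.inr (Sum.inr c) => Sum.inr (Sum.inr c)
  left_inv := by rintro (_ | (_ | _)) <;> rfl
  right_inv := by rintro (_ | (_ | _)) <;> rfl

/-- The inversions are the pairs of a point of `V` and a point of `W`. -/
theorem vsign_lexSumSwap (V W X : Type) [LinearOrder V] [LinearOrder W] [LinearOrder X] :
    vsign k (lexSumSwap V W X) = (-1) ^ (Nat.card V * Nat.card W) := by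
  have h : {p : Lex (V ⊕ Lex (W ⊕ X)) × Lex (V ⊕ Lex (W ⊕ X)) | p.1 < p.2 ∧
      lexSumSwap V W X p.2 < lexSumSwap V W X p.1} =
      Set.range (fun p : V × W => ((toLex (Sum.inl p.1), toLex (Sum.inr (toLex (Sum.inl p.2)))) :
        Lex (V ⊕ Lex (W ⊕ X)) × Lex (V ⊕ Lex (W ⊕ X)))) := by
    ext ⟨p, q⟩
    constructor
    · rintro ⟨h1, h2⟩
      rcases p with a | (a | a) <;> rcases q with b | (b | b)
      · exact absurd (Sum.lex_inl_inl.1 (Sum.lex_inr_inr.1 h2)) (lt_asymm (Sum.lex_inl_inl.1 h1))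
      · exact ⟨(a, b), rfl⟩
      · exact absurd (Sum.lex_inr_inr.1 h2) Sum.lex_inr_inl
      · exact absurd h1 Sum.lex_inr_inl
      · exact absurd (Sum.lex_inl_inl.1 h2)
          (lt_asymm (Sum.lex_inl_inl.1 (Sum.lex_inr_inr.1 h1)))
      · exact absurd h2 Sum.lex_inr_inl
      · exact absurd h1 Sum.lex_inr_inl
      · exact absurd (Sum.lex_inr_inr.1 h1) Sum.lex_inr_inl
      · exact absurd (Sum.lex_inr_inr.1 (Sum.lex_inr_inr.1 h2))
          (lt_asymm (Sum.lex_inr_inr.1 (Sum.lex_inr_inr.1 h1)))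
    · rintro ⟨⟨a, b⟩, e⟩
      obtain ⟨rfl, rfl⟩ := Prod.ext_iff.1 e
      exact ⟨Sum.Lex.sep _ _, Sum.Lex.sep _ _⟩
  rw [vsign, h, ← Set.image_univ, Set.ncard_image_of_injective, Set.ncard_univ, Nat.card_prod]
  rintro ⟨a, b⟩ ⟨c, d⟩ e
  simpa using e

/-- The isomorphism that exchanges the first two summands. -/
def sumSwapIso (A B C : OGraph O) : Iso (A.sum (B.sum C)) (B.sum (A.sum C)) :=
  let onH : A.H ⊕ (B.H ⊕ C.H) ≃ B.H ⊕ (A.H ⊕ C.H) :=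
    { toFun := fun
        | Sum.inl a => Sum.inr (Sum.inl a)
        | Sum.inr (Sum.inl b) => Sum.inl b
        | Sum.inr (Sum.inr c) => Sum.inr (Sum.inr c)
      invFun := fun
        | Sum.inl a => Sum.inr (Sum.inl a)
        | Sum.inr (Sum.inl b) => Sum.inl b
        | Sum.inr (Sum.inr c) => Sum.inr (Sum.inr c)
      left_inv := by rintro (_ | (_ | _)) <;> rfl
      right_inv := by rintro (_ | (_ | _)) <;> rfl }
  Iso.ofAgree (A := A.sum (B.sum C)) (B := B.sum (A.sum C)) (lexSumSwap A.V B.V C.V) onH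
    (by rintro (_ | (_ | _)) <;> rfl)
    (by rintro (_ | (_ | _)) <;> rfl)
    (by
      rintro (v | (v | v))
      · exact ((sum_label_inl A (B.sum C) v).push onH (fun _ => rfl) (fun _ => rfl)).symm.trans
          (((sum_label_inl A C v).push (Sum.inr (α := B.H)) (fun _ => rfl) (fun _ => rfl)).trans
            (sum_label_inr B (A.sum C) (toLex (Sum.inl v))))
      · exact (((sum_label_inl B C v).push (onH ∘ Sum.inr) (fun _ => rfl) (fun _ => rfl)).trans
          ((sum_label_inr A (B.sum C) (toLex (Sum.inl v))).push onH (fun _ => rfl)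
            (fun _ => rfl))).symm.trans (sum_label_inl B (A.sum C) v)
      · exact (((sum_label_inr B C v).push (onH ∘ Sum.inr) (fun _ => rfl) (fun _ => rfl)).trans
          ((sum_label_inr A (B.sum C) (toLex (Sum.inr v))).push onH (fun _ => rfl)
            (fun _ => rfl))).symm.trans
          (((sum_label_inr A C v).push (Sum.inr (α := B.H)) (fun _ => rfl) (fun _ => rfl)).trans
            (sum_label_inr B (A.sum C) (toLex (Sum.inr v)))))

/-- This is the Koszul sign for the grading by the number of vertices, which makes the brackets
graded symmetric. -/
theorem sumSwapIso_sign (A B C : OGraph O) :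
    (sumSwapIso A B C).sign = (-1 : k) ^ (Nat.card A.V * Nat.card B.V) := by
  have hv : vsign k (sumSwapIso A B C).onV = (-1) ^ (Nat.card A.V * Nat.card B.V) :=
    vsign_lexSumSwap _ _ _
  rw [Iso.sign_eq, hv, Iso.dsign_eq_one, mul_one]
  rintro (_ | (_ | _)) h <;> exact h

/-- The empty graph is neutral. -/
def emptySumIso (A : OGraph O) : Iso (empty.sum A) A :=
  Iso.symm (Iso.ofAgree (A := A) (B := empty.sum A)
    { toFun := Sum.inr
      invFun := fun
        | Sum.inl a => Empty.elim a
        | Sum.inr c => c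
      left_inv := fun _ => rfl
      right_inv := by rintro (⟨⟨⟩⟩ | _); rfl }
    { toFun := Sum.inr
      invFun := fun
        | Sum.inl a => Empty.elim a
        | Sum.inr c => c
      left_inv := fun _ => rfl
      right_inv := by rintro (⟨⟨⟩⟩ | _); rfl }
    (fun _ => rfl) (fun _ => rfl) (fun v => sum_label_inr empty A v))

theorem emptySumIso_sign (A : OGraph O) : (emptySumIso A).sign = (1 : k) := by
  refine Iso.sign_eq_one _ ?_ ?_
  · rintro (⟨⟨⟩⟩ | a) (⟨⟨⟩⟩ | b) h
    exact Sum.lex_inr_inr.1 h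
  · rintro (⟨⟨⟩⟩ | a) h
    exact h

theorem card_sum (A B : OGraph O) : Nat.card (A.sum B).V = Nat.card A.V + Nat.card B.V :=
  Nat.card_sum (α := A.V) (β := B.V)

/-- A permutation of the half-edges of the first summand. -/
def twistSumIso (A B : OGraph O) (c : Equiv.Perm A.H) :
    Iso ((A.twist c).sum B) ((A.sum B).twist (Equiv.sumCongr c (Equiv.refl B.H))) :=
  Iso.ofAgree (A := (A.twist c).sum B) (B := (A.sum B).twist (Equiv.sumCongr c (Equiv.refl B.H)))
    (Equiv.refl _) (Equiv.refl _) (by rintro (_ | _) <;> rfl) (by rintro (_ | _) <;> rfl)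
    (by
      rintro (v | v)
      · exact (sum_label_inl (A.twist c) B v).symm.trans (sum_label_inl A B v)
      · exact (sum_label_inr (A.twist c) B v).symm.trans (sum_label_inr A B v))

theorem twistSumIso_sign (A B : OGraph O) (c : Equiv.Perm A.H) :
    (twistSumIso A B c).sign = (1 : k) := by
  refine Iso.sign_eq_one _ (fun _ _ h => h) ?_
  rintro (_ | _) h <;> exact h

/-- Contraction of an edge of the first summand. -/
noncomputable def contractSumIso (A B : OGraph O) (a : A.H)
    (ha : A.vert a ≠ A.vert (A.flip a))
    (ha' : (A.sum B).vert (Sum.inl a) ≠ (A.sum B).vert ((A.sum B).flip (Sum.inl a))) :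
    Iso ((A.contract a ha).sum B) ((A.sum B).contract (Sum.inl a) ha') :=
  let onV : ((A.contract a ha).sum B).V ≃ ((A.sum B).contract (Sum.inl a) ha').V :=
    { toFun := fun
        | Sum.inl v => ⟨toLex (Sum.inl v.1), fun e => v.2 (Sum.inl_injective e)⟩
        | Sum.inr v => ⟨toLex (Sum.inr v), fun e => Sum.inr_ne_inl e⟩
      invFun := fun
        | ⟨Sum.inl v, e⟩ => toLex (Sum.inl ⟨v, fun e' => e (congrArg Sum.inl e')⟩)
        | ⟨Sum.inr v, e⟩ => toLex (Sum.inr v)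
      left_inv := by rintro (_ | _) <;> rfl
      right_inv := by rintro ⟨_ | _, _⟩ <;> rfl }
  let onH : ((A.contract a ha).sum B).H ≃ ((A.sum B).contract (Sum.inl a) ha').H :=
    { toFun := fun
        | Sum.inl v => ⟨Sum.inl v.1, fun e => v.2.1 (Sum.inl_injective e),
            fun e => v.2.2 (Sum.inl_injective e)⟩
        | Sum.inr v => ⟨Sum.inr v, fun e => Sum.inr_ne_inl e, fun e => Sum.inr_ne_inl e⟩
      invFun := fun
        | ⟨Sum.inl v, e⟩ => Sum.inl ⟨v, fun e' => e.1 (congrArg Sum.inl e'),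
            fun e' => e.2 (congrArg Sum.inl e')⟩
        | ⟨Sum.inr v, e⟩ => Sum.inr v
      left_inv := by rintro (_ | _) <;> rfl
      right_inv := by rintro ⟨_ | _, _⟩ <;> rfl }
  Iso.ofAgree onV onH
    (by
      rintro (x | x)
      · refine Subtype.ext ?_
        by_cases h : A.vert x.1 = A.vert (A.flip a)
        · refine ((A.sum B).contract_vert_of_eq ha' (onH (Sum.inl x))
            (congrArg Sum.inl h)).trans ?_
          exact (congrArg Sum.inl (A.contract_vert_of_eq ha x h)).symm
        · refine ((A.sum B).contract_vert_of_ne ha' (onH (Sum.inl x))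
            (fun e => h (Sum.inl_injective e))).trans ?_
          exact (congrArg Sum.inl (A.contract_vert_of_ne ha x h)).symm
      · exact Subtype.ext ((A.sum B).contract_vert_of_ne ha' (onH (Sum.inr x))
            (fun e => Sum.inr_ne_inl e)))
    (by rintro (x | x) <;> rfl)
    (by
      rintro (v | v)
      · by_cases h : v.1 = A.vert a
        · have h1 := ((A.contract_label_merged a ha v h).push (Sum.inl (β := B.H))
            (i' := Sum.elim (fun x => Sum.inl x.1.1) (fun x => Sum.inl x.1.1))
            (by rintro (_ | _) <;> rfl) (fun _ => rfl)).trans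
            ((sum_label_inl (A.contract a ha) B v).push
              (fun x => (onH x).1) (fun _ => rfl) (fun _ => rfl))
          have h2 := (A.sum B).contract_label_merged (Sum.inl a) ha' (onV (Sum.inl v))
            (congrArg Sum.inl h)
          have h3 := (sum_label_inl A B (A.vert a)).comp (sum_label_inl A B (A.vert (A.flip a)))
            Subtype.val_injective Subtype.val_injective (x := ⟨a, rfl⟩) (x' := ⟨Sum.inl a, rfl⟩)
            (y := ⟨A.flip a, rfl⟩) (y' := ⟨Sum.inl (A.flip a), rfl⟩) rfl rfl
          exact (h1.symm.trans (h3.trans h2)).pull Subtype.val Subtype.val_injective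
            (fun _ => rfl) (fun _ => rfl)
        · have h1 := ((A.contract_label_unmerged a ha v h).push (Sum.inl (β := B.H))
            (fun _ => rfl) (fun _ => rfl)).trans ((sum_label_inl (A.contract a ha) B v).push
              (fun x => (onH x).1) (fun _ => rfl) (fun _ => rfl))
          have h2 := (A.sum B).contract_label_unmerged (Sum.inl a) ha' (onV (Sum.inl v))
            (fun e => h (Sum.inl_injective e))
          exact (h1.symm.trans ((sum_label_inl A B v.1).trans h2)).pull Subtype.val
            Subtype.val_injective (fun _ => rfl) (fun _ => rfl)
      · have h1 := (sum_label_inr (A.contract a ha) B v).push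
          (fun x => (onH x).1) (fun _ => rfl) (fun _ => rfl)
        have h2 := (A.sum B).contract_label_unmerged (Sum.inl a) ha' (onV (Sum.inr v))
            (fun e => Sum.inr_ne_inl e)
        exact (h1.symm.trans ((sum_label_inr A B v).trans h2)).pull Subtype.val
            Subtype.val_injective (fun _ => rfl) (fun _ => rfl))

theorem contractSumIso_sign (A B : OGraph O) (a : A.H)
    (ha : A.vert a ≠ A.vert (A.flip a))
    (ha' : (A.sum B).vert (Sum.inl a) ≠ (A.sum B).vert ((A.sum B).flip (Sum.inl a))) :
    (contractSumIso A B a ha ha').sign = (1 : k) := by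
  refine Iso.sign_eq_one _ ?_ ?_
  · rintro (a | a) (b | b) h
    · exact Sum.Lex.inl (show a < b from Sum.lex_inl_inl.1 h)
    · exact Sum.Lex.sep _ _
    · exact absurd h Sum.lex_inr_inl
    · exact Sum.Lex.inr (Sum.lex_inr_inr.1 h)
  · rintro (_ | _) h <;> exact h

theorem belowSign_inl {V W : Type} [LinearOrder V] [LinearOrder W] (v : V) :
    belowSign k (toLex (Sum.inl v) : Lex (V ⊕ W)) = belowSign k v := by
  have : {x : Lex (V ⊕ W) | x < toLex (Sum.inl v)} =
      (fun x => toLex (Sum.inl x)) '' {x : V | x < v} := by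
    ext x
    induction x using Lex.rec with | _ x
    rcases x with x | x <;> simp
  rw [belowSign, this, Set.ncard_image_of_injective, belowSign]
  intro a b e
  simpa using e

/-- The vertices of the first summand come first, so no vertex of `B` precedes the head of `a`. -/
theorem contractSign_sum (A B : OGraph O) (a : A.H) :
    (A.sum B).contractSign (Sum.inl a) = A.contractSign a := by
  have h : belowSign k ((A.sum B).vert ((A.sum B).flip (Sum.inl a))) =
      belowSign k (A.vert (A.flip a)) := belowSign_inl _
  unfold contractSign
  rw [h]
  rfl

open Classical in
/-- A permutation of the half-edges that remain after a contraction. -/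
noncomputable def contractTwistIso (A : OGraph O) (a : A.H) (ha : A.vert a ≠ A.vert (A.flip a))
    (c : Equiv.Perm (A.contract a ha).H) (d : Equiv.Perm A.H)
    (hd : ∀ x : (A.contract a ha).H, d x.1 = (c x).1) (hda : d a = a)
    (hda' : d (A.flip a) = A.flip a)
    (ha' : (A.twist d).vert a ≠ (A.twist d).vert ((A.twist d).flip a)) :
    Iso ((A.contract a ha).twist c) ((A.twist d).contract a ha') :=
  have hs : d.symm a = a := by rw [Equiv.symm_apply_eq, hda]
  have hf : (A.twist d).flip a = A.flip a := by
    change d (A.flip (d.symm a)) = _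
    rw [hs, hda']
  have hdx : ∀ x : (A.contract a ha).H, d.symm x.1 = (c.symm x).1 := fun x => by
    rw [Equiv.symm_apply_eq, hd, c.apply_symm_apply]
  let onV : ((A.contract a ha).twist c).V ≃ ((A.twist d).contract a ha').V :=
    Equiv.subtypeEquivRight fun v => by rw [hf]
  let onH : ((A.contract a ha).twist c).H ≃ ((A.twist d).contract a ha').H :=
    Equiv.subtypeEquivRight fun v => by rw [hf]
  Iso.ofAgree onV onH
    (fun x => by
      refine Subtype.ext ?_
      change _ = ((A.contract a ha).vert x).1
      rw [contract_vert_val, contract_vert_val]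
      change (if A.vert x.1 = A.vert ((A.twist d).flip a) then _ else A.vert x.1) = _
      rw [hf])
    (fun x => by
      refine Subtype.ext ?_
      change d (A.flip (d.symm x.1)) = (c ((A.contract a ha).flip (c.symm x))).1
      rw [hdx, ← hd]
      rfl)
    (fun v => by
      refine CyclicOperad.Agree.pull (i' := fun x => x.1.1) (j' := fun x => x.1.1) ?_
        Subtype.val Subtype.val_injective (fun _ => rfl) (fun _ => rfl)
      by_cases h : v.1 = A.vert a
      · have h3 := (A.label_agree rfl).comp (A.label_agree (congrArg A.vert hf.symm))
          Subtype.val_injective Subtype.val_injective (x := ⟨a, rfl⟩) (x' := ⟨a, rfl⟩)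
          (y := ⟨A.flip a, rfl⟩) (y' := ⟨(A.twist d).flip a, rfl⟩) rfl hf.symm
        exact (A.contract_label_merged a ha v h).symm.trans
          (h3.trans ((A.twist d).contract_label_merged a ha' (onV v) h))
      · exact (A.contract_label_unmerged a ha v h).symm.trans
          ((A.twist d).contract_label_unmerged a ha' (onV v) h))

theorem contractTwistIso_sign (A : OGraph O) (a : A.H) (ha : A.vert a ≠ A.vert (A.flip a))
    (c : Equiv.Perm (A.contract a ha).H) (d : Equiv.Perm A.H)
    (hd : ∀ x : (A.contract a ha).H, d x.1 = (c x).1) (hda : d a = a)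
    (hda' : d (A.flip a) = A.flip a)
    (ha' : (A.twist d).vert a ≠ (A.twist d).vert ((A.twist d).flip a)) :
    (A.contractTwistIso a ha c d hd hda hda' ha').sign = (1 : k) := by
  refine Iso.sign_eq_one _ (fun _ _ h => h) (fun x h => ?_)
  change d.symm x.1 ∈ A.dir
  have : d.symm x.1 = (c.symm x).1 := by
    rw [Equiv.symm_apply_eq, hd, c.apply_symm_apply]
  rw [this]
  exact h

end OGraph

namespace OGraph

variable {k : Type u} [Field k] {O : CyclicOperad.{u, w} k}

/-! ### Multilinearity in the labels -/

/-- Change all labels. -/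
abbrev withLabel (A : OGraph O) (l : ∀ v, O.obj {h // A.vert h = v}) : OGraph O :=
  { A with label := l }

theorem cls_update_add (A : OGraph O) (l : ∀ v, O.obj {h // A.vert h = v}) (v : A.V)
    (p q : O.obj {h // A.vert h = v}) :
    (A.withLabel (Function.update l v (p + q))).cls =
      (A.withLabel (Function.update l v p)).cls + (A.withLabel (Function.update l v q)).cls := by
  rw [cls, cls, cls, ← Submodule.Quotient.mk_add, Submodule.Quotient.eq]
  exact Submodule.subset_span (Rel.add (A.withLabel l) v p q)

theorem cls_update_smul (A : OGraph O) (l : ∀ v, O.obj {h // A.vert h = v}) (v : A.V) (c : k)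
    (p : O.obj {h // A.vert h = v}) :
    (A.withLabel (Function.update l v (c • p))).cls =
      c • (A.withLabel (Function.update l v p)).cls := by
  rw [cls, cls, ← Submodule.Quotient.mk_smul, Submodule.Quotient.eq, Finsupp.smul_single,
    smul_eq_mul, mul_one]
  exact Submodule.subset_span (Rel.smul (A.withLabel l) v c p)

open Classical in
/-- The labels of a contraction, as a function of the labels. -/
noncomputable def contractLabel (A : OGraph O) (h : A.H) (hne : A.vert h ≠ A.vert (A.flip h))
    (l : ∀ v, O.obj {h // A.vert h = v}) (v : {v : A.V // v ≠ A.vert (A.flip h)}) :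
    O.obj {x // A.contractVert h hne x = v} :=
  if hv : v.1 = A.vert h then
    O.map (A.mergedEquiv h hne v hv)
      (O.comp ⟨h, rfl⟩ ⟨A.flip h, rfl⟩ (l (A.vert h)) (l (A.vert (A.flip h))))
  else O.map (A.unmergedEquiv h hne v hv) (l v.1)

/-- Each vertex contributes to one label of the contraction only, and linearly: the head and the
tail through one argument of the bilinear composition, any other vertex through a relabelling. Hence
multilinearity survives contraction. -/
theorem exists_contractLabel_update (A : OGraph O) (h : A.H)
    (hne : A.vert h ≠ A.vert (A.flip h)) (l : ∀ v, O.obj {h // A.vert h = v}) (v : A.V) :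
    ∃ (v' : {v : A.V // v ≠ A.vert (A.flip h)})
      (T : O.obj {x // A.vert x = v} →ₗ[k] O.obj {x // A.contractVert h hne x = v'}),
      ∀ p, A.contractLabel h hne (Function.update l v p) =
        Function.update (A.contractLabel h hne l) v' (T p) := by
  by_cases h1 : v = A.vert (A.flip h)
  · subst h1
    refine ⟨⟨A.vert h, hne⟩, O.map (A.mergedEquiv h hne ⟨A.vert h, hne⟩ rfl) ∘ₗ
      O.comp (X := {x // A.vert x = A.vert h}) (Y := {x // A.vert x = A.vert (A.flip h)})
        ⟨h, rfl⟩ ⟨A.flip h, rfl⟩ (l (A.vert h)), fun p => funext fun x => ?_⟩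
    by_cases hx : x = ⟨A.vert h, hne⟩
    · subst hx
      rw [Function.update_self, contractLabel, dif_pos rfl, Function.update_of_ne hne,
        Function.update_self]
      rfl
    · rw [Function.update_of_ne hx]
      have hx' : x.1 ≠ A.vert h := fun e => hx (Subtype.ext e)
      rw [contractLabel, dif_neg hx', contractLabel, dif_neg hx', Function.update_of_ne x.2]
  by_cases h2 : v = A.vert h
  · subst h2
    refine ⟨⟨A.vert h, hne⟩, O.map (A.mergedEquiv h hne ⟨A.vert h, hne⟩ rfl) ∘ₗ
      (O.comp (X := {x // A.vert x = A.vert h}) (Y := {x // A.vert x = A.vert (A.flip h)})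
        ⟨h, rfl⟩ ⟨A.flip h, rfl⟩).flip (l (A.vert (A.flip h))),
      fun p => funext fun x => ?_⟩
    by_cases hx : x = ⟨A.vert h, hne⟩
    · subst hx
      rw [Function.update_self, contractLabel, dif_pos rfl, Function.update_of_ne hne.symm,
        Function.update_self]
      rfl
    · rw [Function.update_of_ne hx]
      have hx' : x.1 ≠ A.vert h := fun e => hx (Subtype.ext e)
      rw [contractLabel, dif_neg hx', contractLabel, dif_neg hx', Function.update_of_ne hx']
  · refine ⟨⟨v, h1⟩, O.map (A.unmergedEquiv h hne ⟨v, h1⟩ h2), fun p => funext fun x => ?_⟩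
    by_cases hx : x = ⟨v, h1⟩
    · subst hx
      rw [Function.update_self, contractLabel, dif_neg h2, Function.update_self]
    · rw [Function.update_of_ne hx]
      have hx' : x.1 ≠ v := fun e => hx (Subtype.ext e)
      by_cases hh : x.1 = A.vert h
      · rw [contractLabel, dif_pos hh, contractLabel, dif_pos hh,
          Function.update_of_ne (Ne.symm h1), Function.update_of_ne (Ne.symm h2)]
      · rw [contractLabel, dif_neg hh, contractLabel, dif_neg hh, Function.update_of_ne hx']

theorem contractCls_withLabel (A : OGraph O) (h : A.H) (hne : A.vert h ≠ A.vert (A.flip h))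
    (l : ∀ v, O.obj {h // A.vert h = v}) : (A.withLabel l).contractCls h =
      A.contractSign h • ((A.contract h hne).withLabel (A.contractLabel h hne l)).cls :=
  contractCls_of_ne (A.withLabel l) h hne

theorem contractCls_update_add (A : OGraph O) (h : A.H) (l : ∀ v, O.obj {h // A.vert h = v})
    (v : A.V) (p q : O.obj {h // A.vert h = v}) :
    (A.withLabel (Function.update l v (p + q))).contractCls h =
      (A.withLabel (Function.update l v p)).contractCls h +
        (A.withLabel (Function.update l v q)).contractCls h := by
  by_cases hne : A.vert h ≠ A.vert (A.flip h)
  · obtain ⟨v', T, hT⟩ := A.exists_contractLabel_update h hne l v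
    rw [contractCls_withLabel A h hne, contractCls_withLabel A h hne, contractCls_withLabel A h hne,
      hT, hT, hT, map_add, ← smul_add]
    exact congrArg _ (cls_update_add (A.contract h hne) (A.contractLabel h hne l) v' _ _)
  · have e : ∀ l, (A.withLabel l).contractCls h = 0 := fun l => dif_neg hne
    rw [e, e, e, add_zero]

theorem contractCls_update_smul (A : OGraph O) (h : A.H) (l : ∀ v, O.obj {h // A.vert h = v})
    (v : A.V) (c : k) (p : O.obj {h // A.vert h = v}) :
    (A.withLabel (Function.update l v (c • p))).contractCls h =
      c • (A.withLabel (Function.update l v p)).contractCls h := by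
  by_cases hne : A.vert h ≠ A.vert (A.flip h)
  · obtain ⟨v', T, hT⟩ := A.exists_contractLabel_update h hne l v
    rw [contractCls_withLabel A h hne, contractCls_withLabel A h hne, hT, hT, map_smul, smul_comm]
    exact congrArg _ (cls_update_smul (A.contract h hne) (A.contractLabel h hne l) v' _ _)
  · have e : ∀ l, (A.withLabel l).contractCls h = 0 := fun l => dif_neg hne
    rw [e, e, smul_zero]

theorem fusionTerm_update_add (A : OGraph O) (t : List A.H) (l : ∀ v, O.obj {h // A.vert h = v})
    (v : A.V) (p q : O.obj {h // A.vert h = v}) :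
    (A.withLabel (Function.update l v (p + q))).fusionTerm t =
      (A.withLabel (Function.update l v p)).fusionTerm t +
        (A.withLabel (Function.update l v q)).fusionTerm t := by
  classical
  cases t with
  | nil => exact (add_zero _).symm
  | cons x t => exact contractCls_update_add (A.twist (x :: t).formPerm) (A.flip x) l v p q

theorem fusionTerm_update_smul (A : OGraph O) (t : List A.H) (l : ∀ v, O.obj {h // A.vert h = v})
    (v : A.V) (c : k) (p : O.obj {h // A.vert h = v}) :
    (A.withLabel (Function.update l v (c • p))).fusionTerm t =
      c • (A.withLabel (Function.update l v p)).fusionTerm t := by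
  classical
  cases t with
  | nil => exact (smul_zero _).symm
  | cons x t => exact contractCls_update_smul (A.twist (x :: t).formPerm) (A.flip x) l v c p

/-- The labels of a disjoint union, as a function of the labels of the first summand. -/
def sumLabel (A B : OGraph O) (l : ∀ v, O.obj {h // A.vert h = v}) :
    ∀ v, O.obj {h // (A.sum B).vert h = v} :=
  ((A.withLabel l).sum B).label

theorem sumLabel_inl (A B : OGraph O) (l : ∀ v, O.obj {h // A.vert h = v}) (v : A.V) :
    sumLabel A B l (toLex (Sum.inl v)) = O.map (inlFibre A.vert B.vert v) (l v) := rfl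

theorem sumLabel_inr (A B : OGraph O) (l : ∀ v, O.obj {h // A.vert h = v}) (v : B.V) :
    sumLabel A B l (toLex (Sum.inr v)) = O.map (inrFibre A.vert B.vert v) (B.label v) := rfl

theorem exists_sumLabel_update (A B : OGraph O) (l : ∀ v, O.obj {h // A.vert h = v}) (v : A.V) :
    ∃ (v' : (A.sum B).V) (T : O.obj {x // A.vert x = v} →ₗ[k]
        O.obj {x // (A.sum B).vert x = v'}),
      ∀ p, sumLabel A B (Function.update l v p) =
        Function.update (sumLabel A B l) v' (T p) := by
  refine ⟨toLex (Sum.inl v), O.map (inlFibre A.vert B.vert v), fun p => funext fun x => ?_⟩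
  rcases x with x | x
  · by_cases hx : x = v
    · obtain rfl := hx.symm
      refine Eq.trans ?_ (Function.update_self (f := sumLabel A B l) _ _).symm
      exact (sumLabel_inl A B _ v).trans (by rw [Function.update_self]; rfl)
    · refine Eq.trans ?_ (Function.update_of_ne (f := sumLabel A B l)
        (fun e => hx (Sum.inl_injective e)) _).symm
      refine (sumLabel_inl A B _ x).trans ?_
      rw [Function.update_of_ne hx]
      exact (sumLabel_inl A B _ x).symm
  · refine Eq.trans ?_ (Function.update_of_ne (f := sumLabel A B l)
      (a := toLex (Sum.inr x)) (a' := toLex (Sum.inl v)) (fun e => Sum.inr_ne_inl e) _).symm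
    exact (sumLabel_inr A B _ x).trans (sumLabel_inr A B l x).symm

/-! ### Sums of fusion terms -/

/-- The sum of the contributions of all lists of `n` directed edges of different colours. -/
noncomputable def fusionSum (A : OGraph O) {C : Type} (κ : A.H → C) (n : ℕ) : GraphComplex O :=
  ∑ᶠ l ∈ {l : List A.H | l.length = n ∧ (l.map κ).Nodup}, A.fusionTerm l

/-- Only equality of colours matters, so colourings with different sets of values can be compared.
-/
theorem nodup_map_congr {X Y C D : Type} {κ : X → C} {f : X → Y} {μ : Y → D}
    (h : ∀ x y, κ x = κ y ↔ μ (f x) = μ (f y)) (l : List X) :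
    (l.map κ).Nodup ↔ ((l.map f).map μ).Nodup := by
  rw [List.map_map, List.Nodup, List.Nodup, List.pairwise_map, List.pairwise_map]
  simp only [Function.comp, Ne, h]

theorem finite_lists {X C : Type} [Finite X] (κ : X → C) (n : ℕ) :
    {l : List X | l.length = n ∧ (l.map κ).Nodup}.Finite :=
  (List.finite_length_eq X n).subset fun _ h => h.1

theorem Iso.fusionSum_eq {A B : OGraph O} (f : Iso A B) {C D : Type} (κ : A.H → C) (μ : B.H → D)
    (h : ∀ x y, κ x = κ y ↔ μ (f.onH x) = μ (f.onH y)) (n : ℕ) :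
    B.fusionSum μ n = f.sign • A.fusionSum κ n := by
  rw [fusionSum, fusionSum, smul_finsum_mem (finite_lists κ n)]
  refine (finsum_mem_eq_of_bijOn (List.map f.onH) ⟨?_, ?_, ?_⟩ ?_).symm
  · rintro l ⟨h1, h2⟩
    exact ⟨by rw [List.length_map, h1], (nodup_map_congr h l).1 h2⟩
  · exact (List.map_injective_iff.2 f.onH.injective).injOn
  · rintro l ⟨h1, h2⟩
    have e : (l.map f.onH.symm).map f.onH = l := by simp
    exact ⟨l.map f.onH.symm, ⟨by rw [List.length_map, h1],
      (nodup_map_congr h _).2 (by rwa [e])⟩, e⟩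
  · exact fun l _ => (f.fusionTerm_eq l).symm

theorem fusionSum_update_add (A : OGraph O) {C : Type} (κ : A.H → C) (n : ℕ)
    (l : ∀ v, O.obj {h // A.vert h = v}) (v : A.V) (p q : O.obj {h // A.vert h = v}) :
    (A.withLabel (Function.update l v (p + q))).fusionSum κ n =
      (A.withLabel (Function.update l v p)).fusionSum κ n +
        (A.withLabel (Function.update l v q)).fusionSum κ n := by
  rw [fusionSum, fusionSum, fusionSum, ← finsum_mem_add_distrib (finite_lists κ n)]
  exact finsum_mem_congr rfl fun t _ => fusionTerm_update_add A t l v p q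

theorem fusionSum_update_smul (A : OGraph O) {C : Type} (κ : A.H → C) (n : ℕ)
    (l : ∀ v, O.obj {h // A.vert h = v}) (v : A.V) (c : k) (p : O.obj {h // A.vert h = v}) :
    (A.withLabel (Function.update l v (c • p))).fusionSum κ n =
      c • (A.withLabel (Function.update l v p)).fusionSum κ n := by
  rw [fusionSum, fusionSum, smul_finsum_mem (finite_lists κ n)]
  exact finsum_mem_congr rfl fun t _ => fusionTerm_update_smul A t l v c p

theorem fusionSum_setLabel_add (A B : OGraph O) {C : Type} (κ : (A.sum B).H → C) (n : ℕ)
    (v : A.V) (p q : O.obj {h // A.vert h = v}) :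
    fusionSum ((A.setLabel v (p + q)).sum B) κ n =
      fusionSum ((A.setLabel v p).sum B) κ n + fusionSum ((A.setLabel v q).sum B) κ n := by
  obtain ⟨v', T, hT⟩ := exists_sumLabel_update A B A.label v
  have e : ∀ p, fusionSum ((A.setLabel v p).sum B) κ n = fusionSum ((A.sum B).withLabel
      (Function.update (sumLabel A B A.label) v' (T p))) κ n := fun p => by
    rw [← hT]
    rfl
  rw [e, e, e, map_add, fusionSum_update_add]

theorem fusionSum_setLabel_smul (A B : OGraph O) {C : Type} (κ : (A.sum B).H → C) (n : ℕ)
    (v : A.V) (c : k) (p : O.obj {h // A.vert h = v}) :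
    fusionSum ((A.setLabel v (c • p)).sum B) κ n =
      c • fusionSum ((A.setLabel v p).sum B) κ n := by
  obtain ⟨v', T, hT⟩ := exists_sumLabel_update A B A.label v
  have e : ∀ p, fusionSum ((A.setLabel v p).sum B) κ n = fusionSum ((A.sum B).withLabel
      (Function.update (sumLabel A B A.label) v' (T p))) κ n := fun p => by
    rw [← hT]
    rfl
  rw [e, e, map_smul, fusionSum_update_smul]

/-! ### The fusion of a list of graphs -/

/-- The disjoint union of a list of graphs. -/
def union : List (OGraph O) → OGraph O
  | [] => empty
  | A :: w => A.sum (union w)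

/-- The position in the list of the member to which a half-edge belongs. -/
def colour : ∀ w : List (OGraph O), (union w).H → ℕ
  | [] => Empty.elim
  | _ :: w => Sum.elim (fun _ => 0) (fun x => colour w x + 1)

/-- The fusion of a list of graphs. -/
noncomputable def bracketWord (w : List (OGraph O)) : GraphComplex O :=
  (union w).fusionSum (colour w) w.length

theorem Iso.refl_sign (A : OGraph O) : (Iso.refl A).sign = (1 : k) :=
  Iso.sign_eq_one _ (fun _ _ h => h) (fun _ h => h)

theorem bracketWord_nil : bracketWord ([] : List (OGraph O)) = 0 := by
  rw [bracketWord, fusionSum]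
  refine finsum_mem_eq_zero_of_forall_eq_zero ?_
  rintro l ⟨h, -⟩
  rw [List.length_eq_zero_iff.1 h]
  rfl

theorem bracketWord_iso {A B : OGraph O} (f : Iso A B) (w : List (OGraph O)) :
    bracketWord (B :: w) = f.sign • bracketWord (A :: w) := by
  have h := (f.sumCongr (Iso.refl (union w))).fusionSum_eq (colour (A :: w)) (colour (B :: w))
    (by rintro (x | x) (y | y) <;> exact Iff.rfl) (w.length + 1)
  rw [Iso.sumCongr_sign, Iso.refl_sign, mul_one] at h
  exact h

theorem bracketWord_add (A : OGraph O) (v : A.V) (p q : O.obj {h // A.vert h = v})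
    (w : List (OGraph O)) : bracketWord (A.setLabel v (p + q) :: w) =
      bracketWord (A.setLabel v p :: w) + bracketWord (A.setLabel v q :: w) :=
  fusionSum_setLabel_add A (union w) (colour (A :: w)) (w.length + 1) v p q

theorem bracketWord_smul (A : OGraph O) (v : A.V) (c : k) (p : O.obj {h // A.vert h = v})
    (w : List (OGraph O)) : bracketWord (A.setLabel v (c • p) :: w) =
      c • bracketWord (A.setLabel v p :: w) :=
  fusionSum_setLabel_smul A (union w) (colour (A :: w)) (w.length + 1) v c p

theorem exists_unionSwapIso (A B : OGraph O) (u w : List (OGraph O)) :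
    ∃ f : Iso (union (u ++ A :: B :: w)) (union (u ++ B :: A :: w)),
      f.sign = (-1 : k) ^ (Nat.card A.V * Nat.card B.V) ∧
      ∀ x y, colour _ x = colour _ y ↔ colour _ (f.onH x) = colour _ (f.onH y) := by
  induction u with
  | nil =>
    refine ⟨sumSwapIso A B (union w), sumSwapIso_sign _ _ _, ?_⟩
    -- The positions change by the transposition of 0 and 1, which preserves equality of colours.
    have h : ∀ x, colour (B :: A :: w) ((sumSwapIso A B (union w)).onH x) =
        Equiv.swap 0 1 (colour (A :: B :: w) x) := by
      rintro (x | (x | x))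
      · rfl
      · rfl
      · exact (Equiv.swap_apply_of_ne_of_ne (x := colour w x + 1 + 1) (by omega) (by omega)).symm
    exact fun x y => (Equiv.apply_eq_iff_eq (Equiv.swap 0 1)).symm.trans
      (iff_of_eq (congrArg₂ (· = ·) (h x).symm (h y).symm))
  | cons C u ih =>
    obtain ⟨f, hf, hc⟩ := ih
    refine ⟨(Iso.refl C).sumCongr f, ?_, ?_⟩
    · exact (Iso.sumCongr_sign (Iso.refl C) f).trans (by rw [Iso.refl_sign, one_mul, hf])
    · rintro (x | x) (y | y)
      · exact Iff.rfl
      · exact iff_of_false (Nat.succ_ne_zero _).symm (Nat.succ_ne_zero _).symm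
      · exact iff_of_false (Nat.succ_ne_zero _) (Nat.succ_ne_zero _)
      · exact (Nat.succ_inj.trans (hc x y)).trans Nat.succ_inj.symm

theorem bracketWord_swap (A B : OGraph O) (u w : List (OGraph O)) :
    bracketWord (u ++ A :: B :: w) =
      (-1 : k) ^ (Nat.card A.V * Nat.card B.V) • bracketWord (u ++ B :: A :: w) := by
  obtain ⟨f, hf, hc⟩ := exists_unionSwapIso (k := k) B A u w
  have h := f.fusionSum_eq (colour _) (colour _) hc (u ++ B :: A :: w).length
  rw [hf, mul_comm] at h
  rw [bracketWord, bracketWord, ← h]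
  simp

end OGraph

open GradedSym

/-! ### Signed sums over the splittings of a word -/

section Signs

variable {k : Type u} [Field k]

theorem neg_one_zpow_congr {a b : ℤ} (h : Even (a - b)) : (-1 : k) ^ a = (-1) ^ b := by
  have e : a = (a - b) + b := by ring
  rw [e, zpow_add₀ (by simp), h.neg_one_zpow, one_mul]

theorem neg_one_zpow_add (a b : ℤ) : (-1 : k) ^ (a + b) = (-1) ^ a * (-1) ^ b :=
  zpow_add₀ (by simp) a b

end Signs

section Splittings

variable {k : Type u} [Field k] {Λ : Type*} (d : Λ → ℤ) {N : Type*} [AddCommGroup N] [Module k N]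

/-- The degree of a word. -/
def wordDegree (w : List Λ) : ℤ := (w.map d).sum

@[simp] theorem wordDegree_nil : wordDegree d [] = 0 := rfl

@[simp] theorem wordDegree_cons (x : Λ) (w : List Λ) :
    wordDegree d (x :: w) = d x + wordDegree d w := by simp [wordDegree]

@[simp] theorem wordDegree_append (u w : List Λ) :
    wordDegree d (u ++ w) = wordDegree d u + wordDegree d w := by simp [wordDegree]

theorem wordDegree_perm {u w : List Λ} (h : u.Perm w) : wordDegree d u = wordDegree d w :=
  (h.map d).sum_eq

variable (k)

/-- Put a letter in front of the first word. -/
def consLeft (x : Λ) : (List Λ → List Λ → N) →ₗ[k] (List Λ → List Λ → N) where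
  toFun g u v := g (x :: u) v
  map_add' _ _ := rfl
  map_smul' _ _ := rfl

/-- Put a letter in front of the second word, with the Koszul sign. -/
def consRight (x : Λ) : (List Λ → List Λ → N) →ₗ[k] (List Λ → List Λ → N) where
  toFun g u v := (-1 : k) ^ (d x * wordDegree d u) • g u (x :: v)
  map_add' _ _ := by ext; simp
  map_smul' c _ := by ext; simp [smul_comm c]

/-- The signed sum over all splittings of a word into two words. -/
def splitSum : List Λ → (List Λ → List Λ → N) →ₗ[k] N
  | [] => { toFun := fun g => g [] [], map_add' := fun _ _ => rfl, map_smul' := fun _ _ => rfl }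
  | x :: w => splitSum w ∘ₗ consLeft k x + splitSum w ∘ₗ consRight k d x

variable {k}

theorem splitSum_nil (g : List Λ → List Λ → N) : splitSum k d [] g = g [] [] := rfl

theorem splitSum_cons (x : Λ) (w : List Λ) (g : List Λ → List Λ → N) :
    splitSum k d (x :: w) g = splitSum k d w (fun u v => g (x :: u) v) +
      splitSum k d w (fun u v => (-1 : k) ^ (d x * wordDegree d u) • g u (x :: v)) := rfl

/-- Only pairs of words whose concatenation rearranges `w` occur in the sum. -/
theorem splitSum_congr {w : List Λ} {g g' : List Λ → List Λ → N}
    (h : ∀ u v, (u ++ v).Perm w → g u v = g' u v) : splitSum k d w g = splitSum k d w g' := by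
  induction w generalizing g g' with
  | nil => exact h [] [] (List.Perm.refl _)
  | cons x w ih =>
    rw [splitSum_cons, splitSum_cons]
    congr 1
    · exact ih fun u v p => h _ _ (p.cons x)
    · exact ih fun u v p => by rw [h u (x :: v) (List.perm_middle.trans (p.cons x))]

theorem splitSum_map {N' : Type*} [AddCommGroup N'] [Module k N'] (f : N →ₗ[k] N') (w : List Λ)
    (g : List Λ → List Λ → N) :
    f (splitSum k d w g) = splitSum k d w fun u v => f (g u v) := by
  induction w generalizing g with
  | nil => rfl
  | cons x w ih =>
    rw [splitSum_cons, splitSum_cons, map_add, ih, ih]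
    simp only [map_smul]

theorem splitSum_eq_zero {w : List Λ} {g : List Λ → List Λ → N}
    (h : ∀ u v, (u ++ v).Perm w → g u v = 0) : splitSum k d w g = 0 := by
  rw [splitSum_congr d (g' := 0) h, map_zero]

theorem splitSum_letter {Λ' : Type*} (f : Λ' → Λ) (w : List Λ') (g : List Λ → List Λ → N) :
    splitSum k d (w.map f) g =
      splitSum k (fun x => d (f x)) w fun u v => g (u.map f) (v.map f) := by
  induction w generalizing g with
  | nil => rfl
  | cons x w ih =>
    rw [List.map_cons, splitSum_cons, splitSum_cons, ih, ih]
    simp [wordDegree, Function.comp_def]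

/-- Coassociativity: both sides are the signed sum over splittings into three words. A letter that
goes to the third word passes the first two, whose degrees add up. -/
theorem splitSum_assoc (w : List Λ) (g : List Λ → List Λ → List Λ → N) :
    splitSum k d w (fun u v => splitSum k d v fun a b => g u a b) =
      splitSum k d w (fun c b => splitSum k d c fun u a => g u a b) := by
  induction w generalizing g with
  | nil => rfl
  | cons x w ih =>
    have hL : splitSum k d w (fun u v => (-1 : k) ^ (d x * wordDegree d u) •
        splitSum k d (x :: v) fun a b => g u a b) =
        splitSum k d w (fun u v => splitSum k d v fun a b =>
          (-1 : k) ^ (d x * wordDegree d u) • g u (x :: a) b) +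
        splitSum k d w (fun u v => splitSum k d v fun a b =>
          (-1 : k) ^ (d x * (wordDegree d u + wordDegree d a)) • g u a (x :: b)) := by
      rw [← map_add]
      congr 1
      ext u v
      rw [splitSum_cons, smul_add, ← map_smul, ← map_smul]
      simp only [Pi.add_apply]
      congr 3
      ext a b
      simp only [Pi.smul_apply, smul_smul, mul_add, neg_one_zpow_add]
    have hR : splitSum k d w (fun c b => (-1 : k) ^ (d x * wordDegree d c) •
        splitSum k d c fun u a => g u a (x :: b)) =
        splitSum k d w (fun c b => splitSum k d c fun u a =>
          (-1 : k) ^ (d x * (wordDegree d u + wordDegree d a)) • g u a (x :: b)) := by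
      congr 1
      ext c b
      rw [← map_smul]
      refine splitSum_congr d fun u a p => ?_
      rw [← wordDegree_append, wordDegree_perm d p]
      rfl
    rw [splitSum_cons, splitSum_cons, hL, hR, ih, ih, ih]
    simp only [splitSum_cons]
    rw [← add_assoc, ← map_add]
    rfl

/-- Graded cocommutativity: a letter put into the left word picks up the sign that it would get on
the other side. -/
theorem splitSum_comm (w : List Λ) (g : List Λ → List Λ → N) :
    splitSum k d w g = splitSum k d w fun u v =>
      (-1 : k) ^ (wordDegree d u * wordDegree d v) • g v u := by
  induction w generalizing g with
  | nil => simp [splitSum_nil]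
  | cons x w ih =>
    rw [splitSum_cons, splitSum_cons, ih fun u v => g (x :: u) v,
      ih fun u v => (-1 : k) ^ (d x * wordDegree d u) • g u (x :: v), add_comm]
    congr 1
    · congr 1
      ext u v
      rw [smul_smul, ← neg_one_zpow_add, wordDegree_cons]
      congr 1
      exact neg_one_zpow_congr ⟨0, by ring⟩
    · congr 1
      ext u v
      rw [smul_smul, ← neg_one_zpow_add, wordDegree_cons]
      congr 1
      exact neg_one_zpow_congr ⟨-(d x * wordDegree d u), by ring⟩

/-- Splittings with the first letter on the left cancel those with the first letter on the right.
Separating these two halves avoids a division by 2, so the argument works in characteristic 2; only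
the empty word needs the extra hypothesis. -/
theorem splitSum_eq_zero_of_antisymm (w : List Λ) (g : List Λ → List Λ → N) (h0 : g [] [] = 0)
    (h : ∀ u v, g u v = -((-1 : k) ^ (wordDegree d u * wordDegree d v) • g v u)) :
    splitSum k d w g = 0 := by
  cases w with
  | nil => exact h0
  | cons x w =>
    rw [splitSum_cons, splitSum_comm d w fun u v => (-1 : k) ^ (d x * wordDegree d u) • g u (x :: v),
      ← map_add]
    refine splitSum_eq_zero d fun u v _ => ?_
    rw [Pi.add_apply, Pi.add_apply, h (x :: u) v, smul_smul, ← neg_one_zpow_add, wordDegree_cons,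
      neg_add_eq_zero]
    congr 1
    exact neg_one_zpow_congr ⟨0, by ring⟩

/-- A function of two words that is graded symmetric in each of them stays so after summation. -/
theorem splitSum_swap (x y : Λ) (g : List Λ → List Λ → N)
    (h1 : ∀ u v w, g (u ++ x :: y :: v) w = (-1 : k) ^ (d x * d y) • g (u ++ y :: x :: v) w)
    (h2 : ∀ u v w, g w (u ++ x :: y :: v) = (-1 : k) ^ (d x * d y) • g w (u ++ y :: x :: v))
    (u v : List Λ) : splitSum k d (u ++ x :: y :: v) g =
      (-1 : k) ^ (d x * d y) • splitSum k d (u ++ y :: x :: v) g := by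
  induction u generalizing g with
  | nil =>
    -- The letters `x`, `y` lie both on the left, both on the right, or on different sides. The
    -- symmetry of `g` is needed when they lie on the same side; the two mixed terms are exchanged
    -- by the Koszul signs alone.
    have e1 : splitSum k d v (fun u v => g (x :: y :: u) v) =
        (-1 : k) ^ (d x * d y) • splitSum k d v (fun u v => g (y :: x :: u) v) := by
      rw [← map_smul]
      congr 1
      ext u v
      exact h1 [] u v
    have e2 : splitSum k d v (fun u v => (-1 : k) ^ (d y * wordDegree d u) • g (x :: u) (y :: v)) =
        (-1 : k) ^ (d x * d y) • splitSum k d v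
          (fun u v => (-1 : k) ^ (d y * wordDegree d (x :: u)) • g (x :: u) (y :: v)) := by
      rw [← map_smul]
      congr 1
      ext u v
      rw [Pi.smul_apply, Pi.smul_apply, smul_smul, ← neg_one_zpow_add, wordDegree_cons]
      congr 1
      exact neg_one_zpow_congr ⟨-(d x * d y), by ring⟩
    have e3 : splitSum k d v
          (fun u v => (-1 : k) ^ (d x * wordDegree d (y :: u)) • g (y :: u) (x :: v)) =
        (-1 : k) ^ (d x * d y) • splitSum k d v
          (fun u v => (-1 : k) ^ (d x * wordDegree d u) • g (y :: u) (x :: v)) := by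
      rw [← map_smul]
      congr 1
      ext u v
      rw [Pi.smul_apply, Pi.smul_apply, smul_smul, ← neg_one_zpow_add, wordDegree_cons]
      congr 1
      exact neg_one_zpow_congr ⟨0, by ring⟩
    have e4 : splitSum k d v (fun u v => (-1 : k) ^ (d y * wordDegree d u) •
          (-1 : k) ^ (d x * wordDegree d u) • g u (x :: y :: v)) =
        (-1 : k) ^ (d x * d y) • splitSum k d v (fun u v => (-1 : k) ^ (d x * wordDegree d u) •
          (-1 : k) ^ (d y * wordDegree d u) • g u (y :: x :: v)) := by
      rw [← map_smul]
      congr 1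
      ext u v
      rw [Pi.smul_apply, Pi.smul_apply, smul_comm, smul_comm ((-1 : k) ^ (d x * d y)),
        smul_comm ((-1 : k) ^ (d x * d y))]
      exact congrArg _ (congrArg _ (h2 [] v u))
    simp only [List.nil_append, splitSum_cons, smul_add]
    rw [e1, e2, e3, e4]
    abel
  | cons z u ih =>
    rw [List.cons_append, List.cons_append, splitSum_cons, splitSum_cons, smul_add,
      ih (fun u v => g (z :: u) v) (fun a b c => h1 (z :: a) b c) (fun a b c => h2 a b (z :: c)),
      ih (fun u v => _ • _)]
    · intro a b c
      rw [h1, smul_comm]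
      simp only [wordDegree_append, wordDegree_cons]
      rw [add_left_comm (d x)]
    · intro a b c
      have := h2 (z :: a) b c
      rw [List.cons_append, List.cons_append] at this
      rw [this, smul_comm]

end Splittings

open GradedSym

/-! ### Linear maps on the graded symmetric algebra of the graph complex -/

namespace SymGraph

variable {k : Type u} [Field k] {O : CyclicOperad.{u, w} k}

/-- The number of vertices. -/
noncomputable def vdeg (A : OGraph O) : ℤ := Nat.card A.V

/-- The product of the classes of a list of graphs. -/
noncomputable def word (w : List (OGraph O)) : SymGraphComplex O :=
  (w.map fun A => incl (GraphComplex.degree O) A.cls).prod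

theorem word_nil : word ([] : List (OGraph O)) = 1 := rfl

theorem word_cons (A : OGraph O) (w : List (OGraph O)) :
    word (A :: w) = incl (GraphComplex.degree O) A.cls * word w := by
  rw [word, List.map_cons, List.prod_cons, word]

theorem word_append (u w : List (OGraph O)) : word (u ++ w) = word u * word w := by
  rw [word, List.map_append, List.prod_append, word, word]

theorem incl_mul_incl {i j : ℤ} {x y : GraphComplex O} (hx : x ∈ GraphComplex.degree O i)
    (hy : y ∈ GraphComplex.degree O j) :
    incl (GraphComplex.degree O) x * incl (GraphComplex.degree O) y =
      (-1 : k) ^ (i * j) • (incl (GraphComplex.degree O) y * incl (GraphComplex.degree O) x) := by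
  have := RingQuot.mkAlgHom_rel k (GradedSymRel.swap (D := GraphComplex.degree O) i j x y hx hy)
  rw [map_smul, map_mul, map_mul] at this
  exact this

theorem cls_mem_degree (A : OGraph O) : A.cls ∈ GraphComplex.degree O (vdeg A) :=
  Submodule.subset_span ⟨A, rfl, rfl⟩

theorem _root_.OGraph.cls_setLabel_add (A : OGraph O) (v : A.V) (p q : O.obj {h // A.vert h = v}) :
    (A.setLabel v (p + q)).cls = (A.setLabel v p).cls + (A.setLabel v q).cls :=
  OGraph.cls_update_add A A.label v p q

theorem _root_.OGraph.cls_setLabel_smul (A : OGraph O) (v : A.V) (c : k)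
    (p : O.obj {h // A.vert h = v}) :
    (A.setLabel v (c • p)).cls = c • (A.setLabel v p).cls :=
  OGraph.cls_update_smul A A.label v c p

variable {N : Type*} [AddCommGroup N] [Module k N]

variable (O N) in
/-- The functions of words of graphs that respect the relations. -/
def wordFunctions : Submodule k (List (OGraph O) → N) where
  carrier := {f |
    (∀ u v (A B : OGraph O) (e : OGraph.Iso A B), f (u ++ B :: v) = e.sign • f (u ++ A :: v)) ∧
    (∀ u v (A : OGraph O) (a : A.V) (p q), f (u ++ A.setLabel a (p + q) :: v) =
      f (u ++ A.setLabel a p :: v) + f (u ++ A.setLabel a q :: v)) ∧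
    (∀ u v (A : OGraph O) (a : A.V) (c : k) (p), f (u ++ A.setLabel a (c • p) :: v) =
      c • f (u ++ A.setLabel a p :: v)) ∧
    (∀ u v (A B : OGraph O), f (u ++ A :: B :: v) =
      (-1 : k) ^ (vdeg A * vdeg B) • f (u ++ B :: A :: v))}
  add_mem' := by
    rintro f g ⟨f1, f2, f3, f4⟩ ⟨g1, g2, g3, g4⟩
    refine ⟨fun u v A B e => ?_, fun u v A a p q => ?_, fun u v A a c p => ?_, fun u v A B => ?_⟩
    · rw [Pi.add_apply, Pi.add_apply, f1 u v A B e, g1 u v A B e, smul_add]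
    · simp only [Pi.add_apply]; rw [f2, g2, add_add_add_comm]
    · simp only [Pi.add_apply]; rw [f3, g3, smul_add]
    · rw [Pi.add_apply, Pi.add_apply, f4, g4, smul_add]
  zero_mem' := by
    refine ⟨fun u v A B e => ?_, fun u v A a p q => ?_, fun u v A a c p => ?_, fun u v A B => ?_⟩ <;>
      simp
  smul_mem' := by
    rintro r f ⟨f1, f2, f3, f4⟩
    refine ⟨fun u v A B e => ?_, fun u v A a p q => ?_, fun u v A a c p => ?_, fun u v A B => ?_⟩
    · rw [Pi.smul_apply, Pi.smul_apply, f1 u v A B e, smul_comm]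
    · simp only [Pi.smul_apply]; rw [f2, smul_add]
    · simp only [Pi.smul_apply]; rw [f3, smul_comm]
    · rw [Pi.smul_apply, Pi.smul_apply, f4, smul_comm]

/-- Append a letter to the argument. -/
def shift (A : OGraph O) : Module.End k (wordFunctions O N) where
  toFun f := ⟨fun w => f.1 (w ++ [A]), by
    obtain ⟨f, f1, f2, f3, f4⟩ := f
    refine ⟨fun u v B C e => ?_, fun u v B a p q => ?_, fun u v B a c p => ?_, fun u v B C => ?_⟩ <;>
      simp only [List.append_assoc, List.cons_append]
    · exact f1 _ _ _ _ e
    · exact f2 _ _ _ _ _ _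
    · exact f3 _ _ _ _ _ _
    · exact f4 _ _ _ _⟩
  map_add' _ _ := rfl
  map_smul' _ _ := rfl

/-- The action of the graph complex on functions of words. -/
noncomputable def shiftLinear : GraphComplex O →ₗ[k] Module.End k (wordFunctions O N) :=
  Submodule.liftQ _ (Finsupp.linearCombination k (shift (N := N))) (by
    rw [Submodule.span_le]
    rintro x (h : OGraph.Rel x)
    change Finsupp.linearCombination k (shift (N := N)) x = 0
    cases h with
    | iso e =>
      rw [map_sub, sub_eq_zero, Finsupp.linearCombination_single, Finsupp.linearCombination_single,
        one_smul]
      ext f w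
      exact f.2.1 w [] _ _ e
    | add A v p q =>
      rw [map_sub, map_add, sub_eq_zero, Finsupp.linearCombination_single,
        Finsupp.linearCombination_single, Finsupp.linearCombination_single,
        one_smul, one_smul, one_smul]
      ext f w
      exact f.2.2.1 w [] _ _ _ _
    | smul A v c p =>
      rw [map_sub, sub_eq_zero, Finsupp.linearCombination_single, Finsupp.linearCombination_single,
        one_smul]
      ext f w
      exact f.2.2.2.1 w [] _ _ _ _)

theorem shiftLinear_cls (A : OGraph O) :
    shiftLinear (N := N) A.cls = shift A := by
  rw [shiftLinear, OGraph.cls]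
  refine (Submodule.liftQ_apply _ _ _).trans ?_
  rw [Finsupp.linearCombination_single, one_smul]

/-- Homogeneous elements are combinations of graphs with the given number of vertices, and for
graphs the relation is the graded symmetry of the functions. -/
theorem shiftLinear_swap {i j : ℤ} {x y : GraphComplex O} (hx : x ∈ GraphComplex.degree O i)
    (hy : y ∈ GraphComplex.degree O j) :
    shiftLinear (N := N) x * shiftLinear y =
      (-1 : k) ^ (i * j) • (shiftLinear y * shiftLinear x) := by
  induction hx using Submodule.span_induction with
  | zero => simp
  | add x x' _ _ h h' => rw [map_add, add_mul, h, h', mul_add, smul_add]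
  | smul c x _ h => rw [map_smul, smul_mul_assoc, h, mul_smul_comm, smul_comm]
  | mem x hx =>
    induction hy using Submodule.span_induction with
    | zero => simp
    | add y y' _ _ h h' => rw [map_add, mul_add, h, h', add_mul, smul_add]
    | smul c y _ h => rw [map_smul, mul_smul_comm, h, smul_mul_assoc, smul_comm]
    | mem y hy =>
      obtain ⟨A, rfl, rfl⟩ := hx
      obtain ⟨B, rfl, rfl⟩ := hy
      rw [shiftLinear_cls, shiftLinear_cls]
      ext f w
      change f.1 ((w ++ [A]) ++ [B]) = (-1 : k) ^ (vdeg A * vdeg B) • f.1 ((w ++ [B]) ++ [A])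
      rw [List.append_assoc, List.append_assoc]
      exact f.2.2.2.2 w [] A B

theorem lift_shiftLinear_rel ⦃a b : TensorAlgebra k (GraphComplex O)⦄
    (h : GradedSymRel (GraphComplex.degree O) a b) :
    TensorAlgebra.lift k (shiftLinear (N := N)) a = TensorAlgebra.lift k shiftLinear b := by
  obtain ⟨i, j, x, y, hx, hy⟩ := h
  rw [map_smul, map_mul, map_mul, TensorAlgebra.lift_ι_apply, TensorAlgebra.lift_ι_apply]
  exact shiftLinear_swap hx hy

/-- The action of the graded symmetric algebra on functions of words. -/
noncomputable def shiftAlg : SymGraphComplex O →ₐ[k] Module.End k (wordFunctions O N) :=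
  RingQuot.liftAlgHom k ⟨TensorAlgebra.lift k shiftLinear, lift_shiftLinear_rel⟩

theorem shiftAlg_incl (A : OGraph O) :
    shiftAlg (N := N) (incl (GraphComplex.degree O) A.cls) = shift A := by
  rw [incl, LinearMap.comp_apply, shiftAlg]
  refine (RingQuot.liftAlgHom_mkAlgHom_apply _ _ _ _).trans ?_
  rw [TensorAlgebra.lift_ι_apply, shiftLinear_cls]

/-- Acting by the letters of `w` appends them to the argument in order, so evaluation at the empty
word recovers `f`. This gives linear maps on the symmetric algebra without any basis of it. -/
theorem shiftAlg_word (w : List (OGraph O)) (f : wordFunctions O N) (v : List (OGraph O)) :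
    (shiftAlg (word w) f).1 v = f.1 (v ++ w) := by
  induction w generalizing f v with
  | nil => rw [word_nil, map_one, List.append_nil]; rfl
  | cons A w ih =>
    rw [word_cons, map_mul, shiftAlg_incl]
    change (shiftAlg (word w) f).1 (v ++ [A]) = _
    rw [ih, List.append_assoc]
    rfl

/-- The linear map on the graded symmetric algebra given by a function of words that respects the
relations. -/
noncomputable def lift (f : wordFunctions O N) : SymGraphComplex O →ₗ[k] N where
  toFun s := (shiftAlg s f).1 []
  map_add' s t := by rw [map_add]; rfl
  map_smul' c s := by rw [map_smul]; rfl

theorem lift_word (f : wordFunctions O N) (w : List (OGraph O)) : lift f (word w) = f.1 w :=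
  shiftAlg_word w f []

theorem span_cls : Submodule.span k (Set.range (OGraph.cls (O := O))) = ⊤ := by
  rw [eq_top_iff]
  rintro x -
  obtain ⟨x, rfl⟩ := Submodule.Quotient.mk_surjective _ x
  induction x using Finsupp.induction_linear with
  | zero => exact zero_mem _
  | add x y hx hy => exact add_mem hx hy
  | single A c =>
    have : Finsupp.single A c = c • Finsupp.single A (1 : k) := by simp
    rw [this]
    exact Submodule.smul_mem _ c (Submodule.subset_span (Set.mem_range_self (f := OGraph.cls) A))

theorem span_word : Submodule.span k (Set.range (word (O := O))) = ⊤ := by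
  set P := Submodule.span k (Set.range (word (O := O)))
  -- Stability of the span under left multiplication is what passes through products in the
  -- induction; applied to the empty word it gives the claim.
  have key : ∀ a : TensorAlgebra k (GraphComplex O), ∀ p ∈ P,
      RingQuot.mkAlgHom k (GradedSymRel (GraphComplex.degree O)) a * p ∈ P := by
    intro a
    induction a using TensorAlgebra.induction with
    | algebraMap r =>
      intro p hp
      rw [AlgHom.commutes, ← Algebra.smul_def]
      exact P.smul_mem r hp
    | ι x =>
      intro p hp
      have hx : x ∈ Submodule.span k (Set.range (OGraph.cls (O := O))) := by
        rw [span_cls]; trivial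
      change incl (GraphComplex.degree O) x * p ∈ P
      induction hx using Submodule.span_induction with
      | zero => simp
      | add x y _ _ h h' => rw [map_add, add_mul]; exact add_mem h h'
      | smul c x _ h => rw [map_smul, smul_mul_assoc]; exact P.smul_mem c h
      | mem x hx =>
        obtain ⟨A, rfl⟩ := hx
        induction hp using Submodule.span_induction with
        | zero => simp
        | add x y _ _ h h' => rw [mul_add]; exact add_mem h h'
        | smul c x _ h => rw [mul_smul_comm]; exact P.smul_mem c h
        | mem x hx =>
          obtain ⟨w, rfl⟩ := hx
          exact Submodule.subset_span ⟨A :: w, word_cons A w⟩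
    | mul a b ha hb =>
      intro p hp
      rw [map_mul, mul_assoc]
      exact ha _ (hb _ hp)
    | add a b ha hb =>
      intro p hp
      rw [map_add, add_mul]
      exact add_mem (ha _ hp) (hb _ hp)
  rw [eq_top_iff]
  rintro s -
  obtain ⟨a, rfl⟩ := RingQuot.mkAlgHom_surjective k (GradedSymRel (GraphComplex.degree O)) s
  have := key a 1 (Submodule.subset_span ⟨[], rfl⟩)
  rwa [mul_one] at this

theorem ext_word {f g : SymGraphComplex O →ₗ[k] N} (h : ∀ w, f (word w) = g (word w)) : f = g :=
  LinearMap.ext_on_range span_word h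

theorem map_to_front (f : List (OGraph O) → N)
    (h : ∀ u v (A B : OGraph O), f (u ++ A :: B :: v) =
      (-1 : k) ^ (vdeg A * vdeg B) • f (u ++ B :: A :: v)) (B : OGraph O)
    (t u v : List (OGraph O)) : f (t ++ (u ++ B :: v)) =
      (-1 : k) ^ (vdeg B * wordDegree vdeg u) • f (t ++ B :: (u ++ v)) := by
  induction u generalizing t with
  | nil => simp
  | cons C u ih =>
    have := ih (t ++ [C])
    rw [List.append_assoc, List.append_assoc] at this
    refine this.trans ?_
    have h2 := h t (u ++ v) C B
    -- The letter has passed all of `u` by induction; one more adjacent transposition takes it past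
    -- `C`.
    rw [List.cons_append, List.nil_append, h2, smul_smul, ← neg_one_zpow_add, wordDegree_cons]
    congr 1
    exact neg_one_zpow_congr ⟨0, by ring⟩

/-- It is enough to check the linear relations in the first letter. -/
theorem mem_wordFunctions {f : List (OGraph O) → N}
    (f1 : ∀ v (A B : OGraph O) (e : OGraph.Iso A B), f (B :: v) = e.sign • f (A :: v))
    (f2 : ∀ v (A : OGraph O) (a : A.V) (p q), f (A.setLabel a (p + q) :: v) =
      f (A.setLabel a p :: v) + f (A.setLabel a q :: v))
    (f3 : ∀ v (A : OGraph O) (a : A.V) (c : k) (p), f (A.setLabel a (c • p) :: v) =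
      c • f (A.setLabel a p :: v))
    (f4 : ∀ u v (A B : OGraph O), f (u ++ A :: B :: v) =
      (-1 : k) ^ (vdeg A * vdeg B) • f (u ++ B :: A :: v)) : f ∈ wordFunctions O N := by
  have h := fun B u v => map_to_front f f4 B [] u v
  simp only [List.nil_append] at h
  refine ⟨fun u v A B e => ?_, fun u v A a p q => ?_, fun u v A a c p => ?_, f4⟩
  · have hd : vdeg A = vdeg B := congrArg Nat.cast (Nat.card_congr e.onV)
    rw [h, h, f1 _ A B e, smul_comm, hd]
  · rw [h, h, h, f2, smul_add]
    rfl
  · rw [h, h, f3, smul_comm]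
    rfl

/-! ### Brackets and coderivations -/

/-- The fusion of a word, weighted by its length. -/
noncomputable def bracketFun (c : ℕ → k) (w : List (OGraph O)) : GraphComplex O :=
  c w.length • OGraph.bracketWord w

/-- The relations preserve the length of a word, so the weight does not interfere with them. -/
theorem bracketFun_mem (c : ℕ → k) : bracketFun c ∈ wordFunctions O (GraphComplex O) := by
  refine mem_wordFunctions (fun v A B e => ?_) (fun v A a p q => ?_) (fun v A a r p => ?_)
    (fun u v A B => ?_)
  · rw [bracketFun, bracketFun, OGraph.bracketWord_iso e, smul_comm]
    rfl
  · rw [bracketFun, OGraph.bracketWord_add, smul_add]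
    rfl
  · rw [bracketFun, OGraph.bracketWord_smul, smul_comm]
    rfl
  · rw [bracketFun, bracketFun, OGraph.bracketWord_swap, smul_comm, vdeg, vdeg, ← Nat.cast_mul,
      zpow_natCast]
    simp

/-- The brackets, weighted by the number of arguments. -/
noncomputable def bracket (c : ℕ → k) : SymGraphComplex O →ₗ[k] GraphComplex O :=
  lift ⟨bracketFun c, bracketFun_mem c⟩

theorem bracket_word (c : ℕ → k) (w : List (OGraph O)) :
    bracket c (word w) = c w.length • OGraph.bracketWord w := lift_word _ w

theorem word_swap (u v : List (OGraph O)) (A B : OGraph O) : word (u ++ A :: B :: v) =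
    (-1 : k) ^ (vdeg A * vdeg B) • word (u ++ B :: A :: v) := by
  rw [word_append, word_append, word_cons, word_cons, word_cons, word_cons, ← mul_assoc (incl _ _),
    incl_mul_incl (cls_mem_degree A) (cls_mem_degree B), smul_mul_assoc, mul_smul_comm, mul_assoc]

/-- The extension of the brackets as a coderivation, on words. -/
noncomputable def coderivationFun (c : ℕ → k) (w : List (OGraph O)) : SymGraphComplex O :=
  splitSum k vdeg w fun u v =>
    incl (GraphComplex.degree O) (bracket c (word u)) * word v

/-- The first letter lands either in the bracket or in the remaining word, and both depend on it in
the required way. The symmetry is inherited through `splitSum_swap`. -/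
theorem coderivationFun_mem (c : ℕ → k) :
    coderivationFun c ∈ wordFunctions O (SymGraphComplex O) := by
  have hb := bracketFun_mem (O := O) c
  have hw : ∀ w : List (OGraph O), bracket c (word w) = bracketFun c w := lift_word _
  refine mem_wordFunctions (fun v A B e => ?_) (fun v A a p q => ?_) (fun v A a r p => ?_)
    (fun u v A B => ?_)
  · have hd : vdeg A = vdeg B := congrArg Nat.cast (Nat.card_congr e.onV)
    simp only [coderivationFun, splitSum_cons, hw]
    rw [smul_add, ← map_smul, ← map_smul]
    congr 2
    · ext u v
      have h := hb.1 [] u A B e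
      simp only [List.nil_append] at h
      rw [Pi.smul_apply, Pi.smul_apply, ← smul_mul_assoc, ← map_smul, h]
    · ext u v
      rw [Pi.smul_apply, Pi.smul_apply, hd, word_cons, word_cons, e.cls_eq, map_smul,
        smul_mul_assoc, mul_smul_comm, smul_comm]
  · simp only [coderivationFun, splitSum_cons, hw]
    rw [add_add_add_comm]
    refine congrArg₂ _ ?_ ?_
    · rw [← map_add]
      refine congrArg _ ?_
      ext u v
      have h := hb.2.1 [] u A a p q
      simp only [List.nil_append] at h
      rw [Pi.add_apply, Pi.add_apply, h, map_add, add_mul]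
    · rw [← map_add]
      refine congrArg _ ?_
      ext u v
      rw [Pi.add_apply, Pi.add_apply, word_cons, word_cons, word_cons, OGraph.cls_setLabel_add,
        map_add, add_mul, mul_add, smul_add]
      rfl
  · simp only [coderivationFun, splitSum_cons, hw]
    rw [smul_add, ← map_smul, ← map_smul]
    congr 2
    · ext u v
      have h := hb.2.2.1 [] u A a r p
      simp only [List.nil_append] at h
      rw [Pi.smul_apply, Pi.smul_apply, h, map_smul, smul_mul_assoc]
    · ext u v
      rw [Pi.smul_apply, Pi.smul_apply, word_cons, word_cons, OGraph.cls_setLabel_smul, map_smul,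
        smul_mul_assoc, mul_smul_comm, smul_comm]
      rfl
  · refine splitSum_swap vdeg A B _ ?_ ?_ u v
    · intro u v w
      rw [word_swap, map_smul, map_smul, smul_mul_assoc]
    · intro u v w
      rw [word_swap, mul_smul_comm]

end SymGraph

theorem splitSum_add {k : Type u} [Field k] {Λ : Type*} (d : Λ → ℤ) {N : Type*} [AddCommGroup N]
    [Module k N] (w : List Λ) (f g : List Λ → List Λ → N) :
    splitSum k d w (fun u v => f u v + g u v) = splitSum k d w f + splitSum k d w g :=
  map_add _ f g

/-! ### The degree of a fusion -/

namespace OGraph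

variable {k : Type u} [Field k] {O : CyclicOperad.{u, w} k}

/-- The contraction deletes the head and nothing else from the vertices, which is why the brackets
have degree -1; a loop gives zero, which lies in every degree. -/
theorem contractCls_mem_degree (A : OGraph O) (a : A.H) :
    A.contractCls a ∈ GraphComplex.degree O (Nat.card A.V - 1) := by
  by_cases ha : A.vert a = A.vert (A.flip a)
  · rw [contractCls_of_eq A a ha]
    exact zero_mem _
  · rw [contractCls_of_ne A a ha]
    refine Submodule.smul_mem _ _ (Submodule.subset_span ⟨_, ?_, rfl⟩)
    have e := Nat.card_congr (Equiv.optionSubtypeNe (A.vert (A.flip a)))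
    rw [Finite.card_option] at e
    change ((Nat.card {v : A.V // v ≠ A.vert (A.flip a)} : ℕ) : ℤ) = _
    omega

theorem fusionTerm_mem_degree (A : OGraph O) (l : List A.H) :
    A.fusionTerm l ∈ GraphComplex.degree O (Nat.card A.V - 1) := by
  cases l with
  | nil => exact zero_mem _
  | cons x l => exact contractCls_mem_degree (A.twist _) _

theorem card_union (w : List (OGraph O)) :
    (Nat.card (union w).V : ℤ) = wordDegree SymGraph.vdeg w := by
  induction w with
  | nil =>
    change ((Nat.card Empty : ℕ) : ℤ) = 0
    simp
  | cons A w ih =>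
    rw [wordDegree_cons, ← ih, SymGraph.vdeg]
    exact_mod_cast card_sum A (union w)

theorem bracketWord_mem_degree (w : List (OGraph O)) :
    bracketWord w ∈ GraphComplex.degree O (wordDegree SymGraph.vdeg w - 1) := by
  rw [← card_union, bracketWord, fusionSum]
  exact finsum_mem_induction (· ∈ GraphComplex.degree O _) (zero_mem _)
    (fun _ _ => add_mem) fun l _ => fusionTerm_mem_degree _ l

end OGraph

/-! ### Reduction of the square to the bracket of the coderivation -/

namespace SymGraph

variable {k : Type u} [Field k] {O : CyclicOperad.{u, w} k}

/-- The extension of the brackets as a coderivation. -/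
noncomputable def coderivation (c : ℕ → k) : Module.End k (SymGraphComplex O) :=
  lift ⟨coderivationFun c, coderivationFun_mem c⟩

theorem coderivation_word (c : ℕ → k) (w : List (OGraph O)) :
    coderivation c (word w) = splitSum k vdeg w fun u v =>
      incl (GraphComplex.degree O) (bracket c (word u)) * word v := lift_word _ w

theorem bracket_word_mem_degree (c : ℕ → k) (w : List (OGraph O)) :
    bracket c (word w) ∈ GraphComplex.degree O (wordDegree vdeg w - 1) := by
  rw [bracket_word]
  exact Submodule.smul_mem _ _ (OGraph.bracketWord_mem_degree w)

theorem bracket_one (c : ℕ → k) : bracket c (1 : SymGraphComplex O) = 0 := by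
  rw [← word_nil, bracket_word, OGraph.bracketWord_nil, smul_zero]

/-- Here `y` will be the output of a first bracket, which need not be a single graph. It either
enters the second bracket or stays outside, and in the latter case the letters in the bracket pass
it. -/
theorem coderivation_incl_mul (c : ℕ → k) {j : ℤ} {y : GraphComplex O}
    (hy : y ∈ GraphComplex.degree O j) (w : List (OGraph O)) :
    coderivation c (incl (GraphComplex.degree O) y * word w) =
      splitSum k vdeg w (fun u v =>
        incl (GraphComplex.degree O)
          (bracket c (incl (GraphComplex.degree O) y * word u)) * word v) +
      splitSum k vdeg w (fun u v => (-1 : k) ^ (j * wordDegree vdeg u) •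
        (incl (GraphComplex.degree O) (bracket c (word u)) *
          (incl (GraphComplex.degree O) y * word v))) := by
  induction hy using Submodule.span_induction with
  | zero =>
    simp only [map_zero, zero_mul, mul_zero, smul_zero]
    rw [splitSum_eq_zero vdeg fun _ _ _ => rfl, add_zero]
  | add x y _ _ hx hy =>
    simp only [map_add, add_mul, mul_add, smul_add] at hx hy ⊢
    rw [hx, hy, add_add_add_comm, ← map_add, ← map_add]
    rfl
  | smul r x _ hx =>
    simp only [map_smul, smul_mul_assoc, mul_smul_comm] at hx ⊢
    rw [hx, smul_add, ← map_smul, ← map_smul]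
    congr 2
    ext u v
    rw [smul_comm]
    rfl
  | mem y hy =>
    obtain ⟨A, rfl, rfl⟩ := hy
    rw [← word_cons, coderivation_word, splitSum_cons]
    simp only [word_cons]
    rfl

/-- The terms in which one bracket is inserted into the other add up to the value of the bracket on
the coderivation of a subword, which vanishes by hypothesis. -/
theorem coderivation_comp_self (c : ℕ → k)
    (h : ∀ w : List (OGraph O), bracket c (coderivation c (word w)) = 0) :
    (coderivation c ∘ₗ coderivation c : Module.End k (SymGraphComplex O)) = 0 := by
  refine ext_word fun w => ?_
  rw [LinearMap.comp_apply, coderivation_word, splitSum_map, LinearMap.zero_apply]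
  simp only [coderivation_incl_mul c (bracket_word_mem_degree c _)]
  rw [splitSum_add, splitSum_assoc, splitSum_assoc]
  have h1 : ∀ v b : List (OGraph O), splitSum k vdeg v (fun u a =>
      incl (GraphComplex.degree O) (bracket c (incl (GraphComplex.degree O)
        (bracket c (word u)) * word a)) * word b) = 0 := by
    intro v b
    have := h v
    rw [coderivation_word, splitSum_map] at this
    have h2 := splitSum_map vdeg (((LinearMap.mulRight k (word b)).comp
      (incl (GraphComplex.degree O)))) v fun u a => bracket c (incl (GraphComplex.degree O)
        (bracket c (word u)) * word a)
    rw [this, map_zero] at h2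
    exact h2.symm
  rw [splitSum_eq_zero vdeg fun v b _ => h1 v b, zero_add]
  -- What is left are two brackets on disjoint subwords of `v`. Since brackets have odd degree,
  -- exchanging them produces one sign more than the Koszul sign of the subwords.
  refine splitSum_eq_zero vdeg fun v b _ => ?_
  refine splitSum_eq_zero_of_antisymm vdeg v _ ?_ fun u a => ?_
  · simp [word_nil, bracket_one]
  · rw [← mul_assoc, ← mul_assoc, incl_mul_incl (bracket_word_mem_degree c a)
      (bracket_word_mem_degree c u), smul_mul_assoc, smul_smul, smul_smul, ← neg_one_zpow_add,
      ← neg_one_zpow_add, ← neg_smul]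
    congr 1
    rw [← neg_one_mul ((-1 : k) ^ _), ← zpow_one_add₀ (by simp)]
    exact neg_one_zpow_congr ⟨-wordDegree vdeg a, by ring⟩

end SymGraph

/-! ### Reversal of a cyclic list of directed edges -/

section Reversal

variable {α : Type}

/-- The list of the reversed directed edges, in the opposite cyclic order; the first two positions
are interchanged. -/
def reversal (φ : α → α) : List α → List α
  | [] => []
  | [x] => [φ x]
  | x :: y :: l => φ y :: φ x :: (l.map φ).reverse

theorem reversal_reversal {φ : α → α} (hφ : Function.Involutive φ) (l : List α) :
    reversal φ (reversal φ l) = l := by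
  match l with
  | [] => rfl
  | [x] => simp [reversal, hφ x]
  | x :: y :: l => simp [reversal, hφ x, hφ y, hφ.comp_self]

theorem reversal_perm (φ : α → α) (l : List α) : (reversal φ l).Perm (l.map φ) := by
  match l with
  | [] => exact .refl _
  | [x] => exact .refl _
  | x :: y :: l => exact (List.Perm.swap _ _ _).trans (((List.reverse_perm _).cons _).cons _)

theorem mem_reversal {φ : α → α} (hφ : Function.Involutive φ) {l : List α} {x : α} :
    x ∈ reversal φ l ↔ φ x ∈ l := by
  rw [(reversal_perm φ l).mem_iff, List.mem_map]
  exact ⟨fun ⟨y, hy, e⟩ => by rwa [← e, hφ y], fun h => ⟨_, h, hφ x⟩⟩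

theorem length_reversal (φ : α → α) (l : List α) : (reversal φ l).length = l.length := by
  rw [(reversal_perm φ l).length_eq, List.length_map]

theorem nodup_reversal {φ : α → α} (hφ : Function.Involutive φ) {l : List α} (h : l.Nodup) :
    (reversal φ l).Nodup :=
  (reversal_perm φ l).nodup_iff.2 (h.map hφ.injective)

-- Up to rotation the reversal is the reversed list with `φ` applied to its entries. Reversing
-- inverts the cyclic permutation and applying `φ` conjugates it.
open Classical in
theorem formPerm_reversal {φ : α → α} (hφ : Function.Involutive φ) {l : List α} (h : l.Nodup)
    (x : α) : (reversal φ l).formPerm x = φ (l.formPerm.symm (φ x)) := by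
  match l with
  | [] => exact (hφ x).symm
  | [y] =>
    rw [reversal, List.formPerm_singleton, List.formPerm_singleton]
    exact (hφ x).symm
  | y :: z :: l =>
    have e : reversal φ (y :: z :: l) = (z :: y :: l.reverse).map φ := by simp [reversal]
    have hr : z :: y :: l.reverse ~r (y :: z :: l).reverse := by
      have h1 : (y :: z :: l).reverse = l.reverse ++ [z, y] := by simp
      rw [h1]
      exact (List.isRotated_append (l := [z, y]) (l' := l.reverse))
    rw [e, ← hφ x, List.formPerm_map_apply _ hφ.injective, hφ x,
      ← List.formPerm_eq_of_isRotated (List.nodup_reverse.2 h) hr.symm, List.formPerm_reverse]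
    rfl

end Reversal

/-! ### Turning a polygon over -/

namespace OGraph

variable {k : Type u} [Field k] {O : CyclicOperad.{u, w} k}

theorem flip_involutive (A : OGraph O) : Function.Involutive A.flip := A.flip_flip

open Classical in
/-- Contract `a` and then take the contribution of a list of directed edges to the fusion. -/
noncomputable def contractFusionTerm (A : OGraph O) (a : A.H) : List A.H → GraphComplex O
  | [] => 0
  | x :: l => (A.twist (x :: l).formPerm).contract2Cls a (A.flip x)

/-- A permutation of the half-edges and the reversed one lead to the same edges. -/
def reversedTwistIso (A : OGraph O) (c d : Equiv.Perm A.H) (s : Set A.H)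
    (hs : ∀ x ∈ s, A.flip x ∉ s) (hc : ∀ x, x ∉ s → c x = x)
    (hd : ∀ x, d x = A.flip (c.symm (A.flip x))) : Iso (A.twist c) (A.twist d) :=
  have hc' : ∀ x, x ∉ s → c.symm x = x := fun x hx => by rw [Equiv.symm_apply_eq, hc x hx]
  have hm : ∀ x ∈ s, c x ∈ s := fun x hx => by
    by_contra h
    exact h (by rwa [c.injective (hc _ h)])
  have hm' : ∀ x ∈ s, c.symm x ∈ s := fun x hx => by
    by_contra h
    exact h (by rw [← hc _ h, c.apply_symm_apply]; exact hx)
  have hd' : ∀ x, d.symm x = A.flip (c (A.flip x)) := fun x => by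
    rw [Equiv.symm_apply_eq, hd, A.flip_flip, c.symm_apply_apply, A.flip_flip]
  Iso.ofAgree (Equiv.refl _) (Equiv.refl _) (fun _ => rfl) (fun x => by
    change d (A.flip (d.symm x)) = c (A.flip (c.symm x))
    rw [hd', A.flip_flip, hd]
    by_cases hx : x ∈ s
    · rw [hc _ (hs x hx), A.flip_flip, hc _ (hs _ (hm' x hx))]
    · rw [hc' x hx]
      by_cases hfx : A.flip x ∈ s
      · rw [hc' _ (hs _ (hm _ hfx)), A.flip_flip]
      · rw [hc _ hfx, A.flip_flip, hc' x hx]) fun _ => .refl _ _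

/-- After reindexing by `c` and by `flip`, a half-edge `x` contributes the product of the signs of
`x ∈ A.dir` and `c x ∈ A.dir`. As `c` is a permutation, the products of these two factors over all
`x` are equal, and the total is a square of a sign. -/
theorem reversedTwistIso_sign (A : OGraph O) (c d : Equiv.Perm A.H) (s : Set A.H)
    (hs : ∀ x ∈ s, A.flip x ∉ s) (hc : ∀ x, x ∉ s → c x = x)
    (hd : ∀ x, d x = A.flip (c.symm (A.flip x))) :
    (A.reversedTwistIso c d s hs hc hd).sign = (1 : k) := by
  classical
  have := Fintype.ofFinite A.H
  have hc' : ∀ x, x ∉ s → c.symm x = x := fun x hx => by rw [Equiv.symm_apply_eq, hc x hx]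
  have hm : ∀ x, c x ∈ s ↔ x ∈ s := fun x => by
    constructor
    · intro h
      by_contra hx
      exact hx (by rwa [hc x hx] at h)
    · intro hx
      by_contra h
      exact h (by rwa [c.injective (hc _ h)])
  have hd' : ∀ x, d.symm x = A.flip (c (A.flip x)) := fun x => by
    rw [Equiv.symm_apply_eq, hd, A.flip_flip, c.symm_apply_apply, A.flip_flip]
  rw [Iso.sign_eq, vsign_eq_one _ (fun _ _ h => h), one_mul, Iso.dsign,
    neg_one_pow_ncard]
  have h1 : ∀ x : A.H, signIf k (x ∈ {h | h ∈ (A.twist c).dir ∧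
      (A.reversedTwistIso c d s hs hc hd).onH h ∉ (A.twist d).dir}) =
      (if x ∈ s then signIf k (c.symm x ∈ A.dir ∧ x ∉ A.dir) else 1) *
      (if A.flip x ∈ s then signIf k (x ∈ A.dir ∧ c (A.flip x) ∈ A.dir) else 1) := by
    intro x
    change signIf k (c.symm x ∈ A.dir ∧ d.symm x ∉ A.dir) = _
    rw [hd', ← A.mem_dir]
    by_cases hx : x ∈ s
    · rw [if_pos hx, if_neg (hs x hx), mul_one, hc _ (hs x hx), A.mem_dir x, not_not]
    · rw [if_neg hx, one_mul, hc' x hx]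
      by_cases hfx : A.flip x ∈ s
      · rw [if_pos hfx]
      · rw [if_neg hfx, hc _ hfx, A.mem_dir x]
        exact signIf_of_not k fun h => h.1 h.2
  refine (Finset.prod_congr rfl fun x _ => h1 x).trans ?_
  rw [Finset.prod_mul_distrib, ← Equiv.prod_comp c, ← Equiv.prod_comp A.flip_involutive.toPerm
    (fun x => if A.flip x ∈ s then signIf k (x ∈ A.dir ∧ c (A.flip x) ∈ A.dir) else 1),
    ← Finset.prod_mul_distrib]
  have h2 : ∀ x : A.H, (if c x ∈ s then signIf k (c.symm (c x) ∈ A.dir ∧ c x ∉ A.dir) else 1) *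
      (if A.flip (A.flip x) ∈ s then signIf k (A.flip x ∈ A.dir ∧ c (A.flip (A.flip x)) ∈ A.dir)
        else 1) = signIf k (x ∈ A.dir) * signIf k (c x ∈ A.dir) := by
    intro x
    rw [c.symm_apply_apply, A.flip_flip, A.mem_dir (A.flip x), A.flip_flip]
    by_cases hx : x ∈ s
    · rw [if_pos ((hm x).2 hx), if_pos hx]
      by_cases h : x ∈ A.dir <;> by_cases h' : c x ∈ A.dir <;> simp [signIf, h, h']
    · rw [if_neg (fun h => hx ((hm x).1 h)), if_neg hx, hc x hx, signIf_mul_self, one_mul]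
  refine (Finset.prod_congr rfl fun x _ => h2 x).trans ?_
  rw [Finset.prod_mul_distrib, Equiv.prod_comp c fun x => signIf k (x ∈ A.dir),
    ← Finset.prod_mul_distrib]
  exact Finset.prod_eq_one fun x _ => signIf_mul_self k _

/-- The polygon turned over has the same sides. The interchange of the first two entries in
`reversal` is chosen so that the side to be contracted stays the same, traversed in the other
direction. -/
theorem contractFusionTerm_reversal (A : OGraph O) (a : A.H) {l : List A.H} (hl : l.Nodup)
    (hf : ∀ x ∈ l, A.flip x ∉ l) :
    A.contractFusionTerm a (reversal A.flip l) = A.contractFusionTerm a l := by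
  classical
  have key : ∀ b, (A.twist (reversal A.flip l).formPerm).contract2Cls a b =
      (A.twist l.formPerm).contract2Cls a b := fun b => by
    have h := Iso.contract2Cls_eq (A.reversedTwistIso l.formPerm (reversal A.flip l).formPerm
      {x | x ∈ l} hf (fun x hx => List.formPerm_apply_of_notMem hx)
      (formPerm_reversal A.flip_involutive hl)) a b
    rw [reversedTwistIso_sign, one_smul] at h
    exact h
  match l with
  | [] => rfl
  | [x] =>
    refine (key (A.flip (A.flip x))).trans ?_
    refine Eq.trans ?_ (contract2Cls_flip_right (A.twist [x].formPerm) a (A.flip x))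
    congr 1
  | x :: y :: l =>
    refine (key (A.flip (A.flip y))).trans ?_
    refine Eq.trans ?_ (contract2Cls_flip_right (A.twist (x :: y :: l).formPerm) a (A.flip x))
    congr 1
    -- In the fused graph the other half of the side at `A.flip x` is `y`, the entry after `x`.
    change _ = (x :: y :: l).formPerm (A.flip ((x :: y :: l).formPerm.symm (A.flip x)))
    have : (x :: y :: l).formPerm.symm (A.flip x) = A.flip x := by
      rw [Equiv.symm_apply_eq, List.formPerm_apply_of_notMem (hf x (by simp))]
    rw [this, A.flip_flip, A.flip_flip, List.formPerm_apply_head _ _ _ hl]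

end OGraph

/-- Terms at fixed points are required to vanish on their own, since in characteristic 2 the
cancellation hypothesis says nothing about them. -/
theorem finsum_mem_involution {α M : Type*} [AddCommMonoid M] {S : Set α} (hS : S.Finite)
    (f : α → M) (σ : α → α) (hσ : ∀ a ∈ S, σ a ∈ S) (hσσ : ∀ a ∈ S, σ (σ a) = a)
    (h : ∀ a ∈ S, f a + f (σ a) = 0) (h' : ∀ a ∈ S, σ a = a → f a = 0) :
    ∑ᶠ a ∈ S, f a = 0 := by
  rw [finsum_mem_eq_finite_toFinset_sum _ hS]
  exact Finset.sum_involution (fun a _ => σ a) (fun a ha => h a (hS.mem_toFinset.1 ha))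
    (fun a ha hf e => hf (h' a (hS.mem_toFinset.1 ha) e))
    (fun a ha => hS.mem_toFinset.2 (hσ a (hS.mem_toFinset.1 ha)))
    (fun a ha => hσσ a (hS.mem_toFinset.1 ha))

theorem List.exists_eq_rotate_cons {α : Type*} {l : List α} {x : α} (h : x ∈ l) :
    ∃ t i, i < l.length ∧ l = (x :: t).rotate i := by
  obtain ⟨s, t, rfl⟩ := List.append_of_mem h
  cases s with
  | nil => exact ⟨t, 0, by simp, by simp⟩
  | cons y s =>
    refine ⟨t ++ y :: s, t.length + 1, by simp, ?_⟩
    exact (List.rotate_append_length_eq (x :: t) (y :: s)).symm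

theorem List.Nodup.eq_of_rotate_eq {α : Type*} {x : α} {s t : List α} (hs : (x :: s).Nodup)
    {i j : ℕ} (hi : i < s.length + 1) (hj : j < s.length + 1)
    (h : (x :: s).rotate i = (x :: t).rotate j) : i = j ∧ s = t := by
  have hl : s.length = t.length := by simpa using congrArg List.length h
  have key : ∀ {s t : List α} {i j : ℕ}, (x :: s).Nodup → i < s.length + 1 → j < s.length + 1 →
      s.length = t.length → (x :: s).rotate i = (x :: t).rotate j → i ≤ j → i = j := by
    intro s t i j hs hi hj hl h hij
    -- Undo the rotation on the right, so that the right-hand list starts with `x`; the position of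
    -- `x` on the left then forces `i = j`.
    have h2 := congrArg (fun l => l.rotate (s.length + 1 - j)) h
    simp only [List.rotate_rotate] at h2
    rw [show j + (s.length + 1 - j) = (x :: t).length by simp; omega, List.rotate_length] at h2
    have h3 := congrArg (fun l => l[0]?) h2
    simp only [List.getElem?_cons_zero] at h3
    rw [List.getElem?_rotate (by simp)] at h3
    simp only [List.length_cons, zero_add] at h3
    by_contra hne
    have e : (i + (s.length + 1 - j)) % (s.length + 1) = (i + (s.length + 1 - j)) :=
      Nat.mod_eq_of_lt (by omega)
    rw [e, List.getElem?_eq_some_iff] at h3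
    obtain ⟨h4, h5⟩ := h3
    have h6 : (x :: s)[i + (s.length + 1 - j)] = (x :: s)[0] := h5
    have := (hs.getElem_inj_iff).1 h6
    omega
  have hij : i = j := by
    rcases le_total i j with hle | hle
    · exact key hs hi hj hl h hle
    · refine (key ?_ (hl ▸ hj) (hl ▸ hi) hl.symm h.symm hle).symm
      rw [← List.nodup_rotate (n := j), ← h, List.nodup_rotate]
      exact hs
  subst hij
  exact ⟨rfl, (List.cons.inj (List.rotate_injective i h)).2⟩

/-! ### Pairs of fusions: independent and reversed pairs -/

namespace OGraph

variable {k : Type u} [Field k] {O : CyclicOperad.{u, w} k}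

open Classical in
/-- The contribution of two lists of directed edges to the iterated fusion. -/
noncomputable def doubleTerm (A : OGraph O) : List A.H → List A.H → GraphComplex O
  | [], _ => 0
  | x :: l, f => (A.twist (x :: l).formPerm).contractFusionTerm (A.flip x) f

open Classical in
/-- The conditions on the lists of directed edges in an iterated fusion: those of the first list
have different colours; those of the second list have different colours after the identification of
all colours that occur in the first list, and they avoid the edge contracted after the first
fusion. -/
structure Admissible (A : OGraph O) (κ : A.H → ℕ) (e f : List A.H) : Prop where
  nodup_left : e.Nodup
  inj_left : ∀ x ∈ e, ∀ y ∈ e, κ x = κ y → x = y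
  nodup_right : f.Nodup
  inj_right : ∀ x ∈ f, ∀ y ∈ f, κ x = κ y → x = y
  inj_merged : ∀ x ∈ f, ∀ y ∈ f, κ x ∈ e.map κ → κ y ∈ e.map κ → x = y
  ne_right : f ≠ []
  avoid : ∃ x l, e = x :: l ∧ A.flip x ∉ f ∧ e.formPerm x ∉ f

theorem finite_admissible (A : OGraph O) (κ : A.H → ℕ) (n : ℕ) :
    {p : List A.H × List A.H | A.Admissible κ p.1 p.2 ∧ p.1.length + p.2.length = n + 1}.Finite :=
  ((List.finite_length_le A.H (n + 1)).prod (List.finite_length_le A.H (n + 1))).subset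
    fun _ h => ⟨(Nat.le_add_right _ _).trans h.2.le, (Nat.le_add_left _ _).trans h.2.le⟩

theorem Admissible.flip_notMem_left {A : OGraph O} {κ : A.H → ℕ} (hκ : ∀ x, κ (A.flip x) = κ x)
    {e f : List A.H} (h : A.Admissible κ e f) {x : A.H} (hx : x ∈ e) : A.flip x ∉ e :=
  fun hf => A.flip_ne x (h.inj_left _ hf _ hx (hκ x))

/-- The terms in which the two fusions are independent of each other cancel in pairs. -/
theorem sum_doubleTerm_disjoint (A : OGraph O) (κ : A.H → ℕ) (c : ℕ → k) (n : ℕ) :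
    ∑ᶠ p ∈ {p : List A.H × List A.H | (A.Admissible κ p.1 p.2 ∧
      p.1.length + p.2.length = n + 1) ∧ ∀ x ∈ p.2, x ∉ p.1 ∧ A.flip x ∉ p.1},
      (c p.1.length * c p.2.length) • A.doubleTerm p.1 p.2 = 0 := by
  classical
  refine finsum_mem_involution ((A.finite_admissible κ n).subset fun p h => h.1) _ Prod.swap ?_
    (fun p _ => Prod.swap_swap p) ?_ ?_
  · rintro ⟨e, f⟩ ⟨⟨h, hn⟩, hd⟩
    -- Using no common edge is a symmetric condition, and it also gives the avoidance condition for
    -- the exchanged pair.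
    have hd' : ∀ x ∈ e, x ∉ f ∧ A.flip x ∉ f := fun x hx =>
      ⟨fun hf => (hd x hf).1 hx, fun hf => (hd _ hf).2 (by rwa [A.flip_flip])⟩
    refine ⟨⟨⟨h.nodup_right, h.inj_right, h.nodup_left, h.inj_left, ?_, ?_, ?_⟩, ?_⟩, hd'⟩
    · intro x hx y hy hxf hyf
      obtain ⟨x', hx', ex⟩ := List.mem_map.1 hxf
      obtain ⟨y', hy', ey⟩ := List.mem_map.1 hyf
      have : x' = y' := h.inj_merged _ hx' _ hy' (ex ▸ List.mem_map_of_mem hx)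
        (ey ▸ List.mem_map_of_mem hy)
      exact h.inj_left _ hx _ hy (by rw [← ex, ← ey, this])
    · obtain ⟨x, l, rfl, -⟩ := h.avoid
      exact List.cons_ne_nil _ _
    · obtain ⟨y, l, rfl⟩ := List.exists_cons_of_ne_nil h.ne_right
      refine ⟨y, l, rfl, (hd y (by simp)).2, fun hm => (hd' _ hm).1 ?_⟩
      exact List.formPerm_apply_mem_of_mem (by simp)
    · change f.length + e.length = n + 1
      rw [add_comm]
      exact hn
  · rintro ⟨e, f⟩ ⟨⟨h, hn⟩, hd⟩
    obtain ⟨x, l, rfl, -⟩ := h.avoid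
    obtain ⟨y, m, rfl⟩ := List.exists_cons_of_ne_nil h.ne_right
    -- The cyclic permutations have disjoint supports, so both orders of fusion give the same graph.
    have hcomm : (x :: l).formPerm * (y :: m).formPerm = (y :: m).formPerm * (x :: l).formPerm := by
      refine Equiv.Perm.Disjoint.commute fun z => ?_
      by_cases hz : z ∈ y :: m
      · exact Or.inl (List.formPerm_apply_of_notMem (hd z hz).1)
      · exact Or.inr (List.formPerm_apply_of_notMem hz)
    have h1 : (x :: l).formPerm (A.flip ((x :: l).formPerm.symm y)) = A.flip y := by
      have e1 : (x :: l).formPerm.symm y = y := by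
        rw [Equiv.symm_apply_eq, List.formPerm_apply_of_notMem (hd y (by simp)).1]
      rw [e1, List.formPerm_apply_of_notMem (hd y (by simp)).2]
    have h2 : (y :: m).formPerm (A.flip ((y :: m).formPerm.symm x)) = A.flip x := by
      have e1 : (y :: m).formPerm.symm x = x := by
        rw [Equiv.symm_apply_eq, List.formPerm_apply_of_notMem fun hx => (hd x hx).1 (by simp)]
      rw [e1, List.formPerm_apply_of_notMem fun hx => (hd _ hx).2 (by simp [A.flip_flip])]
    -- Twisting twice is, by definition, twisting by the product. The side contracted second is the
    -- one that the second polygon would have in the unfused graph.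
    have h3 : A.doubleTerm (x :: l) (y :: m) =
        (A.twist ((y :: m).formPerm * (x :: l).formPerm)).contract2Cls (A.flip x) (A.flip y) := by
      rw [← h1]; rfl
    have h4 : A.doubleTerm (y :: m) (x :: l) =
        (A.twist ((y :: m).formPerm * (x :: l).formPerm)).contract2Cls (A.flip y) (A.flip x) := by
      rw [← h2, ← hcomm]; rfl
    change (c (x :: l).length * c (y :: m).length) • A.doubleTerm (x :: l) (y :: m) +
      (c (y :: m).length * c (x :: l).length) • A.doubleTerm (y :: m) (x :: l) = 0
    rw [h3, h4, contract2Cls_swap, mul_comm (c (y :: m).length), smul_neg, neg_add_cancel]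
  · rintro ⟨e, f⟩ ⟨⟨h, hn⟩, hd⟩ he
    obtain ⟨y, m, rfl⟩ := List.exists_cons_of_ne_nil h.ne_right
    have : y :: m = e := congrArg Prod.fst he
    exact absurd (this ▸ List.mem_cons_self) (hd y (by simp)).1

-- The new sides join half-edges of merged colours, so the merged colours are stable under the new
-- involution.
open Classical in
theorem colour_twist_flip {A : OGraph O} {κ : A.H → ℕ} (hκ : ∀ x, κ (A.flip x) = κ x)
    {e : List A.H} {x : A.H} (hx : κ x ∈ e.map κ) :
    κ ((A.twist e.formPerm).flip x) ∈ e.map κ := by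
  have h : ∀ y, κ y ∈ e.map κ → κ (e.formPerm y) ∈ e.map κ := fun y hy => by
    by_cases h : y ∈ e
    · exact List.mem_map_of_mem (List.formPerm_apply_mem_of_mem h)
    · rwa [List.formPerm_apply_of_notMem h]
  have h' : κ (e.formPerm.symm x) ∈ e.map κ := by
    by_cases h : e.formPerm.symm x ∈ e
    · exact List.mem_map_of_mem h
    · have := List.formPerm_apply_of_notMem h
      rw [Equiv.apply_symm_apply] at this
      rwa [← this]
  exact h _ (by rwa [hκ])

open Classical in
theorem twist_flip_of_notMem {A : OGraph O} {e : List A.H} {x : A.H} (hx : x ∉ e)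
    (hfx : A.flip x ∉ e) : (A.twist e.formPerm).flip x = A.flip x := by
  have h : e.formPerm.symm x = x := by
    rw [Equiv.symm_apply_eq, List.formPerm_apply_of_notMem hx]
  change e.formPerm (A.flip (e.formPerm.symm x)) = _
  rw [h, List.formPerm_apply_of_notMem hfx]

open Classical in
theorem colour_twist_flip_of_notMem {A : OGraph O} {κ : A.H → ℕ} (hκ : ∀ x, κ (A.flip x) = κ x)
    {e : List A.H} {x : A.H} (hx : κ x ∉ e.map κ) :
    κ ((A.twist e.formPerm).flip x) = κ x := by
  rw [twist_flip_of_notMem (fun h => hx (List.mem_map_of_mem h))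
    (fun h => hx (by rw [← hκ]; exact List.mem_map_of_mem h)), hκ]

-- Colour conditions are preserved because the involution of the fused graph preserves merged
-- colours as a set and every other colour individually.
open Classical in
theorem Admissible.reversal {A : OGraph O} {κ : A.H → ℕ} (hκ : ∀ x, κ (A.flip x) = κ x)
    {e f : List A.H} (h : A.Admissible κ e f) :
    A.Admissible κ e (reversal (A.twist e.formPerm).flip f) := by
  have hi := (A.twist e.formPerm).flip_involutive
  have hm : ∀ {x}, x ∈ _root_.reversal (A.twist e.formPerm).flip f ↔
    (A.twist e.formPerm).flip x ∈ f := mem_reversal hi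
  refine ⟨h.nodup_left, h.inj_left, nodup_reversal hi h.nodup_right, ?_, ?_, ?_, ?_⟩
  · intro x hx y hy hxy
    refine hi.injective ?_
    by_cases hxe : κ x ∈ e.map κ
    · exact h.inj_merged _ (hm.1 hx) _ (hm.1 hy) (colour_twist_flip hκ hxe)
        (colour_twist_flip hκ (hxy ▸ hxe))
    · refine h.inj_right _ (hm.1 hx) _ (hm.1 hy) ?_
      rw [colour_twist_flip_of_notMem hκ hxe, hxy, colour_twist_flip_of_notMem hκ (hxy ▸ hxe)]
  · intro x hx y hy hxe hye
    exact hi.injective (h.inj_merged _ (hm.1 hx) _ (hm.1 hy) (colour_twist_flip hκ hxe)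
      (colour_twist_flip hκ hye))
  · intro h0
    have := length_reversal (A.twist e.formPerm).flip f
    rw [h0] at this
    exact h.ne_right (List.length_eq_zero_iff.1 this.symm)
  -- The two halves of the edge to be avoided, `A.flip x` and the successor of `x`, are exchanged by
  -- the involution of the fused graph.
  · obtain ⟨x, l, he, h1, h2⟩ := h.avoid
    have hx : x ∈ e := by rw [he]; simp
    have hfx : e.formPerm.symm (A.flip x) = A.flip x := by
      rw [Equiv.symm_apply_eq, List.formPerm_apply_of_notMem (h.flip_notMem_left hκ hx)]
    refine ⟨x, l, he, fun h3 => h2 ?_, fun h3 => h1 ?_⟩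
    · have h4 : e.formPerm (A.flip (e.formPerm.symm (A.flip x))) ∈ f := hm.1 h3
      rwa [hfx, A.flip_flip] at h4
    · have h4 : e.formPerm (A.flip (e.formPerm.symm (e.formPerm x))) ∈ f := hm.1 h3
      rwa [Equiv.symm_apply_apply, List.formPerm_apply_of_notMem (h.flip_notMem_left hκ hx)] at h4

open Classical in
theorem Admissible.doubleTerm_reversal {A : OGraph O} {κ : A.H → ℕ}
    (hκ : ∀ x, κ (A.flip x) = κ x) {e f : List A.H} (h : A.Admissible κ e f) :
    A.doubleTerm e (_root_.reversal (A.twist e.formPerm).flip f) = A.doubleTerm e f := by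
  obtain ⟨x, l, he, -⟩ := h.avoid
  have hf : ∀ y ∈ f, (A.twist e.formPerm).flip y ∉ f := by
    intro y hy hy'
    refine (A.twist e.formPerm).flip_ne y ?_
    by_cases hye : κ y ∈ e.map κ
    · exact h.inj_merged _ hy' _ hy (colour_twist_flip hκ hye) hye
    · exact h.inj_right _ hy' _ hy (colour_twist_flip_of_notMem hκ hye)
  subst he
  exact contractFusionTerm_reversal (A.twist (x :: l).formPerm) _ h.nodup_right hf

/-- Reversal of the second list, in the graph that results from the first fusion. -/
theorem sum_doubleTerm_reversed (A : OGraph O) (κ : A.H → ℕ) (hκ : ∀ x, κ (A.flip x) = κ x)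
    (c : ℕ → k) (n : ℕ) :
    ∑ᶠ p ∈ {p : List A.H × List A.H | (A.Admissible κ p.1 p.2 ∧
      p.1.length + p.2.length = n + 1) ∧ ∃ x ∈ p.2, A.flip x ∈ p.1},
      (c p.1.length * c p.2.length) • A.doubleTerm p.1 p.2 =
    ∑ᶠ p ∈ {p : List A.H × List A.H | (A.Admissible κ p.1 p.2 ∧
      p.1.length + p.2.length = n + 1) ∧ ∃ x ∈ p.2, x ∈ p.1},
      (c p.1.length * c p.2.length) • A.doubleTerm p.1 p.2 := by
  classical
  have hi := fun e : List A.H => (A.twist e.formPerm).flip_involutive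
  refine finsum_mem_eq_of_bijOn (fun p => (p.1, reversal (A.twist p.1.formPerm).flip p.2))
    (Set.InvOn.bijOn (f' := fun p => (p.1, reversal (A.twist p.1.formPerm).flip p.2))
      ⟨?_, ?_⟩ ?_ ?_) ?_
  · rintro ⟨e, f⟩ -
    exact Prod.ext rfl (reversal_reversal (hi e) f)
  · rintro ⟨e, f⟩ -
    exact Prod.ext rfl (reversal_reversal (hi e) f)
  · rintro ⟨e, f⟩ ⟨⟨h, hn⟩, x, hx, hxe⟩
    refine ⟨⟨h.reversal hκ, by rwa [length_reversal]⟩, (A.twist e.formPerm).flip x,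
      (mem_reversal (hi e)).2 (by rwa [hi e]), ?_⟩
    -- If `A.flip x` is in the first list, then the other half of the new side at `x` is the
    -- successor of `A.flip x`, again an entry of the first list. So reversal turns this case into
    -- the case of a shared entry; the converse below is similar.
    have h1 : e.formPerm.symm x = x := by
      rw [Equiv.symm_apply_eq, List.formPerm_apply_of_notMem fun hxe' =>
        h.flip_notMem_left hκ hxe' hxe]
    change e.formPerm (A.flip (e.formPerm.symm x)) ∈ e
    rw [h1]
    exact List.formPerm_apply_mem_of_mem hxe
  · rintro ⟨e, f⟩ ⟨⟨h, hn⟩, x, hx, hxe⟩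
    refine ⟨⟨h.reversal hκ, by rwa [length_reversal]⟩, (A.twist e.formPerm).flip x,
      (mem_reversal (hi e)).2 (by rwa [hi e]), ?_⟩
    have h1 : e.formPerm.symm x ∈ e := by
      rwa [← List.formPerm_mem_iff_mem, Equiv.apply_symm_apply]
    change A.flip (e.formPerm (A.flip (e.formPerm.symm x))) ∈ e
    rwa [List.formPerm_apply_of_notMem (h.flip_notMem_left hκ h1), A.flip_flip]
  · rintro ⟨e, f⟩ ⟨⟨h, hn⟩, -⟩
    change _ = (_ * c (reversal _ f).length) • A.doubleTerm e (reversal _ f)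
    rw [h.doubleTerm_reversal hκ, length_reversal]

end OGraph

/-! ### Pairs of fusions that share an edge -/

theorem List.exists_rotate_eq_cons {α : Type*} {l : List α} {j : ℕ} {a : α} (h : l[j]? = some a) :
    ∃ t, l.rotate j = a :: t := by
  obtain ⟨hj, rfl⟩ := List.getElem?_eq_some_iff.1 h
  rw [List.rotate_eq_drop_append_take hj.le, List.drop_eq_getElem_cons hj]
  exact ⟨_, rfl⟩

theorem List.exists_split {α : Type*} {l : List α} {m : ℕ} (h : m < l.length) :
    ∃ s x t, l = s ++ x :: t ∧ s.length = m :=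
  ⟨l.take m, l[m], l.drop (m + 1), by rw [List.getElem_cons_drop, List.take_append_drop],
    List.length_take_of_le h.le⟩

namespace OGraph

variable {k : Type u} [Field k] {O : CyclicOperad.{u, w} k}

theorem contract2Cls_self (A : OGraph O) (a : A.H) : A.contract2Cls a a = 0 :=
  dif_neg fun h => h.2.1 rfl

/-- Two lists of directed edges that share one edge `x`, encoded by their concatenation at `x`, the
position of `x` and the amounts of rotation. -/
def sharedPair {α : Type} (q : List α × ℕ × ℕ × ℕ) : List α × List α :=
  ((q.1.drop q.2.1).rotate q.2.2.1, ((q.1.take (q.2.1 + 1)).rotate q.2.1).rotate q.2.2.2)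

/-- The large polygon is cut at `x`: the first polygon consists of `x` and what follows, the second
one of `x` and what precedes. -/
theorem sharedPair_split {α : Type} (s t : List α) (x : α) (i r : ℕ) :
    sharedPair (s ++ x :: t, s.length, i, r) = ((x :: t).rotate i, (x :: s).rotate r) := by
  have h : (s ++ x :: t).take (s.length + 1) = s ++ [x] :=
    List.take_length_add_append 1
  rw [sharedPair]
  simp only [h]
  rw [List.rotate_append_length_eq s [x], List.drop_left]
  rfl

/-- The codes of pairs of lists that share an edge. -/
def sharedCodes {α : Type} (κ : α → ℕ) (n : ℕ) : Set (List α × ℕ × ℕ × ℕ) :=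
  {q | q.1.Nodup ∧ (∀ x ∈ q.1, ∀ y ∈ q.1, κ x = κ y → x = y) ∧ q.1.length = n ∧
    q.2.1 + q.2.2.1 + 1 < n ∧ q.2.2.2 ≤ q.2.1}

theorem finite_sharedCodes {α : Type} [Finite α] (κ : α → ℕ) (n : ℕ) :
    (sharedCodes κ n).Finite := by
  refine ((List.finite_length_eq α n).prod ((Set.finite_lt_nat n).prod
    ((Set.finite_lt_nat n).prod (Set.finite_lt_nat n)))).subset ?_
  rintro ⟨g, m, i, r⟩ ⟨-, -, h1, h2, h3⟩
  simp only at h2 h3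
  exact ⟨h1, show m < n by omega, show i < n by omega, show r < n by omega⟩

/-- The shared entry is the only common member of the two lists, and its position in each of them
determines the rotation. -/
theorem sharedPair_injOn {α : Type} (κ : α → ℕ) (n : ℕ) :
    Set.InjOn sharedPair (sharedCodes κ n) := by
  rintro ⟨g, m, i, r⟩ ⟨h1, h2, h3, h4, h5⟩ ⟨g', m', i', r'⟩ ⟨h1', h2', h3', h4', h5'⟩ h
  simp only at h1 h2 h3 h4 h5 h1' h2' h3' h4' h5'
  obtain ⟨s, x, t, rfl, rfl⟩ := List.exists_split (show m < g.length by omega)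
  obtain ⟨s', x', t', rfl, rfl⟩ := List.exists_split (show m' < g'.length by omega)
  rw [sharedPair_split, sharedPair_split, Prod.mk.injEq] at h
  rw [List.length_append, List.length_cons] at h3 h3'
  have hx : x = x' := by
    by_contra hne
    have e1 : x ∈ (x' :: t').rotate i' := h.1 ▸ List.mem_rotate.2 (by simp)
    have e2 : x ∈ (x' :: s').rotate r' := h.2 ▸ List.mem_rotate.2 (by simp)
    rw [List.mem_rotate, List.mem_cons] at e1 e2
    exact (List.nodup_append.1 h1').2.2 x (e2.resolve_left hne) x
      (List.mem_cons_of_mem _ (e1.resolve_left hne)) rfl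
  subst hx
  have hs := congrArg List.length h.1
  have ht := congrArg List.length h.2
  simp only [List.length_rotate, List.length_cons] at hs ht
  obtain ⟨rfl, rfl⟩ := List.Nodup.eq_of_rotate_eq (List.nodup_append.1 h1).2.1 (by omega) (by omega)
    h.1
  obtain ⟨rfl, rfl⟩ := List.Nodup.eq_of_rotate_eq
    (List.nodup_middle.1 h1).of_append_left (by omega) (by omega) h.2
  rfl

-- The product of the two cyclic permutations is the one of the concatenation, so the twice fused
-- graph is fused along one polygon. The first contracted side starts at the head of `a`, the first
-- entry of the first list. The second one starts at the head of `b`, the entry of the large polygon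
-- with index `r - 1` modulo `n`, where `r` is the rotation of the second list.
open Classical in
theorem doubleTerm_sharedPair (A : OGraph O) {κ : A.H → ℕ} (hκ : ∀ x, κ (A.flip x) = κ x) {n : ℕ}
    {q : List A.H × ℕ × ℕ × ℕ} (hq : q ∈ sharedCodes κ n) {a b : A.H}
    (ha : q.1[q.2.1 + q.2.2.1]? = some a) (hb : q.1[(q.2.2.2 + (n - 1)) % n]? = some b) :
    A.doubleTerm (sharedPair q).1 (sharedPair q).2 =
      (A.twist q.1.formPerm).contract2Cls (A.flip a) (A.flip b) := by
  obtain ⟨g, m, i, r⟩ := q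
  obtain ⟨h1, h2, rfl, h4, h5⟩ := hq
  simp only at h1 h2 h4 h5 ha hb
  obtain ⟨s, x, t, rfl, rfl⟩ := List.exists_split (show m < g.length by omega)
  have hfl : ∀ y ∈ s ++ x :: t, A.flip y ∉ x :: t := fun y hy hy' =>
    A.flip_ne y (h2 _ (List.mem_append_right _ hy') _ hy (hκ y))
  rw [sharedPair_split]
  have ha' : (x :: t)[i]? = some a := by
    rw [List.getElem?_append_right (by omega)] at ha
    simpa using ha
  obtain ⟨l, hl⟩ := List.exists_rotate_eq_cons ha'
  obtain ⟨y, hy⟩ : ∃ y, (x :: s)[r]? = some y := ⟨_, List.getElem?_eq_getElem (by simp; omega)⟩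
  obtain ⟨l', hl'⟩ := List.exists_rotate_eq_cons hy
  have hnt : (x :: t).Nodup := (List.nodup_append.1 h1).2.1
  have hns : (s ++ [x]).Nodup := (List.nodup_append.1 (show (s ++ ([x] ++ t)).Nodup from h1)).1 |>.append
    (by simp) (by
      intro z hz hz'
      rw [List.mem_singleton] at hz'
      subst hz'
      exact (List.nodup_append.1 h1).2.2 z hz z (by simp) rfl)
  have e1 : (a :: l).formPerm = (x :: t).formPerm := by rw [← hl, List.formPerm_rotate _ hnt]
  have e2 : (y :: l').formPerm = (s ++ [x]).formPerm := by
    have : x :: s = (s ++ [x]).rotate s.length := by rw [List.rotate_append_length_eq]; rfl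
    rw [← hl', this, List.rotate_rotate, List.formPerm_rotate _ hns]
  have e3 : (s ++ x :: t).formPerm = (y :: l').formPerm * (a :: l).formPerm := by
    rw [e1, e2, List.formPerm_append_cons]
  have e4 : (a :: l).formPerm (A.flip ((a :: l).formPerm.symm y)) = A.flip b := by
    rw [e1]
    have hbm : b ∈ s ++ x :: t := List.mem_of_getElem? hb
    -- If `r = 0`, then `y` is the shared entry, and its predecessor in the first polygon is the
    -- last entry of the whole list. Otherwise `y` lies in `s` and is fixed by the first
    -- permutation, so `y` itself is `b`.
    have hsy : (x :: t).formPerm.symm y = b := by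
      rw [Equiv.symm_apply_eq]
      simp only [List.length_append, List.length_cons] at hb
      cases r with
      | zero =>
        have hyx : x = y := by simpa using hy
        subst hyx
        have : (0 + (s.length + (t.length + 1) - 1)) % (s.length + (t.length + 1)) =
            s.length + t.length := by rw [Nat.mod_eq_of_lt (by omega)]; omega
        rw [this, List.getElem?_append_right (by omega)] at hb
        have hbl : (x :: t).getLast (by simp) = b := by
          rw [List.getLast_eq_getElem]
          rw [List.getElem?_eq_some_iff] at hb
          obtain ⟨_, rfl⟩ := hb
          simp
        rw [← hbl, List.formPerm_apply_getLast]
      | succ r =>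
        have : (r + 1 + (s.length + (t.length + 1) - 1)) % (s.length + (t.length + 1)) = r := by
          rw [show r + 1 + (s.length + (t.length + 1) - 1) = r + (s.length + (t.length + 1)) by omega,
            Nat.add_mod_right, Nat.mod_eq_of_lt (by omega)]
        rw [this, List.getElem?_append_left (by omega)] at hb
        have hby : b = y := by
          rw [List.getElem?_cons_succ, hb] at hy
          exact Option.some.inj hy
        subst hby
        rw [List.formPerm_apply_of_notMem]
        exact fun hm => (List.nodup_append.1 h1).2.2 _ (List.mem_of_getElem? hb) _ hm rfl
    rw [hsy, List.formPerm_apply_of_notMem (hfl b hbm)]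
  simp only [hl, hl']
  change _ = (A.twist (s ++ x :: t).formPerm).contract2Cls _ _
  rw [e3, ← e4]
  rfl

theorem sharedPair_bijOn (A : OGraph O) {κ : A.H → ℕ} (hκ : ∀ x, κ (A.flip x) = κ x) (n : ℕ) :
    Set.BijOn sharedPair (sharedCodes κ n) {p : List A.H × List A.H | (A.Admissible κ p.1 p.2 ∧
      p.1.length + p.2.length = n + 1) ∧ ∃ x ∈ p.2, x ∈ p.1} := by
  classical
  refine ⟨?_, sharedPair_injOn κ n, ?_⟩
  · rintro ⟨g, m, i, r⟩ ⟨h1, h2, rfl, h4, h5⟩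
    simp only at h1 h2 h4 h5
    obtain ⟨s, x, t, rfl, rfl⟩ := List.exists_split (show m < g.length by omega)
    rw [List.length_append, List.length_cons] at h4
    rw [sharedPair_split]
    have hnt : (x :: t).Nodup := (List.nodup_append.1 h1).2.1
    have hns : (x :: s).Nodup := (List.nodup_middle.1 h1).of_append_left
    have hst : ∀ y ∈ x :: s, y ∉ t := fun y hy hyt =>
      (List.nodup_append.1 (show ((x :: s) ++ t).Nodup from List.nodup_middle.1 h1)).2.2 y hy y hyt
        rfl
    have hmt : ∀ {y}, y ∈ x :: t → y ∈ s ++ x :: t := List.mem_append_right _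
    have hms : ∀ {y}, y ∈ x :: s → y ∈ s ++ x :: t := fun {y} hy => by
      rw [List.mem_append, List.mem_cons]
      rw [List.mem_cons] at hy
      tauto
    refine ⟨⟨⟨List.nodup_rotate.2 hnt, ?_, List.nodup_rotate.2 hns, ?_, ?_, ?_, ?_⟩, ?_⟩,
      x, List.mem_rotate.2 (by simp), List.mem_rotate.2 (by simp)⟩
    · intro y hy z hz e
      exact h2 _ (hmt (List.mem_rotate.1 hy)) _ (hmt (List.mem_rotate.1 hz)) e
    · intro y hy z hz e
      exact h2 _ (hms (List.mem_rotate.1 hy)) _ (hms (List.mem_rotate.1 hz)) e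
    -- Colours are injective on the whole list, so only the shared entry of the second list has a
    -- merged colour.
    · have key : ∀ y ∈ (x :: s).rotate r, κ y ∈ ((x :: t).rotate i).map κ → y = x := by
        intro y hy hye
        obtain ⟨z, hz, e⟩ := List.mem_map.1 hye
        rw [List.mem_rotate] at hy hz
        have hzy := h2 _ (hmt hz) _ (hms hy) e
        subst hzy
        exact (List.mem_cons.1 hz).resolve_right (hst z hy)
      intro y hy z hz hye hze
      rw [key y hy hye, key z hz hze]
    · intro h0
      simpa using congrArg List.length h0
    · have hi : i + 1 < (x :: t).length := by rw [List.length_cons]; omega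
      obtain ⟨l, hl⟩ := List.exists_rotate_eq_cons
        (List.getElem?_eq_getElem (show i < (x :: t).length by omega))
      refine ⟨_, l, hl, fun h => ?_, fun h => ?_⟩
      · have h6 := hmt (List.getElem_mem (show i < (x :: t).length by omega))
        exact A.flip_ne _ (h2 _ (hms (List.mem_rotate.1 h)) _ h6 (hκ _))
      · rw [List.formPerm_rotate _ hnt, List.formPerm_apply_lt_getElem _ hnt _ hi,
          List.mem_rotate] at h
        refine hst _ h ?_
        rw [List.getElem_cons_succ]
        exact List.getElem_mem _
    · simp only [List.length_rotate, List.length_cons, List.length_append]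
      omega
  · rintro ⟨e, f⟩ ⟨⟨h, hn⟩, x, hxf, hxe⟩
    obtain ⟨t, i, hi, he⟩ := List.exists_eq_rotate_cons hxe
    obtain ⟨s, r, hr, hf⟩ := List.exists_eq_rotate_cons hxf
    simp only at he hf hi hr hn h
    have hnt : (x :: t).Nodup := by rw [← List.nodup_rotate (n := i), ← he]; exact h.nodup_left
    have hns : (x :: s).Nodup := by rw [← List.nodup_rotate (n := r), ← hf]; exact h.nodup_right
    have hme : ∀ {y}, y ∈ e ↔ y ∈ x :: t := by rw [he]; exact List.mem_rotate
    have hmf : ∀ {y}, y ∈ f ↔ y ∈ x :: s := by rw [hf]; exact List.mem_rotate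
    have hle : e.length = t.length + 1 := by rw [he]; simp
    have hlf : f.length = s.length + 1 := by rw [hf]; simp
    -- The second list may use the merged graph only once, and the shared entry already does.
    have hst : ∀ y ∈ s, ∀ z ∈ x :: t, κ y ≠ κ z := by
      intro y hy z hz hyz
      have : y = x := h.inj_merged _ (hmf.2 (List.mem_cons_of_mem _ hy)) _ hxf
        (hyz ▸ List.mem_map_of_mem (hme.2 hz)) (List.mem_map_of_mem hxe)
      subst this
      exact (List.nodup_cons.1 hns).1 hy
    -- For this rotation the first list would start with the predecessor of `x`, and the first
    -- contracted edge would contain `x`, which the second list uses. This excluded value accounts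
    -- for the strict bound in `sharedCodes`.
    have hi' : i ≠ t.length := by
      rintro rfl
      obtain ⟨a, l, hal, -, h3⟩ := h.avoid
      have hlast : (x :: t)[t.length]? = some ((x :: t).getLast (by simp)) := by
        rw [List.getLast_eq_getElem, List.getElem?_eq_getElem (by simp)]
        simp
      obtain ⟨l', hl'⟩ := List.exists_rotate_eq_cons hlast
      rw [← he, hal, List.cons.injEq] at hl'
      rw [hl'.1, he, List.formPerm_rotate _ hnt, List.formPerm_apply_getLast] at h3
      exact h3 (hf ▸ hxf)
    refine ⟨(s ++ x :: t, s.length, i, r), ⟨?_, ?_, ?_, ?_, ?_⟩, ?_⟩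
    · exact (List.nodup_append.2 ⟨(List.nodup_cons.1 hns).2, hnt, fun y hy z hz e =>
        hst y hy z hz (by rw [e])⟩)
    · intro y hy z hz e
      rw [List.mem_append] at hy hz
      rcases hy with hy | hy <;> rcases hz with hz | hz
      · exact h.inj_right _ (hmf.2 (List.mem_cons_of_mem _ hy)) _
          (hmf.2 (List.mem_cons_of_mem _ hz)) e
      · exact absurd e (hst y hy z hz)
      · exact absurd e.symm (hst z hz y hy)
      · exact h.inj_left _ (hme.2 hy) _ (hme.2 hz) e
    · simp only [List.length_append, List.length_cons]
      omega
    · change s.length + i + 1 < n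
      omega
    · change r ≤ s.length
      omega
    · rw [sharedPair_split, ← he, ← hf]

/-- The terms in which the two fusions share an edge cancel in pairs. -/
theorem sum_doubleTerm_shared (A : OGraph O) (κ : A.H → ℕ) (hκ : ∀ x, κ (A.flip x) = κ x)
    (c : ℕ → k) (n : ℕ) :
    ∑ᶠ p ∈ {p : List A.H × List A.H | (A.Admissible κ p.1 p.2 ∧
      p.1.length + p.2.length = n + 1) ∧ ∃ x ∈ p.2, x ∈ p.1},
      (c p.1.length * c p.2.length) • A.doubleTerm p.1 p.2 = 0 := by
  classical
  rw [← finsum_mem_eq_of_bijOn sharedPair (sharedPair_bijOn A hκ n) (fun _ _ => rfl)]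
  -- The contracted sides sit at the cyclic indices `m + i` and `r - 1`. As `i` and `r` vary, these
  -- run through complementary arcs of lengths `n - m - 1` and `m + 1`. The rotation by `i + r + 1`
  -- together with the reflected parameters interchanges the two sides; keeping `m` keeps the
  -- lengths of both lists, hence the weight.
  set σ : List A.H × ℕ × ℕ × ℕ → List A.H × ℕ × ℕ × ℕ := fun q =>
    (q.1.rotate (q.2.2.1 + q.2.2.2 + 1), q.2.1, n - q.2.1 - 2 - q.2.2.1, q.2.1 - q.2.2.2) with hσ
  have hmem : ∀ q ∈ sharedCodes κ n, σ q ∈ sharedCodes κ n := by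
    rintro ⟨g, m, i, r⟩ ⟨h1, h2, h3, h4, h5⟩
    simp only at h1 h2 h3 h4 h5
    refine ⟨List.nodup_rotate.2 h1, fun x hx y hy => h2 x (List.mem_rotate.1 hx) y
      (List.mem_rotate.1 hy), by simpa [hσ] using h3, ?_, Nat.sub_le _ _⟩
    change m + (n - m - 2 - i) + 1 < n
    omega
  have hab : ∀ q ∈ sharedCodes κ n, ∃ a b, q.1[q.2.1 + q.2.2.1]? = some a ∧
      q.1[(q.2.2.2 + (n - 1)) % n]? = some b ∧
      (σ q).1[(σ q).2.1 + (σ q).2.2.1]? = some b ∧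
      (σ q).1[((σ q).2.2.2 + (n - 1)) % n]? = some a := by
    rintro ⟨g, m, i, r⟩ ⟨h1, h2, rfl, h4, h5⟩
    simp only at h1 h2 h4 h5
    have hm : (r + (g.length - 1)) % g.length < g.length := Nat.mod_lt _ (by omega)
    refine ⟨g[m + i], g[(r + (g.length - 1)) % g.length], List.getElem?_eq_getElem _,
      List.getElem?_eq_getElem _, ?_, ?_⟩
    · change (g.rotate (i + r + 1))[m + (g.length - m - 2 - i)]? = _
      rw [List.getElem?_rotate (by omega), ← List.getElem?_eq_getElem hm]
      congr 2
      omega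
    · change (g.rotate (i + r + 1))[(m - r + (g.length - 1)) % g.length]? = _
      rw [List.getElem?_rotate (Nat.mod_lt _ (by omega)), Nat.mod_add_mod,
        show m - r + (g.length - 1) + (i + r + 1) = m + i + g.length by omega, Nat.add_mod_right,
        Nat.mod_eq_of_lt (by omega), List.getElem?_eq_getElem]
  refine finsum_mem_involution (finite_sharedCodes κ n) _ σ hmem ?_ ?_ ?_
  · rintro ⟨g, m, i, r⟩ ⟨h1, h2, rfl, h4, h5⟩
    simp only at h1 h2 h4 h5
    simp only [hσ]
    rw [List.rotate_rotate, show i + r + 1 + (g.length - m - 2 - i + (m - r) + 1) = g.length by omega,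
      List.rotate_length, show g.length - m - 2 - (g.length - m - 2 - i) = i by omega,
      show m - (m - r) = r by omega]
  · intro q hq
    obtain ⟨a, b, h1, h2, h3, h4⟩ := hab q hq
    rw [doubleTerm_sharedPair A hκ hq h1 h2, doubleTerm_sharedPair A hκ (hmem q hq) h3 h4]
    have e1 : (σ q).1.formPerm = q.1.formPerm := List.formPerm_rotate _ hq.1 _
    have e2 : (sharedPair (σ q)).1.length = (sharedPair q).1.length := by
      simp [sharedPair, hσ]
    have e3 : (sharedPair (σ q)).2.length = (sharedPair q).2.length := by
      simp [sharedPair, hσ]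
    rw [e1, e2, e3, contract2Cls_swap, smul_neg, neg_add_cancel]
  -- A fixed code would contract the same edge twice, which gives zero.
  · intro q hq he
    obtain ⟨a, b, h1, h2, h3, h4⟩ := hab q hq
    rw [he, h1, Option.some.injEq] at h3
    rw [doubleTerm_sharedPair A hκ hq h1 h2, h3, contract2Cls_self, smul_zero]

/-- An admissible second list uses at most one half-edge of merged colour. Either that half-edge or
its opposite belongs to the first list, or the lists are independent; each of the three parts sums
to zero. -/
theorem sum_doubleTerm_eq_zero (A : OGraph O) (κ : A.H → ℕ) (hκ : ∀ x, κ (A.flip x) = κ x)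
    (c : ℕ → k) (n : ℕ) :
    ∑ᶠ p ∈ {p : List A.H × List A.H | A.Admissible κ p.1 p.2 ∧ p.1.length + p.2.length = n + 1},
      (c p.1.length * c p.2.length) • A.doubleTerm p.1 p.2 = 0 := by
  have hfin := A.finite_admissible κ n
  set S := {p : List A.H × List A.H | A.Admissible κ p.1 p.2 ∧ p.1.length + p.2.length = n + 1}
  have h1 := A.sum_doubleTerm_disjoint κ c n
  have h2 := A.sum_doubleTerm_shared κ hκ c n
  have h3 := A.sum_doubleTerm_reversed κ hκ c n
  rw [h2] at h3
  have hS : S = {p | p ∈ S ∧ ∀ x ∈ p.2, x ∉ p.1 ∧ A.flip x ∉ p.1} ∪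
      ({p | p ∈ S ∧ ∃ x ∈ p.2, x ∈ p.1} ∪ {p | p ∈ S ∧ ∃ x ∈ p.2, A.flip x ∈ p.1}) := by
    ext p
    simp only [Set.mem_union, Set.mem_ofPred_eq]
    constructor
    · intro hp
      by_cases h4 : ∃ x ∈ p.2, x ∈ p.1
      · exact Or.inr (Or.inl ⟨hp, h4⟩)
      by_cases h5 : ∃ x ∈ p.2, A.flip x ∈ p.1
      · exact Or.inr (Or.inr ⟨hp, h5⟩)
      · push Not at h4 h5
        exact Or.inl ⟨hp, fun x hx => ⟨h4 x hx, h5 x hx⟩⟩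
    · rintro (h | h | h) <;> exact h.1
  rw [hS, finsum_mem_union, finsum_mem_union]
  · refine (congrArg₂ _ h1 (congrArg₂ _ h2 h3)).trans ?_
    rw [add_zero, add_zero]
  · rw [Set.disjoint_left]
    rintro p ⟨hp, x, hx, hx'⟩ ⟨-, y, hy, hy'⟩
    -- Both half-edges have merged colours, so they coincide; but a half-edge and its opposite have
    -- the same colour and cannot both occur in the first list.
    have : x = y := hp.1.inj_merged _ hx _ hy (List.mem_map_of_mem hx')
      (by rw [← hκ]; exact List.mem_map_of_mem hy')
    subst this
    exact hp.1.flip_notMem_left hκ hx' hy'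
  · exact hfin.subset fun p hp => hp.1
  · exact hfin.subset fun p hp => hp.1
  · rw [Set.disjoint_left]
    rintro p ⟨hp, h⟩ (⟨-, x, hx, hx'⟩ | ⟨-, x, hx, hx'⟩)
    · exact (h x hx).1 hx'
    · exact (h x hx).2 hx'
  · exact hfin.subset fun p hp => hp.1
  · exact (hfin.subset fun p hp => hp.1).union (hfin.subset fun p hp => hp.1)

end OGraph

namespace OGraph

variable {k : Type u} [Field k] {O : CyclicOperad.{u, w} k}

/-! ### Fusion after a contraction -/

theorem twist_flip_fixed (A : OGraph O) (c : Equiv.Perm A.H) {a : A.H} (h : c a = a)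
    (h' : c (A.flip a) = A.flip a) : (A.twist c).flip a = A.flip a := by
  have hs : c.symm a = a := by rw [Equiv.symm_apply_eq, h]
  change c (A.flip (c.symm a)) = _
  rw [hs, h']

theorem contractSign_twist (A : OGraph O) (c : Equiv.Perm A.H) {a : A.H} (h : c a = a)
    (h' : c (A.flip a) = A.flip a) : (A.twist c).contractSign a = A.contractSign a := by
  have hs : c.symm a = a := by rw [Equiv.symm_apply_eq, h]
  have hd : a ∈ (A.twist c).dir ↔ a ∈ A.dir := by
    change c.symm a ∈ A.dir ↔ _
    rw [hs]
  rw [contractSign, contractSign, A.twist_flip_fixed c h h', hd]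

/-- The half-edges that survive a contraction. -/
def uncontract (A : OGraph O) {a : A.H} (ha : A.vert a ≠ A.vert (A.flip a))
    (x : (A.contract a ha).H) : A.H := x.1

theorem uncontract_injective (A : OGraph O) {a : A.H} (ha : A.vert a ≠ A.vert (A.flip a)) :
    Function.Injective (A.uncontract ha) := fun _ _ => Subtype.ext

/-- A list in the contracted graph avoids both halves of `a`, so its cyclic permutation fixes them.
Hence fusion commutes with the contraction, and both contractions can be carried out at the end. -/
theorem contractSign_smul_fusionTerm (A : OGraph O) (a : A.H) (ha : A.vert a ≠ A.vert (A.flip a))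
    (l : List (A.contract a ha).H) : A.contractSign a • (A.contract a ha).fusionTerm l =
      A.contractFusionTerm a (l.map (A.uncontract ha)) := by
  classical
  cases l with
  | nil => exact smul_zero _
  | cons y l =>
    have h1 : ((y :: l).map (A.uncontract ha)).formPerm a = a :=
      List.formPerm_apply_of_notMem fun h => by
        obtain ⟨z, -, hz⟩ := List.mem_map.1 h
        exact z.2.1 hz
    have h2 : ((y :: l).map (A.uncontract ha)).formPerm (A.flip a) = A.flip a :=
      List.formPerm_apply_of_notMem fun h => by
        obtain ⟨z, -, hz⟩ := List.mem_map.1 h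
        exact z.2.2 hz
    have hf := A.twist_flip_fixed _ h1 h2
    have ha' : (A.twist ((y :: l).map (A.uncontract ha)).formPerm).vert a ≠
        (A.twist ((y :: l).map (A.uncontract ha)).formPerm).vert
          ((A.twist ((y :: l).map (A.uncontract ha)).formPerm).flip a) := by
      rw [hf]; exact ha
    have hab : A.flip y.1 ≠ a ∧
        A.flip y.1 ≠ (A.twist ((y :: l).map (A.uncontract ha)).formPerm).flip a := by
      rw [hf]
      exact ((A.contract a ha).flip y).2
    have h3 : A.contractFusionTerm a ((y :: l).map (A.uncontract ha)) = _ :=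
      contract2Cls_of_ne (A.twist ((y :: l).map (A.uncontract ha)).formPerm) ha' hab
    rw [h3, contractSign_twist A _ h1 h2]
    congr 1
    have h4 := (A.contractTwistIso a ha (y :: l).formPerm ((y :: l).map (A.uncontract ha)).formPerm
      (fun x => List.formPerm_map_apply _ (A.uncontract_injective ha) _ x) h1 h2 ha').contractCls_eq
      ((A.contract a ha).flip y) _ rfl
    refine (h4.trans ((congrArg (fun t : k => t • _) (contractTwistIso_sign A a ha _ _ _ h1 h2
      ha')).trans (one_smul k _))).symm

theorem contractFusionTerm_loop (A : OGraph O) {a : A.H} (ha : A.vert a = A.vert (A.flip a))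
    {l : List A.H} (h : a ∉ l) (h' : A.flip a ∉ l) : A.contractFusionTerm a l = 0 := by
  classical
  cases l with
  | nil => rfl
  | cons y l =>
    refine contract2Cls_of_eq_left (A.twist (y :: l).formPerm) ?_
    rw [A.twist_flip_fixed _ (List.formPerm_apply_of_notMem h) (List.formPerm_apply_of_notMem h')]
    exact ha

/-- The sum of the contributions of lists of `n` directed edges of different colours to the fusion
after the contraction of `a`. -/
noncomputable def contractFusionSum (A : OGraph O) (a : A.H) {C : Type} (κ : A.H → C) (n : ℕ) :
    GraphComplex O :=
  ∑ᶠ l ∈ {l : List A.H | (l.length = n ∧ (l.map κ).Nodup) ∧ a ∉ l ∧ A.flip a ∉ l},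
    A.contractFusionTerm a l

theorem contractFusionSum_loop (A : OGraph O) {a : A.H} (ha : A.vert a = A.vert (A.flip a))
    {C : Type} (κ : A.H → C) (n : ℕ) : A.contractFusionSum a κ n = 0 :=
  finsum_mem_eq_zero_of_forall_eq_zero fun _ hl => contractFusionTerm_loop A ha hl.2.1 hl.2.2

theorem contractSign_smul_fusionSum (A : OGraph O) (a : A.H) (ha : A.vert a ≠ A.vert (A.flip a))
    {C : Type} (κ : A.H → C) (n : ℕ) :
    A.contractSign a • (A.contract a ha).fusionSum (fun x => κ (A.uncontract ha x)) n =
      A.contractFusionSum a κ n := by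
  rw [fusionSum, smul_finsum_mem (finite_lists _ n), contractFusionSum]
  refine finsum_mem_eq_of_bijOn (List.map (A.uncontract ha)) ⟨?_, ?_, ?_⟩
    fun l _ => A.contractSign_smul_fusionTerm a ha l
  · rintro l ⟨h1, h2⟩
    refine ⟨⟨by rw [List.length_map, h1], by rw [List.map_map]; exact h2⟩, fun h => ?_, fun h => ?_⟩
    · obtain ⟨z, -, hz⟩ := List.mem_map.1 h
      exact z.2.1 hz
    · obtain ⟨z, -, hz⟩ := List.mem_map.1 h
      exact z.2.2 hz
  · exact (List.map_injective_iff.2 (A.uncontract_injective ha)).injOn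
  · rintro l ⟨⟨h1, h2⟩, h3, h4⟩
    set l' : List (A.contract a ha).H := l.attach.map fun x => (⟨x.1, fun h => h3 (h ▸ x.2), fun h => h4 (h ▸ x.2)⟩ :
        (A.contract a ha).H)
    have e : l'.map (A.uncontract ha) = l := by
      refine List.map_map.trans ?_
      exact List.attach_map_subtype_val l
    refine ⟨l', ⟨?_, ?_⟩, e⟩
    · rw [← h1, ← e, List.length_map]
    · rw [← e, List.map_map] at h2
      exact h2

theorem Iso.contractFusionTerm_eq {A B : OGraph O} (f : Iso A B) (a : A.H) (l : List A.H) :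
    B.contractFusionTerm (f.onH a) (l.map f.onH) = f.sign • A.contractFusionTerm a l := by
  classical
  cases l with
  | nil => exact (smul_zero _).symm
  | cons x l =>
    have h := (f.twist (x :: l).formPerm ((x :: l).map f.onH).formPerm
        (fun y => List.formPerm_map_apply _ f.onH.injective _ y)).contract2Cls_eq a (A.flip x)
    rw [f.twist_sign] at h
    refine Eq.trans ?_ h
    exact congrArg (fun t => (B.twist ((x :: l).map f.onH).formPerm).contract2Cls (f.onH a) t)
      (f.flip_onH x)

theorem Iso.doubleTerm_eq {A B : OGraph O} (f : Iso A B) (e l : List A.H) :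
    B.doubleTerm (e.map f.onH) (l.map f.onH) = f.sign • A.doubleTerm e l := by
  classical
  cases e with
  | nil => exact (smul_zero _).symm
  | cons x e =>
    have h := (f.twist (x :: e).formPerm ((x :: e).map f.onH).formPerm
        (fun y => List.formPerm_map_apply _ f.onH.injective _ y)).contractFusionTerm_eq (A.flip x) l
    rw [f.twist_sign] at h
    refine Eq.trans ?_ h
    exact congrArg (fun t => (B.twist ((x :: e).map f.onH).formPerm).contractFusionTerm t
      (l.map f.onH)) (f.flip_onH x)

theorem Iso.admissible {A B : OGraph O} (f : Iso A B) {κ : A.H → ℕ} {μ : B.H → ℕ}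
    (h : ∀ x, μ (f.onH x) = κ x) {e l : List A.H} (ha : A.Admissible κ e l) :
    B.Admissible μ (e.map f.onH) (l.map f.onH) := by
  classical
  have hm : (e.map f.onH).map μ = e.map κ := by
    rw [List.map_map]
    exact List.map_congr_left fun x _ => h x
  have hmem : ∀ {x : A.H} {l : List A.H}, f.onH x ∈ l.map f.onH ↔ x ∈ l :=
    List.mem_map_of_injective f.onH.injective
  have hall : ∀ {l : List A.H} {p : B.H → Prop}, (∀ y ∈ l.map f.onH, p y) ↔
      ∀ x ∈ l, p (f.onH x) := List.forall_mem_map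
  refine ⟨ha.nodup_left.map f.onH.injective, ?_, ha.nodup_right.map f.onH.injective, ?_, ?_, ?_, ?_⟩
  · simp only [hall, h, f.onH.apply_eq_iff_eq]
    exact ha.inj_left
  · simp only [hall, h, f.onH.apply_eq_iff_eq]
    exact ha.inj_right
  · simp only [hall, hm, h, f.onH.apply_eq_iff_eq]
    exact ha.inj_merged
  · exact fun h0 => ha.ne_right (List.map_eq_nil_iff.1 h0)
  · obtain ⟨x, t, rfl, h1, h2⟩ := ha.avoid
    refine ⟨f.onH x, t.map f.onH, List.map_cons, ?_, ?_⟩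
    · rwa [f.flip_onH, hmem]
    · rwa [List.formPerm_map_apply _ f.onH.injective, hmem]

/-- The part of the iterated fusion in which the colours of the first list are the elements of `I`,
weighted by the numbers of arguments. -/
noncomputable def iteratedFusion (c : ℕ → k) (n : ℕ) (A : OGraph O) (κ : A.H → ℕ) (I : Finset ℕ) :
    GraphComplex O :=
  ∑ᶠ p ∈ {p : List A.H × List A.H | (A.Admissible κ p.1 p.2 ∧ p.1.length + p.2.length = n + 1) ∧
      (p.1.map κ).toFinset = I},
    (c p.1.length * c p.2.length) • A.doubleTerm p.1 p.2

theorem Iso.iteratedFusion_eq {A B : OGraph O} (f : Iso A B) {κ : A.H → ℕ} {μ : B.H → ℕ}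
    (h : ∀ x, μ (f.onH x) = κ x) (c : ℕ → k) (n : ℕ) (I : Finset ℕ) :
    B.iteratedFusion c n μ I = f.sign • A.iteratedFusion c n κ I := by
  have hm : ∀ e : List A.H, (e.map f.onH).map μ = e.map κ := fun e => by
    rw [List.map_map]
    exact List.map_congr_left fun x _ => h x
  have h' : ∀ x, κ (f.symm.onH x) = μ x := fun x => by
    rw [← h]
    exact congrArg μ (f.onH.apply_symm_apply x)
  have hm' : ∀ e : List B.H, (e.map f.symm.onH).map κ = e.map μ := fun e => by
    rw [List.map_map]
    exact List.map_congr_left fun x _ => h' x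
  have e1 : ∀ l : List A.H, (l.map f.onH).map f.symm.onH = l := fun l => by
    rw [List.map_map]
    exact (List.map_congr_left fun x _ => f.onH.symm_apply_apply x).trans (List.map_id l)
  have e2 : ∀ l : List B.H, (l.map f.symm.onH).map f.onH = l := fun l => by
    rw [List.map_map]
    exact (List.map_congr_left fun x _ => f.onH.apply_symm_apply x).trans (List.map_id l)
  rw [iteratedFusion, iteratedFusion, smul_finsum_mem ((A.finite_admissible κ n).subset
    fun _ hp => hp.1)]
  refine (finsum_mem_eq_of_bijOn (fun p => (p.1.map f.onH, p.2.map f.onH)) (Set.InvOn.bijOn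
    (f' := fun p => (p.1.map f.symm.onH, p.2.map f.symm.onH)) ⟨?_, ?_⟩ ?_ ?_) ?_).symm
  · rintro ⟨e, l⟩ -
    exact Prod.ext (e1 e) (e1 l)
  · rintro ⟨e, l⟩ -
    exact Prod.ext (e2 e) (e2 l)
  · rintro ⟨e, l⟩ ⟨⟨h1, h2⟩, h3⟩
    exact ⟨⟨f.admissible h h1, by simpa using h2⟩, by simpa only [hm] using h3⟩
  · rintro ⟨e, l⟩ ⟨⟨h1, h2⟩, h3⟩
    exact ⟨⟨f.symm.admissible h' h1, by simpa using h2⟩, by simpa only [hm'] using h3⟩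
  · rintro ⟨e, l⟩ -
    change f.sign • _ = (c (e.map f.onH).length * c (l.map f.onH).length) •
      B.doubleTerm (e.map f.onH) (l.map f.onH)
    rw [f.doubleTerm_eq, List.length_map, List.length_map, smul_comm]

/-- The admissible pairs are grouped by the set of colours of the first list. -/
theorem sum_iteratedFusion (c : ℕ → k) (n : ℕ) (A : OGraph O) (κ : A.H → ℕ)
    (hκ : ∀ x, κ (A.flip x) = κ x) (s : Finset ℕ) (hs : ∀ x, κ x ∈ s) :
    ∑ I ∈ s.powerset, A.iteratedFusion c n κ I = 0 := by
  classical
  have hfin := A.finite_admissible κ n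
  rw [← A.sum_doubleTerm_eq_zero κ hκ c n, finsum_mem_eq_finite_toFinset_sum _ hfin,
    ← Finset.sum_fiberwise_of_maps_to (t := s.powerset) (g := fun p : List A.H × List A.H => (p.1.map κ).toFinset)]
  · refine Finset.sum_congr rfl fun I _ => ?_
    rw [iteratedFusion, ← finsum_mem_coe_finset]
    congr! 3
    simp
  · intro p _
    rw [Finset.mem_powerset]
    intro i hi
    rw [List.mem_toFinset, List.mem_map] at hi
    obtain ⟨x, -, rfl⟩ := hi
    exact hs x

end OGraph

/-! ### Colourings of disjoint unions -/

namespace OGraph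

variable {k : Type u} [Field k] {O : CyclicOperad.{u, w} k}

/-- The inclusion of the half-edges of the first summand. -/
def inlHalf (A B : OGraph O) : A.H → (A.sum B).H := Sum.inl

theorem inlHalf_injective (A B : OGraph O) : Function.Injective (inlHalf A B) := Sum.inl_injective

-- Fusing inside the first summand is fusing the disjoint union along the image of the list: its
-- cyclic permutation is the identity on the second summand.
open Classical in
theorem contractFusionTerm_twist_sum (A B : OGraph O) (x : A.H) (l : List A.H)
    (f : List (A.H ⊕ B.H)) :
    ((A.twist (x :: l).formPerm).sum B).contractFusionTerm (Sum.inl (A.flip x)) f =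
      (A.sum B).doubleTerm ((x :: l).map (inlHalf A B)) f := by
  have h := (twistSumIso A B (x :: l).formPerm).contractFusionTerm_eq (Sum.inl (A.flip x)) f
  rw [twistSumIso_sign, one_smul] at h
  have h' : ((A.sum B).twist (Equiv.sumCongr (x :: l).formPerm (Equiv.refl B.H))).contractFusionTerm
      (Sum.inl (A.flip x)) f = _ := Eq.trans (congrArg _ (List.map_id f).symm) h
  have hp : (Equiv.sumCongr (x :: l).formPerm (Equiv.refl B.H) : Equiv.Perm (A.sum B).H) =
      @List.formPerm (A.sum B).H (fun _ _ => Classical.propDecidable _) ((x :: l).map Sum.inl) := by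
    refine Equiv.ext fun y => ?_
    rcases y with y | y
    · exact (List.formPerm_map_apply (Sum.inl : A.H → (A.sum B).H) Sum.inl_injective _ y).symm
    · refine (@List.formPerm_apply_of_notMem (A.sum B).H (fun _ _ => Classical.propDecidable _) _ _
        fun hy => ?_).symm
      obtain ⟨z, -, hz⟩ := List.mem_map.1 hy
      exact Sum.inl_ne_inr hz
  exact h'.symm.trans
    (congrArg (fun d => ((A.sum B).twist d).contractFusionTerm (Sum.inl (A.flip x)) f) hp)

theorem colour_flip (w : List (OGraph O)) (x : (union w).H) :
    colour w ((union w).flip x) = colour w x := by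
  induction w with
  | nil => exact x.elim
  | cons A w ih =>
    rcases x with x | x
    · rfl
    · exact congrArg (· + 1) (ih x)

/-- The colouring of the half-edges of a disjoint union of coloured graphs. -/
def letterColour : (w : List (OGraph O × ℕ)) → (union (w.map Prod.fst)).H → ℕ
  | [] => fun _ => 0
  | x :: w => Sum.elim (fun _ => x.2) (letterColour w)

theorem letterColour_flip (w : List (OGraph O × ℕ)) (x : (union (w.map Prod.fst)).H) :
    letterColour w ((union (w.map Prod.fst)).flip x) = letterColour w x := by
  induction w with
  | nil => exact x.elim
  | cons A w ih =>
    rcases x with x | x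
    · rfl
    · exact ih x

theorem letterColour_mem (w : List (OGraph O × ℕ)) (x : (union (w.map Prod.fst)).H) :
    letterColour w x ∈ w.map Prod.snd := by
  induction w with
  | nil => exact x.elim
  | cons A w ih =>
    rcases x with x | x
    · exact List.mem_cons_self
    · exact List.mem_cons_of_mem _ (ih x)

/-- Positions change when letters are split or reordered, attached colours do not; for distinct
colours both distinguish the same half-edges. -/
theorem colour_eq_iff {w : List (OGraph O × ℕ)} (hw : (w.map Prod.snd).Nodup)
    (x y : (union (w.map Prod.fst)).H) :
    colour (w.map Prod.fst) x = colour (w.map Prod.fst) y ↔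
      letterColour w x = letterColour w y := by
  induction w with
  | nil => exact x.elim
  | cons A w ih =>
    rw [List.map_cons, List.nodup_cons] at hw
    rcases x with x | x <;> rcases y with y | y
    · exact ⟨fun _ => rfl, fun _ => rfl⟩
    · refine ⟨fun h => absurd h (Nat.succ_ne_zero _).symm, fun h => ?_⟩
      exact absurd ((congrArg (· ∈ w.map Prod.snd) (show A.2 = letterColour w y from h)).mpr
        (letterColour_mem w y)) hw.1
    · refine ⟨fun h => absurd h (Nat.succ_ne_zero _), fun h => ?_⟩
      exact absurd ((congrArg (· ∈ w.map Prod.snd) (show A.2 = letterColour w x from h.symm)).mpr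
        (letterColour_mem w x)) hw.1
    · exact (Nat.succ_inj (a := colour (w.map Prod.fst) x)).trans (ih hw.2 x y)

end OGraph

/-! ### The bracket applied to a contraction -/

namespace SymGraph

open OGraph

variable {k : Type u} [Field k] {O : CyclicOperad.{u, w} k}

/-- The colouring of a disjoint union by `0` on the first summand. -/
def consColour (A : OGraph O) (v : List (OGraph O)) : (A.sum (union v)).H → ℕ :=
  Sum.elim (fun _ => 0) fun x => colour v x + 1

/-- Contraction in the first letter is contraction in the disjoint union with the same sign, and it
can be postponed until after the fusion. For a loop both sides vanish. -/
theorem bracket_contractCls (c : ℕ → k) (A : OGraph O) (a : A.H) (v : List (OGraph O)) :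
    bracket c (incl (GraphComplex.degree O) (A.contractCls a) * word v) =
      c (v.length + 1) • (A.sum (union v)).contractFusionSum (Sum.inl a) (consColour A v)
        (v.length + 1) := by
  by_cases ha : A.vert a = A.vert (A.flip a)
  · rw [contractCls_of_eq A a ha, map_zero, zero_mul, map_zero,
      contractFusionSum_loop (A.sum (union v)) (a := Sum.inl a)
        (congrArg (fun v => toLex (Sum.inl v)) ha), smul_zero]
  · have ha' : (A.sum (union v)).vert (Sum.inl a) ≠
        (A.sum (union v)).vert ((A.sum (union v)).flip (Sum.inl a)) :=
      fun h => ha (Sum.inl_injective (toLex.injective h))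
    rw [contractCls_of_ne A a ha, map_smul, smul_mul_assoc, ← word_cons, map_smul, bracket_word,
      List.length_cons, smul_comm]
    congr 1
    have h1 := (contractSumIso A (union v) a ha ha').fusionSum_eq
      (colour (A.contract a ha :: v)) (fun x => consColour A v ((A.sum (union v)).uncontract ha' x))
      (by rintro (x | x) (y | y) <;> rfl) (v.length + 1)
    rw [contractSumIso_sign, one_smul] at h1
    rw [← contractSign_smul_fusionSum _ _ ha', contractSign_sum, h1]
    rfl

end SymGraph

/-! ### The bracket of a bracket as a sum over pairs of lists -/

namespace SymGraph

open OGraph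

variable {k : Type u} [Field k] {O : CyclicOperad.{u, w} k}

/-- The colouring of the disjoint union of two disjoint unions of coloured graphs. -/
def sumColour (u v : List (OGraph O × ℕ)) :
    ((union (u.map Prod.fst)).sum (union (v.map Prod.fst))).H → ℕ :=
  Sum.elim (letterColour u) (letterColour v)

open Classical in
/-- The lists of directed edges in the second of two fusions, if `e` is the list in the first one. -/
def secondLists (u v : List (OGraph O × ℕ)) (e : List (union (u.map Prod.fst)).H) :
    Set (List ((union (u.map Prod.fst)).sum (union (v.map Prod.fst))).H) :=
  {f | (f.length = v.length + 1 ∧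
      (f.map (consColour (union (u.map Prod.fst)) (v.map Prod.fst))).Nodup) ∧
    ∀ x l, e = x :: l → inlHalf _ _ ((union (u.map Prod.fst)).flip x) ∉ f ∧
      inlHalf _ _ (e.formPerm x) ∉ f}

theorem bracket_fusionTerm (c : ℕ → k) (u v : List (OGraph O × ℕ))
    (e : List (union (u.map Prod.fst)).H) (he : (e.map (colour (u.map Prod.fst))).Nodup) :
    bracket c (incl (GraphComplex.degree O) ((union (u.map Prod.fst)).fusionTerm e) *
        word (v.map Prod.fst)) =
      c (v.length + 1) • ∑ᶠ f ∈ secondLists u v e,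
        ((union (u.map Prod.fst)).sum (union (v.map Prod.fst))).doubleTerm (e.map (inlHalf _ _)) f := by
  classical
  cases e with
  | nil =>
    refine Eq.trans ?_ (smul_eq_zero_of_right _
      (finsum_mem_eq_zero_of_forall_eq_zero fun _ _ => rfl)).symm
    change bracket c (incl (GraphComplex.degree O) 0 * _) = 0
    rw [map_zero, zero_mul, map_zero]
  | cons x l =>
    have hx : (union (u.map Prod.fst)).flip x ∉ x :: l := fun h => by
      have h1 := List.inj_on_of_nodup_map he h List.mem_cons_self (colour_flip _ x)
      exact (union (u.map Prod.fst)).flip_ne x h1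
    -- The edge contracted first has the halves `flip x` and the successor of `x`; these are what
    -- the second list has to avoid.
    have hf : ((union (u.map Prod.fst)).twist (x :: l).formPerm).flip ((union (u.map Prod.fst)).flip x) = (x :: l).formPerm x := by
      have : (x :: l).formPerm.symm ((union (u.map Prod.fst)).flip x) = (union (u.map Prod.fst)).flip x := by
        rw [Equiv.symm_apply_eq, List.formPerm_apply_of_notMem hx]
      change (x :: l).formPerm ((union (u.map Prod.fst)).flip ((x :: l).formPerm.symm ((union (u.map Prod.fst)).flip x))) = _
      rw [this, (union (u.map Prod.fst)).flip_flip]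
    refine (bracket_contractCls c ((union (u.map Prod.fst)).twist (x :: l).formPerm) _ _).trans ?_
    rw [List.length_map]
    congr 1
    refine finsum_mem_congr ?_ fun f _ => contractFusionTerm_twist_sum (union (u.map Prod.fst)) _ x l f
    ext f
    refine and_congr Iff.rfl ⟨?_, ?_⟩
    · rintro ⟨h1, h2⟩ y l' e
      obtain ⟨rfl, rfl⟩ := List.cons.inj e
      refine ⟨h1, fun h3 => h2 ?_⟩
      rw [← hf] at h3
      exact h3
    · intro h
      obtain ⟨h1, h2⟩ := h x l rfl
      refine ⟨h1, fun h3 => h2 ?_⟩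
      rw [← hf]
      exact h3

/-- Since the colours are distinct, a first list whose colours are those of `u` lies in the first
summand and meets each of its members once. Distinctness of the colours in the second list, with the
first summand merged into one colour, is then admissibility. An admissible first list is nonempty,
so `u` has to be nonempty. -/
theorem mem_iteratedFusion_iff {u v : List (OGraph O × ℕ)} (hu : u ≠ [])
    (hnd : ((u ++ v).map Prod.snd).Nodup)
    (p : List ((union (u.map Prod.fst)).sum (union (v.map Prod.fst))).H ×
      List ((union (u.map Prod.fst)).sum (union (v.map Prod.fst))).H) :
    ((((union (u.map Prod.fst)).sum (union (v.map Prod.fst))).Admissible (sumColour u v) p.1 p.2 ∧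
        p.1.length + p.2.length = u.length + v.length + 1) ∧
      (p.1.map (sumColour u v)).toFinset = (u.map Prod.snd).toFinset) ↔
    ∃ e, (e.length = u.length ∧ (e.map (colour (u.map Prod.fst))).Nodup) ∧
      p.2 ∈ secondLists u v e ∧ e.map (inlHalf _ _) = p.1 := by
  classical
  obtain ⟨e, f⟩ := p
  rw [List.map_append, List.nodup_append] at hnd
  obtain ⟨hndu, hndv, hdis⟩ := hnd
  have hl : ∀ x : (union (u.map Prod.fst)).H, sumColour u v (inlHalf _ _ x) ∈ u.map Prod.snd := letterColour_mem u
  have hr : ∀ x : (union (v.map Prod.fst)).H, sumColour u v (Sum.inr x) ∉ u.map Prod.snd := fun x hx =>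
    hdis _ hx _ (letterColour_mem v x) rfl
  have hcol : ∀ x y : (union (u.map Prod.fst)).H, colour (u.map Prod.fst) x = colour (u.map Prod.fst) y ↔
      sumColour u v (inlHalf _ _ x) = sumColour u v (inlHalf _ _ y) := colour_eq_iff hndu
  have hcol' : ∀ x y : (union (v.map Prod.fst)).H, colour (v.map Prod.fst) x = colour (v.map Prod.fst) y ↔
      sumColour u v (Sum.inr x) = sumColour u v (Sum.inr y) := colour_eq_iff hndv
  have hcard : (u.map Prod.snd).toFinset.card = u.length := by
    rw [List.toFinset_card_of_nodup hndu, List.length_map]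
  have hform : ∀ (e' : List (union (u.map Prod.fst)).H) (x : (union (u.map Prod.fst)).H),
      @List.formPerm ((union (u.map Prod.fst)).sum (union (v.map Prod.fst))).H (fun _ _ => Classical.propDecidable _) (e'.map (inlHalf _ _))
        (inlHalf _ _ x) = inlHalf _ _ (e'.formPerm x) := fun e' x =>
    List.formPerm_map_apply (inlHalf (union (u.map Prod.fst)) (union (v.map Prod.fst))) (inlHalf_injective _ _) e' x
  have hlm : ∀ e' : List (union (u.map Prod.fst)).H, (e'.map (inlHalf (union (u.map Prod.fst)) (union (v.map Prod.fst)))).length = e'.length :=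
    fun _ => List.length_map _
  have hlm2 : ∀ e' : List (union (u.map Prod.fst)).H, ((e'.map (inlHalf (union (u.map Prod.fst)) (union (v.map Prod.fst)))).map (sumColour u v)).length =
      e'.length :=
    fun _ => (List.length_map _).trans (List.length_map _)
  constructor
  · rintro ⟨⟨h, hn⟩, hI⟩
    simp only at h hn hI ⊢
    have hI' : ∀ i, i ∈ e.map (sumColour u v) ↔ i ∈ u.map Prod.snd := fun i => by
      rw [← List.mem_toFinset, hI, List.mem_toFinset]
    -- No half-edge of the second summand has a colour of `u`.
    have hinl : ∀ y ∈ e, y ∈ Set.range (inlHalf (union (u.map Prod.fst)) (union (v.map Prod.fst))) := by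
      rintro (y | y) hy
      · exact ⟨y, rfl⟩
      · exact absurd ((hI' _).1 (List.mem_map_of_mem hy)) (hr y)
    obtain ⟨e', rfl⟩ : e ∈ Set.range (List.map (inlHalf (union (u.map Prod.fst)) (union (v.map Prod.fst)))) := by
      rw [Set.range_list_map]
      exact hinl
    have hek : ((e'.map (inlHalf (union (u.map Prod.fst)) (union (v.map Prod.fst)))).map (sumColour u v)).Nodup :=
      (List.nodup_map_iff_inj_on h.nodup_left).2 h.inj_left
    have hlen : e'.length = u.length := by
      exact (hlm2 e').symm.trans ((List.toFinset_card_of_nodup hek).symm.trans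
        ((congrArg Finset.card hI).trans hcard))
    refine ⟨e', ⟨hlen, (nodup_map_congr hcol e').2 hek⟩, ⟨⟨?_, ?_⟩, ?_⟩, rfl⟩
    · have := hlm e'
      omega
    · refine (List.nodup_map_iff_inj_on h.nodup_right).2 ?_
      rintro (y | y) hy (z | z) hz hyz
      · exact h.inj_merged _ hy _ hz ((hI' _).2 (hl y)) ((hI' _).2 (hl z))
      · exact absurd hyz (Nat.succ_ne_zero _).symm
      · exact absurd hyz (Nat.succ_ne_zero _)
      · exact h.inj_right _ hy _ hz ((hcol' y z).1 (Nat.succ_inj.1 hyz))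
    · rintro x l rfl
      obtain ⟨x', l', he, h1, h2⟩ := h.avoid
      have hxx : inlHalf _ _ x = x' := (List.cons.inj he).1
      subst hxx
      refine ⟨h1, fun h3 => h2 ?_⟩
      have := hform (x :: l) x
      rw [← this] at h3
      exact h3
  · rintro ⟨e', ⟨hlen, hnd'⟩, ⟨⟨hlf, hf⟩, hav⟩, he⟩
    simp only at hlf hf hav he ⊢
    subst he
    have hek : ((e'.map (inlHalf (union (u.map Prod.fst)) (union (v.map Prod.fst)))).map (sumColour u v)).Nodup :=
      (nodup_map_congr hcol e').1 hnd'
    have hsub : ∀ i ∈ (e'.map (inlHalf (union (u.map Prod.fst)) (union (v.map Prod.fst)))).map (sumColour u v),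
        i ∈ u.map Prod.snd := by
      intro i hi
      obtain ⟨z, hz, rfl⟩ := List.mem_map.1 hi
      obtain ⟨y, -, rfl⟩ := List.mem_map.1 hz
      exact hl y
    have hinj := List.inj_on_of_nodup_map hf
    refine ⟨⟨⟨hek.of_map, fun x hx y hy hxy => List.inj_on_of_nodup_map hek hx hy hxy, hf.of_map,
      ?_, ?_, ?_, ?_⟩, ?_⟩, ?_⟩
    · rintro (y | y) hy (z | z) hz hyz
      · exact hinj hy hz rfl
      · exact absurd (hyz ▸ hl y) (hr z)
      · exact absurd (hyz ▸ hl z) (hr y)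
      · exact hinj hy hz (congrArg (· + 1) ((hcol' y z).2 hyz))
    · rintro (y | y) hy (z | z) hz hye hze
      · exact hinj hy hz rfl
      · exact absurd (hsub _ hze) (hr z)
      · exact absurd (hsub _ hye) (hr y)
      · exact absurd (hsub _ hye) (hr y)
    · rintro rfl
      simp at hlf
    · cases e' with
      | nil => exact absurd (List.length_eq_zero_iff.1 hlen.symm) hu
      | cons x l =>
        obtain ⟨h1, h2⟩ := hav x l rfl
        refine ⟨inlHalf _ _ x, l.map (inlHalf _ _), rfl, h1, fun h3 => h2 ?_⟩
        rw [← hform]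
        exact h3
    · have := hlm e'
      omega
    · refine Finset.eq_of_subset_of_card_le ?_ ?_
      · intro i hi
        rw [List.mem_toFinset] at hi ⊢
        exact hsub i hi
      · exact (hcard.trans (hlen.symm.trans ((hlm2 e').symm.trans
          (List.toFinset_card_of_nodup hek).symm))).le

/-- Both brackets are expanded into fusion terms. The resulting double sum, over first lists in the
letters of `u` and then over second lists, is a sum over one set of pairs. -/
theorem bracket_bracket (c : ℕ → k) (u v : List (OGraph O × ℕ))
    (hnd : ((u ++ v).map Prod.snd).Nodup) :
    bracket c (incl (GraphComplex.degree O) (bracket c (word (u.map Prod.fst))) *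
        word (v.map Prod.fst)) =
      ((union (u.map Prod.fst)).sum (union (v.map Prod.fst))).iteratedFusion c
        (u.length + v.length) (sumColour u v) (u.map Prod.snd).toFinset := by
  classical
  by_cases hu : u = []
  · subst hu
    have h0 : bracket c (word (([] : List (OGraph O × ℕ)).map Prod.fst)) = 0 := bracket_one c
    rw [h0, map_zero, zero_mul, map_zero]
    refine (finsum_mem_eq_zero_of_forall_eq_zero ?_).symm
    rintro ⟨e, f⟩ ⟨⟨h, -⟩, hI⟩
    obtain ⟨x, l, he, -⟩ := h.avoid
    simp only at he hI
    subst he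
    simp at hI
  · set T : GraphComplex O →ₗ[k] GraphComplex O := bracket c ∘ₗ
      LinearMap.mulRight k (word (v.map Prod.fst)) ∘ₗ incl (GraphComplex.degree O) with hT
    change T (bracket c (word (u.map Prod.fst))) = _
    rw [bracket_word, map_smul, bracketWord, fusionSum, List.length_map]
    have h1 := AddMonoidHom.map_finsum_mem (union (u.map Prod.fst)).fusionTerm T.toAddMonoidHom
      (finite_lists (colour (u.map Prod.fst)) u.length)
    refine (congrArg (c u.length • ·) h1).trans ?_
    have h2 : ∀ e ∈ {l : List (union (u.map Prod.fst)).H | l.length = u.length ∧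
        (l.map (colour (u.map Prod.fst))).Nodup},
        T.toAddMonoidHom ((union (u.map Prod.fst)).fusionTerm e) =
          c (v.length + 1) • ∑ᶠ f ∈ secondLists u v e,
        ((union (u.map Prod.fst)).sum (union (v.map Prod.fst))).doubleTerm (e.map (inlHalf _ _)) f :=
      fun e he => bracket_fusionTerm c u v e he.2
    have hfin : ∀ e, (secondLists u v e).Finite := fun e =>
      (finite_lists _ (v.length + 1)).subset fun f hf => hf.1
    rw [finsum_mem_congr rfl h2, ← smul_finsum_mem (finite_lists _ _), smul_smul, iteratedFusion]
    have hS : {p : List ((union (u.map Prod.fst)).sum (union (v.map Prod.fst))).H ×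
        List ((union (u.map Prod.fst)).sum (union (v.map Prod.fst))).H |
        (((union (u.map Prod.fst)).sum (union (v.map Prod.fst))).Admissible (sumColour u v) p.1 p.2 ∧
        p.1.length + p.2.length = u.length + v.length + 1) ∧
      (p.1.map (sumColour u v)).toFinset = (u.map Prod.snd).toFinset} =
      ⋃ e ∈ {l : List (union (u.map Prod.fst)).H | l.length = u.length ∧
        (l.map (colour (u.map Prod.fst))).Nodup},
        (fun f => (e.map (inlHalf _ _), f)) '' secondLists u v e := by
      ext p
      refine (mem_iteratedFusion_iff hu hnd p).trans ?_
      simp only [Set.mem_iUnion, Set.mem_image]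
      constructor
      · rintro ⟨e, he, hp, hpe⟩
        exact ⟨e, he, p.2, hp, Prod.ext hpe rfl⟩
      · rintro ⟨e, he, f, hf, rfl⟩
        exact ⟨e, he, hf, rfl⟩
    rw [hS, finsum_mem_biUnion _ (finite_lists _ _) fun e _ => (hfin e).image _,
      smul_finsum_mem (finite_lists _ _)]
    · refine finsum_mem_congr rfl fun e he => ?_
      rw [finsum_mem_image (fun _ _ _ _ h => (Prod.mk.inj h).2), smul_finsum_mem (hfin e)]
      refine finsum_mem_congr rfl fun f hf => ?_
      rw [List.length_map, he.1, hf.1.1]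
    · intro e _ e' _ hee
      refine Set.disjoint_left.2 ?_
      rintro _ ⟨f, -, rfl⟩ ⟨f', -, h⟩
      exact hee (List.map_injective_iff.2 (inlHalf_injective _ _) (Prod.mk.inj h).1).symm

end SymGraph

/-! ### Vanishing of the bracket of the coderivation -/

namespace SymGraph

open OGraph

variable {k : Type u} [Field k] {O : CyclicOperad.{u, w} k}

/-- The sum over the splittings of a list of graphs of a function of the disjoint union. -/
theorem splitSum_union {N : Type*} [AddCommGroup N] [Module k N]
    (F : (A : OGraph O) → (A.H → ℕ) → Finset ℕ → N)
    (hF : ∀ (A B : OGraph O) (f : Iso A B) (κ : A.H → ℕ) (μ : B.H → ℕ) (I : Finset ℕ),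
      (∀ x, μ (f.onH x) = κ x) → F B μ I = f.sign • F A κ I)
    (w : List (OGraph O × ℕ)) (hw : (w.map Prod.snd).Nodup) :
    splitSum k (fun x => vdeg x.1) w (fun u v => F ((union (u.map Prod.fst)).sum
        (union (v.map Prod.fst))) (sumColour u v) (u.map Prod.snd).toFinset) =
      ∑ I ∈ (w.map Prod.snd).toFinset.powerset, F (union (w.map Prod.fst)) (letterColour w) I := by
  induction w generalizing F with
  | nil =>
    have h := hF _ _ (emptySumIso (union (([] : List (OGraph O × ℕ)).map Prod.fst)))
      (sumColour [] []) (letterColour []) ∅ fun x => by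
        rcases x with x | x <;> exact x.elim
    rw [emptySumIso_sign, one_smul] at h
    rw [splitSum_nil]
    refine h.symm.trans ?_
    simp
  | cons x w ih =>
    rw [List.map_cons, List.nodup_cons] at hw
    have hx : x.2 ∉ (w.map Prod.snd).toFinset := by rw [List.mem_toFinset]; exact hw.1
    have hF' : ∀ J : Finset ℕ → Finset ℕ,
        ∀ (A B : OGraph O) (f : Iso A B) (κ : A.H → ℕ) (μ : B.H → ℕ) (I : Finset ℕ),
        (∀ x, μ (f.onH x) = κ x) → F (x.1.sum B) (Sum.elim (fun _ => x.2) μ) (J I) =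
          f.sign • F (x.1.sum A) (Sum.elim (fun _ => x.2) κ) (J I) := by
      intro J A B f κ μ I h
      have h1 := hF _ _ ((Iso.refl x.1).sumCongr f) (Sum.elim (fun _ => x.2) κ)
        (Sum.elim (fun _ => x.2) μ) (J I) (by
          rintro (y | y)
          · rfl
          · exact h y)
      rwa [Iso.sumCongr_sign, Iso.refl_sign, one_mul] at h1
    have h1 := ih (fun A κ I => F (x.1.sum A) (Sum.elim (fun _ => x.2) κ) (insert x.2 I))
      (hF' (insert x.2)) hw.2
    have h2 := ih (fun A κ I => F (x.1.sum A) (Sum.elim (fun _ => x.2) κ) I) (hF' id) hw.2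
    -- The first letter goes to the left or to the right word according as its colour belongs to `I`
    -- or not.
    rw [List.map_cons, List.toFinset_cons, Finset.sum_powerset_insert hx, add_comm, splitSum_cons]
    refine congrArg₂ _ (Eq.trans ?_ h1) (Eq.trans ?_ h2)
    · refine splitSum_congr _ fun u v _ => ?_
      have h := hF _ _ (sumAssocIso x.1 (union (u.map Prod.fst)) (union (v.map Prod.fst)))
        (sumColour (x :: u) v) (Sum.elim (fun _ => x.2) (sumColour u v))
        (insert x.2 (u.map Prod.snd).toFinset) (by rintro ((y | y) | y) <;> rfl)
      rw [sumAssocIso_sign, one_smul] at h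
      exact Eq.trans (congrArg (F _ (sumColour (x :: u) v)) List.toFinset_cons) h.symm
    · refine splitSum_congr _ fun u v _ => ?_
      have h := hF _ _ (sumSwapIso (union (u.map Prod.fst)) x.1 (union (v.map Prod.fst)))
        (sumColour u (x :: v)) (Sum.elim (fun _ => x.2) (sumColour u v))
        (u.map Prod.snd).toFinset (by rintro (y | (y | y)) <;> rfl)
      refine Eq.trans ?_ h.symm
      -- Bringing the first letter back to the front of the disjoint union moves it past the left
      -- word; the sign of this isomorphism cancels the Koszul sign.
      rw [sumSwapIso_sign, ← zpow_natCast, Nat.cast_mul, card_union]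
      have e : wordDegree (fun y : OGraph O × ℕ => vdeg y.1) u =
          wordDegree vdeg (u.map Prod.fst) := by
        rw [wordDegree, wordDegree, List.map_map]
        rfl
      rw [e, mul_comm (vdeg x.1)]
      rfl

theorem bracket_coderivation_word (c : ℕ → k) (w : List (OGraph O)) :
    bracket c (coderivation c (word w)) = 0 := by
  -- Every letter is marked by its position, so that equal graphs remain distinguishable in all
  -- splittings and the terms live on one coloured graph.
  set W : List (OGraph O × ℕ) := w.zipIdx with hW
  have hw : w = W.map Prod.fst := (List.zipIdx_map_fst 0 w).symm
  have hnd : (W.map Prod.snd).Nodup := by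
    rw [hW, List.zipIdx_map_snd]
    exact List.nodup_range'
  rw [coderivation_word, splitSum_map, hw, splitSum_letter]
  have h := splitSum_union (k := k) (fun A κ I => A.iteratedFusion c W.length κ I)
    (fun A B f κ μ I h => f.iteratedFusion_eq h c _ I) W hnd
  refine Eq.trans (splitSum_congr _ fun u v huv => ?_) (h.trans ?_)
  · rw [bracket_bracket c u v ((huv.map Prod.snd).nodup_iff.2 hnd)]
    rw [← huv.length_eq, List.length_append]
  · refine sum_iteratedFusion c _ _ _ (letterColour_flip W) _ fun x => ?_
    rw [List.mem_toFinset]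
    exact letterColour_mem W x

theorem coderivation_sq (c : ℕ → k) :
    (coderivation c ∘ₗ coderivation c : Module.End k (SymGraphComplex O)) = 0 :=
  coderivation_comp_self c (bracket_coderivation_word c)

end SymGraph

/-! ### Splittings of a word as subsets of positions -/

section Splittings

variable {k : Type u} [Field k]

theorem sum_finset_fin_succ {M : Type*} [AddCommMonoid M] {m : ℕ} (f : Finset (Fin (m + 1)) → M) :
    ∑ I, f I = ∑ I : Finset (Fin m), f (insert 0 (I.map (Fin.succEmb m))) +
      ∑ I : Finset (Fin m), f (I.map (Fin.succEmb m)) := by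
  have h0 : (0 : Fin (m + 1)) ∉ (Finset.univ : Finset (Fin m)).map (Fin.succEmb m) := by
    simp
  have hu : (Finset.univ : Finset (Finset (Fin (m + 1)))) =
      (insert 0 ((Finset.univ : Finset (Fin m)).map (Fin.succEmb m))).powerset := by
    rw [← Finset.powerset_univ, Fin.univ_succ, Finset.cons_eq_insert]
    rfl
  have hmap : ∀ g : Finset (Fin (m + 1)) → M,
      ∑ I ∈ ((Finset.univ : Finset (Fin m)).map (Fin.succEmb m)).powerset, g I =
        ∑ I : Finset (Fin m), g (I.map (Fin.succEmb m)) := by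
    intro g
    symm
    refine Finset.sum_nbij (fun I => I.map (Fin.succEmb m)) ?_ ?_ ?_ ?_
    · intro I _
      rw [Finset.mem_powerset]
      exact Finset.map_subset_map.2 (Finset.subset_univ I)
    · intro I _ J _ h
      exact Finset.map_injective _ h
    · intro I hI
      rw [Finset.mem_coe, Finset.mem_powerset, Finset.subset_map_iff] at hI
      obtain ⟨J, -, rfl⟩ := hI
      exact ⟨J, by simp, rfl⟩
    · intro _ _
      rfl
  rw [hu, Finset.sum_powerset_insert h0, hmap, hmap, add_comm]

/-- The exponent of the Koszul sign. -/
theorem koszul_exponent {m : ℕ} (d : Fin m → ℤ) (I : Finset (Fin m)) :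
    ∑ i ∈ I, ∑ j ∈ Iᶜ with j < i, d i * d j =
      ∑ i, ∑ j, if i ∈ I ∧ j ∉ I ∧ j < i then d i * d j else 0 := by
  rw [← Finset.sum_filter_add_sum_filter_not Finset.univ (· ∈ I)]
  rw [Finset.sum_eq_zero (s := Finset.univ.filter (· ∉ I)), add_zero]
  · rw [Finset.filter_mem_eq_inter, Finset.univ_inter]
    refine Finset.sum_congr rfl fun i hi => ?_
    rw [Finset.sum_filter, ← Finset.sum_filter_add_sum_filter_not Finset.univ (· ∈ I),
      Finset.sum_eq_zero (s := Finset.univ.filter (· ∈ I)), zero_add, ← Finset.sum_filter]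
    · simp only [hi, true_and]
      rw [← Finset.sum_filter]
      refine Finset.sum_congr ?_ fun _ _ => rfl
      ext j
      simp
    · intro j hj
      rw [Finset.mem_filter] at hj
      simp [hj.2]
  · intro i hi
    rw [Finset.mem_filter] at hi
    simp [hi.2]

/-- Position 0 is the smallest, so as a member of the left part it passes nothing. -/
theorem koszulSign_insert_zero {m : ℕ} (d : Fin (m + 1) → ℤ) (I : Finset (Fin m)) :
    koszulSign k d (insert 0 (I.map (Fin.succEmb m))) = koszulSign k (fun i => d i.succ) I := by
  rw [koszulSign, koszulSign, koszul_exponent, koszul_exponent]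
  congr 1
  rw [Fin.sum_univ_succ]
  simp [Fin.sum_univ_succ]

/-- As a member of the right part, position 0 is passed by every member of the left part. -/
theorem koszulSign_map_succ {m : ℕ} (d : Fin (m + 1) → ℤ) (I : Finset (Fin m)) :
    koszulSign k d (I.map (Fin.succEmb m)) =
      (-1 : k) ^ (d 0 * ∑ i ∈ I, d i.succ) * koszulSign k (fun i => d i.succ) I := by
  rw [koszulSign, koszulSign, koszul_exponent, koszul_exponent, ← neg_one_zpow_add]
  congr 1
  rw [Fin.sum_univ_succ]
  simp [Fin.sum_univ_succ, Finset.sum_add_distrib, Finset.mul_sum, mul_comm]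

theorem filter_finRange_succ {m : ℕ} (I : Finset (Fin (m + 1))) :
    (List.finRange (m + 1)).filter (· ∈ I) = (if 0 ∈ I then [0] else []) ++
      ((List.finRange m).filter (fun i => i.succ ∈ I)).map Fin.succ := by
  rw [List.finRange_succ, List.filter_cons, List.filter_map]
  split <;> simp_all [Function.comp_def]

theorem wordDegree_filter {Λ : Type*} (d : Λ → ℤ) {m : ℕ} (x : Fin m → Λ) (I : Finset (Fin m)) :
    wordDegree d (((List.finRange m).filter (· ∈ I)).map x) = ∑ i ∈ I, d (x i) := by
  rw [wordDegree, List.map_map]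
  have h : ((List.finRange m).filter (· ∈ I)).Nodup := (List.nodup_finRange m).filter _
  rw [← List.sum_toFinset _ h]
  refine Finset.sum_congr ?_ fun _ _ => rfl
  ext i
  simp

/-- Splittings of a list correspond to subsets of the set of positions. -/
theorem splitSum_ofFn {Λ : Type*} (d : Λ → ℤ) {N : Type*} [AddCommGroup N] [Module k N] {m : ℕ}
    (x : Fin m → Λ) (g : List Λ → List Λ → N) :
    splitSum k d (List.ofFn x) g = ∑ I : Finset (Fin m), koszulSign k (fun i => d (x i)) I •
      g (((List.finRange m).filter (· ∈ I)).map x) (((List.finRange m).filter (· ∈ Iᶜ)).map x) := by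
  induction m generalizing g with
  | zero =>
    rw [List.ofFn_zero, splitSum_nil, Fintype.sum_unique, koszulSign,
      Finset.sum_eq_zero fun i _ => i.elim0, zpow_zero, one_smul]
    rfl
  | succ m ih =>
    rw [List.ofFn_succ, splitSum_cons, sum_finset_fin_succ, ih, ih]
    refine congrArg₂ _ (Finset.sum_congr rfl fun I _ => ?_) (Finset.sum_congr rfl fun I _ => ?_)
    · rw [koszulSign_insert_zero, filter_finRange_succ, filter_finRange_succ]
      simp
      rfl
    · rw [koszulSign_map_succ, filter_finRange_succ, filter_finRange_succ, wordDegree_filter,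
        smul_smul, mul_comm]
      simp
      rfl

end Splittings

/-! ### The fusion of a family as the fusion of a word -/

theorem List.ofFn_eq_cons {α : Type*} {n : ℕ} (hn : 0 < n) (e : Fin n → α) :
    List.ofFn e = e ⟨0, hn⟩ :: (List.ofFn e).tail := by
  cases n with
  | zero => exact absurd hn (lt_irrefl 0)
  | succ n =>
    rw [List.ofFn_succ]
    rfl

namespace OGraph

variable {k : Type u} [Field k] {O : CyclicOperad.{u, w} k}

open Classical in
theorem fusionTerm_of_eq_cons (A : OGraph O) {l t : List A.H} {x : A.H} (h : l = x :: t) :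
    A.fusionTerm l = (A.twist l.formPerm).contractCls (A.flip x) := by
  subst h
  rfl

section Family

variable {ι : Type} [Finite ι] [LinearOrder ι] (G : ι → OGraph O)

/-- The half-edges of the disjoint union of a list of members of a family. -/
noncomputable def sigmaHalf : (l : List ι) → (union (l.map G)).H → (disjUnion G).H
  | [] => Empty.elim
  | i :: l => Sum.elim (fun h => ⟨i, h⟩) (sigmaHalf l)

/-- The vertices of the disjoint union of a list of members of a family. -/
noncomputable def sigmaVert : (l : List ι) → (union (l.map G)).V → (disjUnion G).V
  | [] => Empty.elim
  | i :: l => fun v => Sum.elim (fun a => toLex ⟨i, a⟩) (sigmaVert l) (ofLex v)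

theorem sigmaHalf_fst_mem (l : List ι) (x : (union (l.map G)).H) : (sigmaHalf G l x).1 ∈ l := by
  induction l with
  | nil => exact x.elim
  | cons i l ih =>
    rcases x with x | x
    · exact List.mem_cons_self
    · exact List.mem_cons_of_mem _ (ih x)

theorem sigmaVert_fst_mem (l : List ι) (v : (union (l.map G)).V) :
    (ofLex (sigmaVert G l v)).1 ∈ l := by
  induction l with
  | nil => exact v.elim
  | cons i l ih =>
    rcases v with v | v
    · exact List.mem_cons_self
    · exact List.mem_cons_of_mem _ (ih v)

theorem sigmaHalf_colour {l : List ι} (hl : l.Nodup) (x y : (union (l.map G)).H) :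
    colour (l.map G) x = colour (l.map G) y ↔ (sigmaHalf G l x).1 = (sigmaHalf G l y).1 := by
  induction l with
  | nil => exact x.elim
  | cons i l ih =>
    rw [List.nodup_cons] at hl
    rcases x with x | x <;> rcases y with y | y
    · exact ⟨fun _ => rfl, fun _ => rfl⟩
    · refine ⟨fun h => absurd h (Nat.succ_ne_zero _).symm, fun h => absurd ?_ hl.1⟩
      have h' : i = (sigmaHalf G l y).1 := h
      rw [h']
      exact sigmaHalf_fst_mem G l y
    · refine ⟨fun h => absurd h (Nat.succ_ne_zero _), fun h => absurd ?_ hl.1⟩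
      have h' : (sigmaHalf G l x).1 = i := h
      rw [← h']
      exact sigmaHalf_fst_mem G l x
    · exact (Nat.succ_inj (a := colour (l.map G) x)).trans (ih hl.2 x y)

theorem sigmaHalf_injective {l : List ι} (hl : l.Nodup) : Function.Injective (sigmaHalf G l) := by
  induction l with
  | nil => exact fun x => x.elim
  | cons i l ih =>
    rw [List.nodup_cons] at hl
    rintro (x | x) (y | y) h
    · exact congrArg Sum.inl (eq_of_heq (Sigma.mk.inj h).2)
    · have h' : i = (sigmaHalf G l y).1 := congrArg Sigma.fst h
      exact absurd (h' ▸ sigmaHalf_fst_mem G l y) hl.1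
    · have h' : (sigmaHalf G l x).1 = i := congrArg Sigma.fst h
      exact absurd (h' ▸ sigmaHalf_fst_mem G l x) hl.1
    · exact congrArg Sum.inr (ih hl.2 h)

theorem sigmaHalf_surjective {l : List ι} (i : ι) (hi : i ∈ l) (h : (G i).H) :
    ∃ x, sigmaHalf G l x = ⟨i, h⟩ := by
  induction l with
  | nil => simp at hi
  | cons j l ih =>
    by_cases hij : i = j
    · subst hij
      exact ⟨Sum.inl h, rfl⟩
    · obtain ⟨x, hx⟩ := ih ((List.mem_cons.1 hi).resolve_left hij)
      exact ⟨Sum.inr x, hx⟩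

theorem sigmaVert_surjective {l : List ι} (i : ι) (hi : i ∈ l) (v : (G i).V) :
    ∃ x, sigmaVert G l x = toLex ⟨i, v⟩ := by
  induction l with
  | nil => simp at hi
  | cons j l ih =>
    by_cases hij : i = j
    · subst hij
      exact ⟨toLex (Sum.inl v), rfl⟩
    · obtain ⟨x, hx⟩ := ih ((List.mem_cons.1 hi).resolve_left hij)
      exact ⟨toLex (Sum.inr x), hx⟩

theorem sigmaVert_strictMono {l : List ι} (hl : l.Pairwise (· < ·)) :
    StrictMono (sigmaVert G l) := by
  induction l with
  | nil => exact fun x => x.elim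
  | cons i l ih =>
    rw [List.pairwise_cons] at hl
    rintro (x | x) (y | y) h
    · exact Sigma.Lex.right _ _ (Sum.lex_inl_inl.1 h)
    · exact Sigma.Lex.left _ _ (hl.1 _ (sigmaVert_fst_mem G l y))
    · exact absurd h Sum.lex_inr_inl
    · exact ih hl.2 (Sum.lex_inr_inr.1 h)

theorem vert_sigmaHalf (l : List ι) (x : (union (l.map G)).H) :
    (disjUnion G).vert (sigmaHalf G l x) = sigmaVert G l ((union (l.map G)).vert x) := by
  induction l with
  | nil => exact x.elim
  | cons i l ih =>
    rcases x with x | x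
    · rfl
    · exact ih x

theorem flip_sigmaHalf (l : List ι) (x : (union (l.map G)).H) :
    (disjUnion G).flip (sigmaHalf G l x) = sigmaHalf G l ((union (l.map G)).flip x) := by
  induction l with
  | nil => exact x.elim
  | cons i l ih =>
    rcases x with x | x
    · rfl
    · exact ih x

theorem sigmaHalf_mem_dir (l : List ι) (x : (union (l.map G)).H) (hx : x ∈ (union (l.map G)).dir) :
    sigmaHalf G l x ∈ (disjUnion G).dir := by
  induction l with
  | nil => exact x.elim
  | cons i l ih =>
    rcases x with x | x
    · exact hx
    · exact ih x hx

theorem disjUnion_label (i : ι) (v : (G i).V) :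
    O.Agree (fun x : {x // (G i).vert x = v} => (⟨i, x.1⟩ : (disjUnion G).H))
      (fun x : {x // (disjUnion G).vert x = toLex ⟨i, v⟩} => x.1)
      ((G i).label v) ((disjUnion G).label (toLex ⟨i, v⟩)) :=
  ⟨_, fun _ => rfl, rfl⟩

theorem sigmaVert_label (l : List ι) (v : (union (l.map G)).V) :
    O.Agree (fun x : {x // (union (l.map G)).vert x = v} => sigmaHalf G l x.1)
      (fun x : {x // (disjUnion G).vert x = sigmaVert G l v} => x.1)
      ((union (l.map G)).label v) ((disjUnion G).label (sigmaVert G l v)) := by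
  induction l with
  | nil => exact v.elim
  | cons i l ih =>
    rcases v with v | v
    · exact ((sum_label_inl (G i) (union (l.map G)) v).symm.push (sigmaHalf G (i :: l))
        (fun _ => rfl) (fun _ => rfl)).trans (disjUnion_label G i v)
    · exact ((sum_label_inr (G i) (union (l.map G)) v).symm.push (sigmaHalf G (i :: l))
        (fun _ => rfl) (fun _ => rfl)).trans (ih v)

/-- The disjoint union of a family as the disjoint union of a list. -/
noncomputable def unionSigmaIso (l : List ι) (hl : l.Pairwise (· < ·)) (hl' : ∀ i, i ∈ l) :
    Iso (union (l.map G)) (disjUnion G) :=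
  Iso.ofAgree
    (Equiv.ofBijective (sigmaVert G l) ⟨(sigmaVert_strictMono G hl).injective,
      fun v => sigmaVert_surjective G (ofLex v).1 (hl' _) (ofLex v).2⟩)
    (Equiv.ofBijective (sigmaHalf G l) ⟨sigmaHalf_injective G (hl.imp ne_of_lt),
      fun x => sigmaHalf_surjective G x.1 (hl' _) x.2⟩)
    (vert_sigmaHalf G l) (flip_sigmaHalf G l) (sigmaVert_label G l)

theorem unionSigmaIso_sign (l : List ι) (hl : l.Pairwise (· < ·)) (hl' : ∀ i, i ∈ l) :
    (unionSigmaIso G l hl hl').sign = (1 : k) :=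
  Iso.sign_eq_one _ (sigmaVert_strictMono G hl) (sigmaHalf_mem_dir G l)

theorem fusion_eq_fusionSum (n : ℕ+) :
    fusion n G = (disjUnion G).fusionSum (fun x => x.1) n := by
  classical
  rw [fusion, fusionSum]
  refine finsum_mem_eq_of_bijOn List.ofFn ⟨?_, ?_, ?_⟩ ?_
  · intro e he
    refine ⟨List.length_ofFn, ?_⟩
    rw [List.map_ofFn, List.nodup_ofFn]
    exact he
  · exact List.ofFn_injective.injOn
  · rintro l ⟨h1, h2⟩
    obtain ⟨e, rfl⟩ : ∃ e : Fin n → (disjUnion G).H, List.ofFn e = l := by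
      obtain ⟨n, hn⟩ := n
      simp only [PNat.mk_coe] at h1
      subst h1
      exact ⟨l.get, List.ofFn_get l⟩
    rw [List.map_ofFn, List.nodup_ofFn] at h2
    exact ⟨e, h2, rfl⟩
  · intro e _
    exact ((disjUnion G).fusionTerm_of_eq_cons (List.ofFn_eq_cons n.pos e)).symm

/-- Listing the index set in increasing order identifies the lexicographic disjoint union with the
iterated one, with the same order of vertices and hence sign 1. -/
theorem fusion_eq_bracketWord (l : List ι) (hl : l.Pairwise (· < ·)) (hl' : ∀ i, i ∈ l) (n : ℕ+)
    (hn : l.length = n) : fusion n G = bracketWord (l.map G) := by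
  rw [fusion_eq_fusionSum, (unionSigmaIso G l hl hl').fusionSum_eq (colour (l.map G)) (fun x => x.1)
    (sigmaHalf_colour G (hl.imp ne_of_lt)), unionSigmaIso_sign, one_smul, bracketWord,
    List.length_map, hn]

end Family

end OGraph

namespace SymGraph

open OGraph

variable {k : Type u} [Field k] {O : CyclicOperad.{u, w} k}

/-! ### The fusion operations as coderivations -/

theorem monomial_cls {m : ℕ} (G : Fin m → OGraph O) (I : Finset (Fin m)) :
    monomial (GraphComplex.degree O) (fun i => (G i).cls) I =
      word (((List.finRange m).filter (· ∈ I)).map G) := by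
  rw [monomial, word, List.map_map]
  rfl

theorem monomial_cls_univ {m : ℕ} (G : Fin m → OGraph O) :
    monomial (GraphComplex.degree O) (fun i => (G i).cls) Finset.univ = word (List.ofFn G) := by
  rw [monomial_cls, List.ofFn_eq_map]
  simp

theorem coderivation_monomial_cls (c : ℕ → k) {m : ℕ} (G : Fin m → OGraph O) :
    coderivation c (monomial (GraphComplex.degree O) (fun i => (G i).cls) Finset.univ) =
      ∑ I : Finset (Fin m), koszulSign k (fun i => (Nat.card (G i).V : ℤ)) I •
        (incl (GraphComplex.degree O) (bracket c (monomial (GraphComplex.degree O)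
          (fun i => (G i).cls) I)) * monomial (GraphComplex.degree O) (fun i => (G i).cls) Iᶜ) := by
  rw [monomial_cls_univ, coderivation_word, splitSum_ofFn]
  simp only [monomial_cls]
  rfl

theorem length_filter_finRange {m : ℕ} (I : Finset (Fin m)) :
    ((List.finRange m).filter (· ∈ I)).length = I.card := by
  rw [← List.toFinset_card_of_nodup ((List.nodup_finRange m).filter _)]
  congr 1
  ext i
  simp

theorem fusion_subfamily (n : ℕ+) {m : ℕ} (G : Fin m → OGraph O) (I : Finset (Fin m))
    (hI : I.card = n) : fusion n (fun i : I => G i) =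
      bracketWord (((List.finRange m).filter (· ∈ I)).map G) := by
  set l : List I := ((List.finRange m).filter (· ∈ I)).pmap Subtype.mk
    (fun i hi => by simpa using hi) with hl
  have e : l.map Subtype.val = (List.finRange m).filter (· ∈ I) := by
    rw [hl, List.map_pmap]
    simp
  have h1 : l.Pairwise (· < ·) := by
    have : (l.map Subtype.val).Pairwise (· < ·) := by
      rw [e]
      exact (List.pairwise_lt_finRange m).filter _
    rw [List.pairwise_map] at this
    exact this
  have h2 : ∀ i, i ∈ l := fun i => by
    rw [← List.mem_map_of_injective Subtype.val_injective, e]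
    simp
  rw [fusion_eq_bracketWord _ l h1 h2 n, ← e, List.map_map]
  · rfl
  · rw [← hI, ← length_filter_finRange, ← e, List.length_map]

/-- The unit sequence kills the terms of all subsets that do not have `n` elements. -/
theorem isFusion_coderivation (n : ℕ+) :
    IsFusion O n (coderivation (Pi.single (n : ℕ) 1)) := by
  intro m G
  rw [coderivation_monomial_cls]
  symm
  refine (Finset.sum_congr rfl fun I hI => ?_).trans
    (Finset.sum_subset (Finset.subset_univ _) fun I _ hI => ?_)
  · rw [Finset.mem_powersetCard] at hI
    rw [fusion_subfamily n G I hI.2, monomial_cls G I, bracket_word, List.length_map,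
      length_filter_finRange, hI.2, Pi.single_eq_same, one_smul]
  · rw [Finset.mem_powersetCard, not_and] at hI
    rw [monomial_cls G I, bracket_word, List.length_map, length_filter_finRange,
      Pi.single_eq_of_ne (hI (Finset.subset_univ _)), zero_smul, map_zero, zero_mul, smul_zero]

theorem IsFusion.eq_coderivation {n : ℕ+} {φ : Module.End k (SymGraphComplex O)}
    (h : IsFusion O n φ) : φ = coderivation (Pi.single (n : ℕ) 1) := by
  refine ext_word fun w => ?_
  have hw : word w = monomial (GraphComplex.degree O) (fun i => (w.get i).cls) Finset.univ := by
    rw [monomial_cls_univ, List.ofFn_get]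
  rw [hw]
  exact (h _ w.get).trans (isFusion_coderivation n _ w.get).symm

/-! ### Homogeneous arguments -/

section Update

variable {M : Type*} [AddCommGroup M] [Module k M] (D : ℤ → Submodule k M) {m : ℕ} (x : Fin m → M)
  (i : Fin m) (I : Finset (Fin m))

theorem monomial_update_of_notMem (hi : i ∉ I) (a : M) :
    monomial D (Function.update x i a) I = monomial D x I := by
  rw [monomial, monomial]
  refine congrArg List.prod (List.map_congr_left fun j hj => ?_)
  rw [Function.update_of_ne]
  rintro rfl
  simp at hj
  exact hi hj

theorem exists_monomial_update (hi : i ∈ I) : ∃ s t : GradedSym D, ∀ a,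
    monomial D (Function.update x i a) I = s * (incl D a * t) := by
  have hmem : i ∈ (List.finRange m).filter (· ∈ I) := by simpa using hi
  have hnd : ((List.finRange m).filter (· ∈ I)).Nodup := (List.nodup_finRange m).filter _
  obtain ⟨s, t, hst⟩ := List.append_of_mem hmem
  rw [hst, List.nodup_middle, List.nodup_cons, List.mem_append, not_or] at hnd
  refine ⟨(s.map fun j => incl D (x j)).prod, (t.map fun j => incl D (x j)).prod, fun a => ?_⟩
  rw [monomial, hst, List.map_append, List.map_cons, List.prod_append, List.prod_cons,
    Function.update_self]
  have h : ∀ l : List (Fin m), i ∉ l → (l.map fun j => incl D (Function.update x i a j)) =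
      l.map fun j => incl D (x j) := fun l hl =>
    List.map_congr_left fun j hj => by
      rw [Function.update_of_ne]
      rintro rfl
      exact hl hj
  rw [h s hnd.1.1, h t hnd.1.2]

theorem monomial_update_add (hi : i ∈ I) (a b : M) :
    monomial D (Function.update x i (a + b)) I =
      monomial D (Function.update x i a) I + monomial D (Function.update x i b) I := by
  obtain ⟨s, t, h⟩ := exists_monomial_update D x i I hi
  rw [h, h, h, map_add, add_mul, mul_add]

theorem monomial_update_smul (hi : i ∈ I) (r : k) (a : M) :
    monomial D (Function.update x i (r • a)) I =
      r • monomial D (Function.update x i a) I := by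
  obtain ⟨s, t, h⟩ := exists_monomial_update D x i I hi
  rw [h, h, map_smul, smul_mul_assoc, mul_smul_comm]

/-- Induction for families in the spans of given sets. -/
theorem span_pi_induction {S : Fin m → Set M} {P : (Fin m → M) → Prop}
    (hS : ∀ x, (∀ i, x i ∈ S i) → P x)
    (hzero : ∀ x i, P (Function.update x i 0))
    (hadd : ∀ x i a b, P (Function.update x i a) → P (Function.update x i b) →
      P (Function.update x i (a + b)))
    (hsmul : ∀ x i (r : k) a, P (Function.update x i a) → P (Function.update x i (r • a)))
    (x : Fin m → M) (hx : ∀ i, x i ∈ Submodule.span k (S i)) : P x := by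
  -- The set `s` contains the coordinates that are not yet reduced to generators; the induction
  -- reduces one of them at a time.
  suffices h : ∀ (s : Finset (Fin m)) (x : Fin m → M), (∀ i, x i ∈ Submodule.span k (S i)) →
      (∀ i, i ∉ s → x i ∈ S i) → P x from
    h Finset.univ x hx fun i hi => absurd (Finset.mem_univ i) hi
  intro s
  induction s using Finset.induction_on with
  | empty => exact fun x _ h => hS x fun i => h i (Finset.notMem_empty i)
  | insert i s hi ih =>
    intro x hx h
    have key : ∀ a ∈ Submodule.span k (S i), P (Function.update x i a) := by
      intro a ha
      induction ha using Submodule.span_induction with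
      | zero => exact hzero x i
      | add a b _ _ iha ihb => exact hadd x i a b iha ihb
      | smul r a _ iha => exact hsmul x i r a iha
      | mem a ha =>
        refine ih _ (fun j => ?_) fun j hj => ?_
        · by_cases hji : j = i
          · subst hji
            rw [Function.update_self]
            exact Submodule.subset_span ha
          · rw [Function.update_of_ne hji]
            exact hx j
        · by_cases hji : j = i
          · subst hji
            rwa [Function.update_self]
          · rw [Function.update_of_ne hji]
            exact h j fun hj' => (Finset.mem_insert.1 hj').elim hji hj
    have := key (x i) (hx i)
    rwa [Function.update_eq_self] at this

end Update

theorem bracket_monomial_mem (c : ℕ → k) {m : ℕ} (x : Fin m → GraphComplex O) (d : Fin m → ℤ)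
    (hx : ∀ i, x i ∈ GraphComplex.degree O (d i)) :
    bracket c (monomial (GraphComplex.degree O) x Finset.univ) ∈
      GraphComplex.degree O (∑ i, d i - 1) := by
  refine span_pi_induction (P := fun x => bracket c (monomial (GraphComplex.degree O) x
    Finset.univ) ∈ GraphComplex.degree O (∑ i, d i - 1)) ?_ ?_ ?_ ?_ x hx
  · intro x hx
    choose G hG hGx using hx
    obtain rfl : (fun i => (G i).cls) = x := funext hGx
    obtain rfl : (fun i => (Nat.card (G i).V : ℤ)) = d := funext hG
    rw [monomial_cls_univ]
    have h := bracket_word_mem_degree c (List.ofFn G)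
    rw [wordDegree, List.map_ofFn, List.sum_ofFn] at h
    exact h
  · intro x i
    have h := monomial_update_smul (k := k) (GraphComplex.degree O) x i Finset.univ
      (Finset.mem_univ i) 0 0
    rw [zero_smul, zero_smul] at h
    rw [h, map_zero]
    exact zero_mem _
  · intro x i a b ha hb
    rw [monomial_update_add _ _ _ _ (Finset.mem_univ i), map_add]
    exact add_mem ha hb
  · intro x i r a ha
    rw [monomial_update_smul _ _ _ _ (Finset.mem_univ i), map_smul]
    exact Submodule.smul_mem _ r ha

/-- With the degrees fixed both sides are multilinear, since every argument occurs in exactly one of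
the two monomials of each term. So it suffices to take classes of graphs. -/
theorem coderivation_monomial (c : ℕ → k) {m : ℕ} (x : Fin m → GraphComplex O) (d : Fin m → ℤ)
    (hx : ∀ i, x i ∈ GraphComplex.degree O (d i)) :
    coderivation c (monomial (GraphComplex.degree O) x Finset.univ) =
      ∑ I : Finset (Fin m), koszulSign k d I • (incl (GraphComplex.degree O)
        (bracket c (monomial (GraphComplex.degree O) x I)) *
          monomial (GraphComplex.degree O) x Iᶜ) := by
  have hsmul : ∀ (x : Fin m → GraphComplex O) i (r : k) a (I : Finset (Fin m)),
      incl (GraphComplex.degree O) (bracket c (monomial (GraphComplex.degree O)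
        (Function.update x i (r • a)) I)) *
          monomial (GraphComplex.degree O) (Function.update x i (r • a)) Iᶜ =
      r • (incl (GraphComplex.degree O) (bracket c (monomial (GraphComplex.degree O)
        (Function.update x i a) I)) *
          monomial (GraphComplex.degree O) (Function.update x i a) Iᶜ) := by
    intro x i r a I
    by_cases hi : i ∈ I
    · have hi' : i ∉ Iᶜ := by simpa using hi
      rw [monomial_update_smul _ _ _ _ hi, monomial_update_of_notMem _ _ _ _ hi',
        monomial_update_of_notMem _ _ _ _ hi', map_smul, map_smul, smul_mul_assoc]
    · have hi' : i ∈ Iᶜ := by simpa using hi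
      rw [monomial_update_smul _ _ _ _ hi', monomial_update_of_notMem _ _ _ _ hi,
        monomial_update_of_notMem _ _ _ _ hi, mul_smul_comm]
  have hadd : ∀ (x : Fin m → GraphComplex O) i a b (I : Finset (Fin m)),
      incl (GraphComplex.degree O) (bracket c (monomial (GraphComplex.degree O)
        (Function.update x i (a + b)) I)) *
          monomial (GraphComplex.degree O) (Function.update x i (a + b)) Iᶜ =
      incl (GraphComplex.degree O) (bracket c (monomial (GraphComplex.degree O)
        (Function.update x i a) I)) *
          monomial (GraphComplex.degree O) (Function.update x i a) Iᶜ +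
      incl (GraphComplex.degree O) (bracket c (monomial (GraphComplex.degree O)
        (Function.update x i b) I)) *
          monomial (GraphComplex.degree O) (Function.update x i b) Iᶜ := by
    intro x i a b I
    by_cases hi : i ∈ I
    · have hi' : i ∉ Iᶜ := by simpa using hi
      rw [monomial_update_add _ _ _ _ hi, monomial_update_of_notMem _ _ _ _ hi',
        monomial_update_of_notMem _ _ _ _ hi', monomial_update_of_notMem _ _ _ _ hi',
        map_add, map_add, add_mul]
    · have hi' : i ∈ Iᶜ := by simpa using hi
      rw [monomial_update_add _ _ _ _ hi', monomial_update_of_notMem _ _ _ _ hi,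
        monomial_update_of_notMem _ _ _ _ hi, monomial_update_of_notMem _ _ _ _ hi, mul_add]
  have hs : ∀ (x : Fin m → GraphComplex O) i (r : k) a,
      coderivation c (monomial (GraphComplex.degree O) (Function.update x i a) Finset.univ) =
        ∑ I : Finset (Fin m), koszulSign k d I • (incl (GraphComplex.degree O)
          (bracket c (monomial (GraphComplex.degree O) (Function.update x i a) I)) *
            monomial (GraphComplex.degree O) (Function.update x i a) Iᶜ) →
      coderivation c (monomial (GraphComplex.degree O) (Function.update x i (r • a)) Finset.univ) =
        ∑ I : Finset (Fin m), koszulSign k d I • (incl (GraphComplex.degree O)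
          (bracket c (monomial (GraphComplex.degree O) (Function.update x i (r • a)) I)) *
            monomial (GraphComplex.degree O) (Function.update x i (r • a)) Iᶜ) := by
    intro x i r a h
    rw [monomial_update_smul _ _ _ _ (Finset.mem_univ i), map_smul, h, Finset.smul_sum]
    refine Finset.sum_congr rfl fun I _ => ?_
    rw [hsmul, smul_comm]
  refine span_pi_induction (P := fun x => coderivation c (monomial (GraphComplex.degree O) x
    Finset.univ) = ∑ I : Finset (Fin m), koszulSign k d I • (incl (GraphComplex.degree O)
        (bracket c (monomial (GraphComplex.degree O) x I)) *
          monomial (GraphComplex.degree O) x Iᶜ)) ?_ ?_ ?_ hs x hx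
  · intro x hx
    choose G hG hGx using hx
    obtain rfl : (fun i => (G i).cls) = x := funext hGx
    obtain rfl : (fun i => (Nat.card (G i).V : ℤ)) = d := funext hG
    exact coderivation_monomial_cls c G
  · intro x i
    have h := monomial_update_smul (k := k) (GraphComplex.degree O) x i Finset.univ
      (Finset.mem_univ i) 0 0
    rw [zero_smul, zero_smul] at h
    rw [h, map_zero]
    refine (Finset.sum_eq_zero fun I _ => ?_).symm
    have h' := hsmul x i 0 0 I
    rw [zero_smul, zero_smul] at h'
    rw [h', smul_zero]
  · intro x i a b ha hb
    rw [monomial_update_add _ _ _ _ (Finset.mem_univ i), map_add, ha, hb,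
      ← Finset.sum_add_distrib]
    refine Finset.sum_congr rfl fun I _ => ?_
    rw [hadd, smul_add]

theorem isLieInfinity_coderivation (c : ℕ → k) :
    IsLieInfinity (GraphComplex.degree O) (coderivation c) :=
  ⟨⟨bracket c, bracket_one c, fun _ x d hx =>
    ⟨bracket_monomial_mem c x d hx, coderivation_monomial c x d hx⟩⟩, coderivation_sq c⟩

end SymGraph

namespace SymGraph

open OGraph

variable {k : Type u} [Field k] {O : CyclicOperad.{u, w} k}

/-! ### Sums of the fusion operations -/

theorem coderivation_word_eq_smul (c : ℕ → k) (w : List (OGraph O)) :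
    coderivation c (word w) = splitSum k vdeg w fun u v =>
      c u.length • (incl (GraphComplex.degree O) (bracketWord u) * word v) := by
  rw [coderivation_word]
  refine splitSum_congr vdeg fun u v _ => ?_
  rw [bracket_word, map_smul, smul_mul_assoc]

variable (O) in
/-- The coderivation with given coefficients of the brackets, as a function of the coefficients. -/
noncomputable def coderivationLinear : (ℕ → k) →ₗ[k] Module.End k (SymGraphComplex O) where
  toFun := coderivation
  map_add' c c' := ext_word fun w => by
    rw [LinearMap.add_apply, coderivation_word_eq_smul, coderivation_word_eq_smul,
      coderivation_word_eq_smul, ← splitSum_add]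
    refine splitSum_congr vdeg fun u v _ => ?_
    rw [Pi.add_apply, add_smul]
  map_smul' r c := ext_word fun w => by
    rw [LinearMap.smul_apply, coderivation_word_eq_smul, coderivation_word_eq_smul, RingHom.id_apply,
      ← map_smul]
    refine splitSum_congr vdeg fun u v _ => ?_
    rw [Pi.smul_apply, Pi.smul_apply, Pi.smul_apply, smul_assoc]

/-- A bracket on a word takes between one and all of its letters; the coefficient at 0 is irrelevant
because the bracket of no letters is zero. -/
theorem coderivation_word_eq_zero (c : ℕ → k) (w : List (OGraph O))
    (hc : ∀ n, 1 ≤ n → n ≤ w.length → c n = 0) : coderivation c (word w) = 0 := by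
  rw [coderivation_word_eq_smul]
  refine splitSum_eq_zero vdeg fun u v p => ?_
  have hl := p.length_eq
  rw [List.length_append] at hl
  cases u with
  | nil => rw [bracketWord_nil, map_zero, zero_mul, smul_zero]
  | cons A u => rw [hc _ (by simp) (by omega), zero_smul]

/-- Only finitely many coefficients matter for the value on a given element. -/
theorem exists_coderivation_eq_zero (x : SymGraphComplex O) :
    ∃ N : ℕ, ∀ c : ℕ → k, (∀ n, 1 ≤ n → n ≤ N → c n = 0) → coderivation c x = 0 := by
  have hx : x ∈ Submodule.span k (Set.range (word (O := O))) := by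
    rw [span_word]
    exact Submodule.mem_top
  induction hx using Submodule.span_induction with
  | mem x h =>
    obtain ⟨w, rfl⟩ := h
    exact ⟨w.length, fun c => coderivation_word_eq_zero c w⟩
  | zero => exact ⟨0, fun c _ => map_zero _⟩
  | add x y _ _ hx hy =>
    obtain ⟨N, hN⟩ := hx
    obtain ⟨M, hM⟩ := hy
    refine ⟨max N M, fun c hc => ?_⟩
    rw [map_add, hN c fun n h h' => hc n h (h'.trans (le_max_left _ _)),
      hM c fun n h h' => hc n h (h'.trans (le_max_right _ _)), add_zero]
  | smul r x _ hx =>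
    obtain ⟨N, hN⟩ := hx
    exact ⟨N, fun c hc => by rw [map_smul, hN c hc, smul_zero]⟩

open Classical in
/-- The sum of the fusion operations with indices in `I`. -/
noncomputable def fusionSumOver (O : CyclicOperad.{u, w} k) (I : Set ℕ+) :
    Module.End k (SymGraphComplex O) :=
  coderivation fun n => if ∃ i ∈ I, (i : ℕ) = n then 1 else 0

theorem isPointwiseSum_fusionSumOver (I : Set ℕ+) :
    IsPointwiseSum (fun n : ℕ+ => coderivation (O := O) (Pi.single (n : ℕ) 1)) I
      (fusionSumOver O I) := by
  classical
  intro x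
  obtain ⟨N, hN⟩ := exists_coderivation_eq_zero x
  have hfin : {i : ℕ+ | (i : ℕ) ≤ N}.Finite :=
    (Set.finite_Iic N).preimage PNat.coe_injective.injOn
  have hz : ∀ i : ℕ+, coderivation (Pi.single (i : ℕ) 1) x ≠ 0 → (i : ℕ) ≤ N := fun i h => by
    by_contra hi
    exact h (hN _ fun n _ hn => Pi.single_eq_of_ne (by omega) _)
  refine ⟨hfin.subset fun i h => hz i h.2, ?_⟩
  have hI : (I ∩ {i : ℕ+ | (i : ℕ) ≤ N}).Finite := hfin.inter_of_right I
  have h1 : ∑ᶠ i ∈ I, coderivation (Pi.single (i : ℕ) 1) x =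
      ∑ i ∈ hI.toFinset, coderivation (Pi.single (i : ℕ) 1) x := by
    rw [← finsum_mem_coe_finset, Set.Finite.coe_toFinset]
    refine finsum_mem_inter_support_eq _ _ _ ?_
    ext i
    simp only [Set.mem_inter_iff, Function.mem_support, Set.mem_ofPred_eq]
    exact ⟨fun h => ⟨⟨h.1, hz i h.2⟩, h.2⟩, fun h => ⟨h.1.1, h.2⟩⟩
  refine Eq.trans ?_ h1.symm
  have h2 : ∑ i ∈ hI.toFinset, coderivation (Pi.single (i : ℕ) 1) x =
      coderivationLinear O (∑ i ∈ hI.toFinset, Pi.single (i : ℕ) 1) x := by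
    rw [map_sum, LinearMap.sum_apply]
    rfl
  -- By linearity in the coefficients it is enough that the indicator of `I` and the finite sum of
  -- unit sequences agree at the indices from 1 to `N`, the only ones that matter for `x`.
  rw [h2, ← sub_eq_zero]
  refine (congrArg (· x) (map_sub (coderivationLinear O) _ _)).symm.trans (hN _ ?_)
  intro n h0 hn
  rw [Pi.sub_apply, Finset.sum_apply, sub_eq_zero]
  obtain ⟨n, rfl⟩ : ∃ m : ℕ+, (m : ℕ) = n := ⟨⟨n, h0⟩, rfl⟩
  by_cases hnI : n ∈ I
  · rw [if_pos ⟨n, hnI, rfl⟩, Finset.sum_eq_single n, Pi.single_eq_same]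
    · intro b _ hb
      exact Pi.single_eq_of_ne (fun h => hb (PNat.coe_injective h.symm)) _
    · intro h
      exact absurd (hI.mem_toFinset.2 ⟨hnI, hn⟩) h
  · rw [if_neg, Finset.sum_eq_zero]
    · intro b hb
      have := (hI.mem_toFinset.1 hb).1
      refine Pi.single_eq_of_ne (fun h => hnI ?_) _
      rwa [PNat.coe_injective h]
    · rintro ⟨i, hi, h⟩
      exact hnI (PNat.coe_injective h ▸ hi)

/-! ### Projection to a fixed number of factors -/

theorem lengthPart_mem (r : ℕ) :
    (fun w : List (OGraph O) => if w.length = r then word w else 0) ∈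
      wordFunctions O (SymGraphComplex O) := by
  refine mem_wordFunctions (fun v A B e => ?_) (fun v A a p q => ?_) (fun v A a c p => ?_)
    (fun u v A B => ?_)
  · simp only [List.length_cons, smul_ite, smul_zero]
    rw [word_cons, word_cons, e.cls_eq, map_smul, smul_mul_assoc]
  · simp only [List.length_cons]
    split_ifs
    · rw [word_cons, word_cons, word_cons, cls_setLabel_add, map_add, add_mul]
    · rw [add_zero]
  · simp only [List.length_cons, smul_ite, smul_zero]
    rw [word_cons, word_cons, cls_setLabel_smul, map_smul, smul_mul_assoc]
  · simp only [List.length_append, List.length_cons, smul_ite, smul_zero]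
    rw [word_swap]

/-- The projection of the symmetric algebra to its part with `r` factors. -/
noncomputable def lengthPart (O : CyclicOperad.{u, w} k) (r : ℕ) :
    Module.End k (SymGraphComplex O) :=
  lift ⟨_, lengthPart_mem r⟩

theorem lengthPart_incl_mul (r : ℕ) (y : GraphComplex O) (v : List (OGraph O)) :
    lengthPart O r (incl (GraphComplex.degree O) y * word v) =
      if v.length + 1 = r then incl (GraphComplex.degree O) y * word v else 0 := by
  have hy : y ∈ Submodule.span k (Set.range (OGraph.cls (O := O))) := by
    rw [span_cls]
    exact Submodule.mem_top
  induction hy using Submodule.span_induction with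
  | mem y h =>
    obtain ⟨A, rfl⟩ := h
    rw [← word_cons]
    exact lift_word _ (A :: v)
  | zero => rw [map_zero, zero_mul, map_zero, ite_self]
  | add x y _ _ hx hy =>
    rw [map_add, add_mul, map_add, hx, hy]
    split_ifs
    · rfl
    · rw [add_zero]
  | smul c x _ hx => rw [map_smul, smul_mul_assoc, map_smul, hx, smul_ite, smul_zero]

/-- A bracket of `n` letters replaces them by one factor, so the number of factors in the result
isolates the contribution of `n`. -/
theorem lengthPart_coderivation_word (c : ℕ → k) (w : List (OGraph O)) {n : ℕ}
    (hn : n ≤ w.length) : lengthPart O (w.length - n + 1) (coderivation c (word w)) =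
      c n • coderivation (Pi.single n 1) (word w) := by
  rw [coderivation_word_eq_smul, coderivation_word_eq_smul, splitSum_map, ← map_smul]
  refine splitSum_congr vdeg fun u v p => ?_
  have hl := p.length_eq
  rw [List.length_append] at hl
  rw [map_smul, lengthPart_incl_mul, Pi.smul_apply, Pi.smul_apply]
  by_cases h : u.length = n
  · rw [if_pos (by omega), h, Pi.single_eq_same, one_smul]
  · rw [if_neg (by omega), Pi.single_eq_of_ne h, zero_smul, smul_zero, smul_zero]

/-- A coderivation determines the coefficients of the nonzero fusion operations. -/
theorem eq_of_coderivation_eq {c c' : ℕ → k} (h : coderivation (O := O) c = coderivation c')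
    {n : ℕ} (hn : coderivation (O := O) (Pi.single n 1) ≠ 0) : c n = c' n := by
  obtain ⟨w, hw⟩ : ∃ w : List (OGraph O), coderivation (Pi.single n 1) (word w) ≠ 0 := by
    by_contra! hw
    exact hn (ext_word hw)
  have hl : n ≤ w.length := by
    by_contra hl
    exact hw (coderivation_word_eq_zero _ _ fun m _ hm => Pi.single_eq_of_ne (by omega) _)
  have := lengthPart_coderivation_word c w hl
  rw [h, lengthPart_coderivation_word c' w hl] at this
  exact (smul_left_injective k hw this).symm

theorem fusionSumOver_eq_iff (I J : Set ℕ+) : fusionSumOver O I = fusionSumOver O J ↔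
    ∀ n : ℕ+, coderivation (O := O) (Pi.single (n : ℕ) 1) ≠ 0 → (n ∈ I ↔ n ∈ J) := by
  classical
  constructor
  · intro h n hn
    have hc := eq_of_coderivation_eq h hn
    have hmem : ∀ I : Set ℕ+, (∃ i ∈ I, (i : ℕ) = n) ↔ n ∈ I := fun I =>
      ⟨fun ⟨i, hi, e⟩ => PNat.coe_injective e ▸ hi, fun hi => ⟨n, hi, rfl⟩⟩
    -- Membership can be recovered from the indicator because `1 ≠ 0` in a field.
    have hone : ∀ p q : Prop, (if p then (1 : k) else 0) = (if q then 1 else 0) → (p ↔ q) := by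
      intro p q
      split_ifs with hp hq hq <;> simp [hp, hq]
    rw [← hmem I, ← hmem J]
    exact hone _ _ hc
  · intro h
    ext x
    rw [(isPointwiseSum_fusionSumOver I x).2, (isPointwiseSum_fusionSumOver J x).2]
    refine finsum_mem_inter_support_eq _ _ _ ?_
    ext n
    refine and_congr_left fun hn => h n fun h0 => hn ?_
    simp only [h0, LinearMap.zero_apply]

end SymGraph

/-! ### Counting the structures, and the theorem -/

/-- A countable range would give an injection from the subsets of `T` into the natural numbers,
hence into `T`, against Cantor. -/
theorem not_countable_range_of_injOn_powerset {α β : Type*} (Φ : Set α → β) (T : Set α)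
    (hT : T.Infinite) (hΦ : Set.InjOn Φ (Set.powerset T)) : ¬ (Set.range Φ).Countable := by
  intro hc
  have : Countable (Set.range Φ) := hc
  have : Infinite T := hT.to_subtype
  have hinj : Function.Injective fun A : Set T =>
      (⟨Φ (Subtype.val '' A), Set.mem_range_self _⟩ : Set.range Φ) := by
    intro A B h
    exact Set.image_injective.2 Subtype.val_injective
      (hΦ (by rintro _ ⟨a, -, rfl⟩; exact a.2) (by rintro _ ⟨a, -, rfl⟩; exact a.2)
        (congrArg Subtype.val h))
  have : Countable (Set T) := hinj.countable
  obtain ⟨f, hf⟩ := exists_injective_nat (Set T)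
  exact Function.cantor_injective _ ((Infinite.natEmbedding T).injective.comp hf)

theorem mainTheorem2 {k : Type u} [Field k] (O : CyclicOperad.{u, w} k) :
    (∃! φ : ℕ+ → Module.End k (SymGraphComplex O), ∀ n, IsFusion O n (φ n)) ∧
    ∀ φ : ℕ+ → Module.End k (SymGraphComplex O), (∀ n, IsFusion O n (φ n)) →
      ∃ Φ : Set ℕ+ → Module.End k (SymGraphComplex O),
        (∀ I, IsPointwiseSum φ I (Φ I)) ∧
        (∀ I, Φ I ∘ₗ Φ I = 0) ∧
        (∀ I, GradedSym.IsLieInfinity (GraphComplex.degree O) (Φ I)) ∧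
        (∀ I J, Φ I = Φ J ↔ ∀ n, φ n ≠ 0 → (n ∈ I ↔ n ∈ J)) ∧
        ({n | φ n ≠ 0}.Infinite → ¬ (Set.range Φ).Countable) := by
  have huniq : ∀ φ : ℕ+ → Module.End k (SymGraphComplex O), (∀ n, IsFusion O n (φ n)) →
      φ = fun n : ℕ+ => SymGraph.coderivation (Pi.single (n : ℕ) 1) :=
    fun φ h => funext fun n => SymGraph.IsFusion.eq_coderivation (h n)
  refine ⟨⟨_, SymGraph.isFusion_coderivation, huniq⟩, fun φ hφ => ?_⟩
  obtain rfl := huniq φ hφ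
  refine ⟨SymGraph.fusionSumOver O, SymGraph.isPointwiseSum_fusionSumOver,
    fun I => SymGraph.coderivation_sq _, fun I => SymGraph.isLieInfinity_coderivation _,
    SymGraph.fusionSumOver_eq_iff, fun hT => not_countable_range_of_injOn_powerset _ _ hT ?_⟩
  -- Here `T` is the set of indices of nonzero operations. Subsets of `T` that give the same sum
  -- agree at these indices, and outside of them both are empty.
  intro I hI J hJ h
  ext n
  by_cases hn : SymGraph.coderivation (O := O) (Pi.single (n : ℕ) 1) = 0
  · exact ⟨fun h => absurd hn (hI h), fun h => absurd hn (hJ h)⟩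
  · exact (SymGraph.fusionSumOver_eq_iff I J).1 h n hn
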